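/- **Setting.** Let $C$ be a field of characteristic $0$, let $(D,\leqslant)$ be a non-empty directed set, and let $(\Gamma_d)_{d\in D}$ be a directed system, for inclusion, of non-trivial (linearly) ordered Abelian groups, with direct limit (union) $\Gamma$. Let $\mathbb{S}_d = C((\Gamma_d))$ be the field of Hahn series with coefficients in $C$ and exponents in $\Gamma_d$, and let $\mathbb{S}=\bigcup_{d}\mathbb{S}_d$, with valuation $v(f)=\min \operatorname{supp} f$ and $v(0)=+\infty$. Write $f\prec g$ if $v(f)>v(g)$, $f \preccurlyeq g$ if $v(f)\geqslant v(g)$, and $f\sim g$ if $v(f-g)>v(f)$. A family in $\mathbb{S}$ is summable if it takes values in some $\mathbb{S}_d$ and is summable there. Let $\partial : f\mapsto f'$ be a $C$-linear derivation on $\mathbb{S}$ with kernel $C$ which is regular, i.e. for each $d \in D$ it maps $\mathbb{S}_d$ into itself and commutes with sums of summable families in $\mathbb{S}_d$. Write $f^\dagger = f'/f$ for $f \neq 0$. Assume that $(\mathbb{S},\preccurlyeq,\partial)$ is an H-asymptotic field: for all nonzero $f,g\prec 1$, $$f\prec g \iff f'\prec g', \qquad\text{and}\qquad f\prec g\implies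 f^\dagger\succcurlyeq g^\dagger .$$ Then for $\gamma=v(a)\in\Gamma\setminus\{0\}$, the values $\gamma' := v(a')$ and $\gamma^\dagger := v(a^\dagger)$ depend only on $\gamma$. Write $X'=\{\gamma' : \gamma\in X\setminus\{0\}\}$ for $X\subseteq\Gamma$, and $\Psi=\{\gamma^\dagger : \gamma\in\Gamma,\ \gamma>0\}$. A pseudo-gap is an element of $\Gamma \setminus (\Gamma\setminus\{0\})'$. We say that $\mathbb{S}$ has *regular asymptotic integration* if 1. for each nonzero $f\in\mathbb{S}$ there is an $A\in\mathbb{S}$ with $A'\sim f$; and 2. for each $d\in D$ there is a $d_1\geqslant d$ such that for each nonzero $f\in\mathbb{S}_d$ whose valuation is not a pseudo-gap, there is a term $\tau = c\,t^{\gamma}\in\mathbb{S}_{d_1}$ (a series with at most one exponent $\gamma$, and coefficient $c \in C$) with $\tau'\in\mathbb{S}_d$ and $\tau'\sim f$. Let $\operatorname{Cont}(\partial)$ be the set of all $f\in\mathbb{S}$ such that $f a'\prec a$ for all nonzero $a\in\mathbb{S}$, and let $[\![f,g]\!]=f g'-f'g$. **Theorem (Main Theorem 1).** Suppose that $\mathbb{S}$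 has regular asymptotic integration. Then $\operatorname{Cont}(\partial)$ is a group under the Baker–Campbell–Hausdorff operation $$f\ast g = f+g+\tfrac12[\![f,g]\!]+\tfrac1{12}\big([\![f,[\![f,g]\!]]\!]-[\![g,[\![f,g]\!]]\!]\big)+\cdots$$ (the sum of a summable family, the $n$-th member of which is the homogeneous component of degree $n$ of the Baker–Campbell–Hausdorff series), and for all nonzero $f,g\in\operatorname{Cont}(\partial)$ the following are equivalent: * (i) $f$ and $g$ are conjugate in the group $(\operatorname{Cont}(\partial),\ast)$; * (ii) $f\sim g$ and $v\big(\frac{f-g}{g^2}\big)>(-v(g)-\Psi)'$, i.e. $v\big(\frac{f-g}{g^2}\big)$ is strictly larger than every element of $(-v(g)-\Psi)'=\{(-v(g)-\psi)' : \psi\in\Psi\}$; * (iii) $v(f-g)>v(g)$, and $v(f-g)>v\Big(g^2\big(\tfrac{h}{g h'}\big)'\Big)$ for all nonzero $h\in\mathbb{S}$ with $v(h)>0$. -/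

import Mathlib

universe u v w

/-! ### The formal Baker-Campbell-Hausdorff series -/

section BCH

variable {M : Type*} [AddCommGroup M] (br : M → M → M)

/-- For a sequence `Z : ℕ → M`, thought of as `Z(t) = ∑_{m ≥ 1} Z_m t ^ m`, `adPowCoeff br Z w k n` is
the coefficient of `t ^ n` in `(ad Z(t)) ^ k w`, i.e. the sum over all `m₁, …, m_k ≥ 1` with
`m₁ + ⋯ + m_k = n` of the nested brackets `[Z_{m₁}, [Z_{m₂}, … [Z_{m_k}, w]]]`. -/
def adPowCoeff (Z : ℕ → M) (w : M) : ℕ → ℕ → M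
  | 0, n => if n = 0 then w else 0
  | k + 1, n => ∑ m ∈ Finset.Icc 1 n, br (Z m) (adPowCoeff Z w k (n - m))

variable (K : Type*) [Field K] [Module K M]

/-- `bchPrefix br K x y n m` is the homogeneous component of degree `m` of the
Baker-Campbell-Hausdorff series if `m ≤ n`, and `0` otherwise. -/
def bchPrefix (x y : M) : ℕ → ℕ → M
  | 0 => fun _ => 0
  | n + 1 => Function.update (bchPrefix x y n) (n + 1)
      (((n : K) + 1)⁻¹ • ∑ k ∈ Finset.range (n + 1),
        ((bernoulli k / (Nat.factorial k : ℚ) : ℚ) : K) •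
          adPowCoeff br (bchPrefix x y n) (x + (-1 : K) ^ k • y) k n)

/-- The homogeneous component of degree `n` of the Baker-Campbell-Hausdorff series in `x` and `y`,
for the bracket `br` and over a field `K` of characteristic zero. With `Z_n` this component,
`Z(t) = ∑_{n ≥ 1} Z_n t ^ n = log (exp (t x) exp (t y))` is the solution with `Z(0) = 0` of
`Z'(t) = (ad Z / (exp (ad Z) - 1)) x + (ad Z / (1 - exp (- ad Z))) y`. Comparing coefficients of
`t ^ n`, this is the classical recursion
`(n + 1) Z_{n+1} = ∑_k (B_k / k!) ∑_{m₁ + ⋯ + m_k = n} [Z_{m₁}, [… [Z_{m_k}, x + (-1) ^ k y]]]`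
(`B_k` Bernoulli numbers, `B_1 = -1/2`), so that `Z_1 = x + y`, `Z_2 = [x, y] / 2`,
`Z_3 = ([x, [x, y]] - [y, [x, y]]) / 12`, and so on. -/
def bchTerm (x y : M) (n : ℕ) : M := bchPrefix br K x y n n

end BCH

namespace HahnLimit

/-! ### Hahn fields and their direct limits -/

section Field

variable (C : Type w) [Field C]
variable {Γ : Type u} [AddCommGroup Γ] [LinearOrder Γ] [IsOrderedAddMonoid Γ]

theorem mem_range_of_support_subset (H : AddSubgroup Γ) {f : HahnSeries Γ C}
    (hf : f.support ⊆ H) :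
    f ∈ (HahnSeries.embDomainRingHom (R := C) H.subtype H.subtype_injective
      (fun _ _ => Iff.rfl)).fieldRange := by
  have hP : Set.IsPWO {a : H | f.coeff (a : Γ) ≠ 0} := by
    rw [Set.isPWO_iff_isWF, Set.isWF_iff_no_descending_seq]
    intro s hs hmem
    have := f.isWF_support
    rw [Set.isWF_iff_no_descending_seq] at this
    exact this (fun n => (s n : Γ)) (fun a b hab => hs hab) (fun n => hmem n)
  refine ⟨⟨fun a => f.coeff (a : Γ), hP⟩, ?_⟩
  ext γ
  by_cases hγ : γ ∈ H
  · exact HahnSeries.embDomain_coeff (f := ⟨⟨H.subtype, H.subtype_injective⟩, Iff.rfl⟩)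
      (a := (⟨γ, hγ⟩ : H))
  · have h1 : f.coeff γ = 0 := by
      by_contra h
      exact hγ (hf h)
    rw [h1]
    refine HahnSeries.embDomain_of_notMem_range
      (f := ⟨⟨H.subtype, H.subtype_injective⟩, fun {_ _} => Iff.rfl⟩) ?_
    rintro ⟨a, rfl⟩
    exact hγ a.2

theorem support_subset_of_mem_range (H : AddSubgroup Γ) {f : HahnSeries Γ C}
    (hf : f ∈ (HahnSeries.embDomainRingHom (R := C) H.subtype H.subtype_injective
      (fun _ _ => Iff.rfl)).fieldRange) : f.support ⊆ H := by
  obtain ⟨g, rfl⟩ := hf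
  intro γ hγ
  obtain ⟨a, _, rfl⟩ := HahnSeries.support_embDomain_subset hγ
  exact a.2

/-- For a subgroup `H` of `Γ`, the field `C((H))` of Hahn series with coefficients in `C` and
exponents in `H`, as a subfield of `C((Γ))`. -/
noncomputable def hahnSubfield (H : AddSubgroup Γ) : IntermediateField C (HahnSeries Γ C) where
  carrier := {f | f.support ⊆ H}
  zero_mem' := by simp
  one_mem' := support_subset_of_mem_range C H (one_mem _)
  add_mem' hf hg := support_subset_of_mem_range C H
    (add_mem (mem_range_of_support_subset C H hf) (mem_range_of_support_subset C H hg))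
  mul_mem' hf hg := support_subset_of_mem_range C H
    (mul_mem (mem_range_of_support_subset C H hf) (mem_range_of_support_subset C H hg))
  inv_mem' _ hf := support_subset_of_mem_range C H
    (inv_mem (mem_range_of_support_subset C H hf))
  algebraMap_mem' c := by
    intro γ hγ
    have h : (algebraMap C (HahnSeries Γ C)) c = HahnSeries.single 0 c := by
      simp [HahnSeries.algebraMap_apply]
    rw [h] at hγ
    have : γ = 0 := by simpa using HahnSeries.support_single_subset hγ
    rw [this]
    exact H.zero_mem

variable {D : Type v} [Preorder D] [IsDirectedOrder D] [Nonempty D] (G : D →o AddSubgroup Γ)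

/-- The direct limit `𝕊` of the Hahn fields `𝕊_d = C((Γ_d))` along the inclusions, where
`Γ_d = G d` is a directed system of subgroups of `Γ`: it is the union of the `𝕊_d` in `C((Γ))`. -/
noncomputable def limitField : IntermediateField C (HahnSeries Γ C) where
  carrier := {f | ∃ d, f ∈ hahnSubfield C (G d)}
  zero_mem' := ⟨Classical.arbitrary D, zero_mem _⟩
  one_mem' := ⟨Classical.arbitrary D, one_mem _⟩
  add_mem' := by
    rintro f g ⟨d, hf⟩ ⟨e, hg⟩
    obtain ⟨c, hdc, hec⟩ := exists_ge_ge d e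
    exact ⟨c, add_mem (S := IntermediateField C (HahnSeries Γ C))
      (show f ∈ hahnSubfield C (G c) from fun _ h => G.monotone hdc (hf h))
      (show g ∈ hahnSubfield C (G c) from fun _ h => G.monotone hec (hg h))⟩
  mul_mem' := by
    rintro f g ⟨d, hf⟩ ⟨e, hg⟩
    obtain ⟨c, hdc, hec⟩ := exists_ge_ge d e
    exact ⟨c, mul_mem (S := IntermediateField C (HahnSeries Γ C))
      (show f ∈ hahnSubfield C (G c) from fun _ h => G.monotone hdc (hf h))
      (show g ∈ hahnSubfield C (G c) from fun _ h => G.monotone hec (hg h))⟩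
  inv_mem' := by
    rintro f ⟨d, hf⟩
    exact ⟨d, inv_mem (S := IntermediateField C (HahnSeries Γ C)) hf⟩
  algebraMap_mem' c := ⟨Classical.arbitrary D, (hahnSubfield C (G _)).algebraMap_mem c⟩

/-- `𝕊_d = C((Γ_d))` as a subset of `𝕊`. -/
def level (d : D) : Set (limitField C G) :=
  {f | (f : HahnSeries Γ C) ∈ hahnSubfield C (G d)}

variable {C G}

/-- The valuation `v f = min (supp f)` on `𝕊`, with `v 0 = ⊤`. -/
noncomputable def val (f : limitField C G) : WithTop Γ := (f : HahnSeries Γ C).orderTop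

/-- `f ∼ g`, i.e. `v (f - g) > v f`. -/
def Asymp (f g : limitField C G) : Prop := val f < val (f - g)

/-- The family `F` of elements of `𝕊` takes values in some `𝕊_d`, is summable there, and has
sum `s`. -/
def HasStrongSum {ι : Type*} (F : ι → limitField C G) (s : limitField C G) : Prop :=
  ∃ d, (∀ i, F i ∈ level C G d) ∧
    ∃ T : HahnSeries.SummableFamily Γ C ι,
      (∀ i, T i = (F i : HahnSeries Γ C)) ∧ T.hsum = (s : HahnSeries Γ C)

/-- A map `φ : 𝕊 → 𝕊` is regular if it maps each `𝕊_d` into itself, and commutes there with sums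
of summable families. -/
def IsRegularMap (φ : limitField C G → limitField C G) : Prop :=
  ∀ d, (∀ f ∈ level C G d, φ f ∈ level C G d) ∧
    ∀ (ι : Type u) (F : ι → limitField C G) (s : limitField C G),
      (∀ i, F i ∈ level C G d) → HasStrongSum F s →
        HasStrongSum (fun i => φ (F i)) (φ s)

variable (der : Derivation C (limitField C G) (limitField C G))

/-- The kernel of the derivation is the field `C` of constants. -/
def KernelEqConstants : Prop :=
  ∀ f : limitField C G, der f = 0 ↔ f ∈ Set.range (algebraMap C (limitField C G))

/-- `(𝕊, ≼, ∂)` is an H-asymptotic field: for nonzero infinitesimal `f` and `g` we have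
`f ≺ g ↔ f' ≺ g'`, and `f ≺ g` implies `f† ≽ g†`. -/
def IsHAsymptotic : Prop :=
  ∀ f g : limitField C G, f ≠ 0 → g ≠ 0 → 0 < val f → 0 < val g →
    (val g < val f ↔ val (der g) < val (der f)) ∧
      (val g < val f → val (der f / f) ≤ val (der g / g))

/-- The image `X' = {γ' : γ ∈ X, γ ≠ 0}` of a set `X ⊆ Γ` under the map
`Γ ∖ {0} → Γ, v(a) ↦ v(a')` of the asymptotic couple. -/
def derivImage (X : Set Γ) : Set Γ :=
  {δ | ∃ γ ∈ X, γ ≠ 0 ∧ ∃ a : limitField C G, val a = γ ∧ val (der a) = δ}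

/-- The set `Ψ = {γ† : γ ∈ Γ, γ > 0}`, where `γ† = v(a'/a)` if `γ = v(a)`. -/
def PsiSet : Set Γ :=
  {ψ | ∃ γ : Γ, 0 < γ ∧ ∃ a : limitField C G, val a = γ ∧ val (der a / a) = ψ}

/-- `γ` is a pseudo-gap: it does not lie in `(Γ ∖ {0})'`. -/
def IsPseudoGap (γ : Γ) : Prop := γ ∉ derivImage der Set.univ

/-- Every nonzero series has an asymptotic integral. -/
def ClosedUnderAsymptoticIntegration : Prop :=
  ∀ f : limitField C G, f ≠ 0 → ∃ A : limitField C G, Asymp (der A) f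

/-- Asymptotic integration is regular: for each `d` there is `d₁ ≥ d` such that each nonzero
`f ∈ 𝕊_d` whose valuation is not the pseudo-gap is asymptotic to the derivative, in `𝕊_d`, of a
term `c 𝔪` (with `c ∈ C` and `𝔪` a monomial) of `𝕊_{d₁}`. -/
def AsymptoticIntegrationRegular : Prop :=
  ∀ d, ∃ d₁, d ≤ d₁ ∧ ∀ f ∈ level C G d, f ≠ 0 →
    (∀ γ : Γ, val f = γ → ¬ IsPseudoGap der γ) →
      ∃ τ ∈ level C G d₁, (∃ (γ : Γ) (c : C), (τ : HahnSeries Γ C) = HahnSeries.single γ c) ∧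
        der τ ∈ level C G d ∧ Asymp (der τ) f

/-- `𝕊` has regular asymptotic integration. -/
def HasRegularAsymptoticIntegration : Prop :=
  ClosedUnderAsymptoticIntegration der ∧ AsymptoticIntegrationRegular der

/-- The contractive hull of `∂`: the set of `f ∈ 𝕊` such that `f ∂` is contracting, i.e. such that
`f ∂(a) ≺ a` for all `a ≠ 0`. -/
def ContractiveHull : Set (limitField C G) := {f | ∀ a : limitField C G, a ≠ 0 → val a < val (f * der a)}

/-- The bracket `⟦f, g⟧ = f ∂(g) - ∂(f) g`, i.e. `⟦f, g⟧ ∂` is the commutator of `f ∂` and `g ∂`. -/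
noncomputable def bracket (f g : limitField C G) : limitField C G := f * der g - der f * g

/-- `k = f ∗ g` is the sum of the Baker-Campbell-Hausdorff series
`f + g + ⟦f, g⟧ / 2 + (⟦f, ⟦f, g⟧⟧ - ⟦g, ⟦f, g⟧⟧) / 12 + ⋯`, which is summable. -/
def IsBCHProduct (f g k : limitField C G) : Prop :=
  HasStrongSum (fun n : ℕ => bchTerm (bracket der) C f g n) k

end Field

end HahnLimit

open HahnLimit

/-!
The idea is to work with the operators `f ∂` on `𝕊` instead of the elements `f` of `Cont(∂)`. By
definition `f ∂` is contracting for `f ∈ Cont(∂)`, and `f ↦ f ∂` turns the bracket `⟦f, g⟧` into the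
commutator of operators.

*The group.* Words in finitely many strongly linear contracting operators, applied to a series, form
a summable family (`summ_words`, a minimal bad sequence argument as in Higman's lemma). So the
exponential `exp (f ∂) = ∑ (f ∂) ^ n / n!` exists, and the Baker-Campbell-Hausdorff series of
`f, g ∈ Cont(∂)` is summable (`summ_bchTerm`). In formal power series over an associative algebra,
the recursion defining the Baker-Campbell-Hausdorff components says that `Z(t)` solves the
differential equation for which `exp (Z(t)) = exp (t x) exp (t y)` (`coeff_exp_bchSeries`). Setting
`t = 1` gives `exp ((f ∗ g) ∂) = exp (f ∂) exp (g ∂)` (`expOp_vf_of_isBCHProduct`). As `f` is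
determined by `exp (f ∂)` (`eq_of_expOp_vf_eq`), the group axioms for `∗` are inherited from the
composition of operators (`bchGroup`).

*Conjugacy.* Write an element of `Cont(∂)` as `k g`. If `z` were an element with `g ∂ z = 1`, then
`exp (k g ∂)` would map `z` to `z + w` for a certain series `w`, the displacement, which makes sense
without `z`. The automorphism `exp (k g ∂)` of the field `𝕊` carries `g ∂` to `f ∂` if and only if
`f (1 + g ∂ w) = g`, by the chain rule `vf_expOp_vf` (`expOp_vf_comm_iff`). Every `w` with
`g w ∈ Cont(∂)` is a displacement, by the fixed point theorem for contracting maps on spherically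
complete sets of series (`exists_fixed_point`, `exists_displacement_eq`). Therefore `f` and `g` are
conjugate if and only if `f (1 + g ∂ w) = g` for some `w` with `g w ∈ Cont(∂)`
(`isConj_iff_exists_der`).

*The criteria.* By regular asymptotic integration, and the fixed point theorem once more, `∂` is
surjective (`exists_der_eq`), so that there is a `w` with `f (1 + g ∂ w) = g`, i.e. with
`∂ w = (g - f) / (f g)`. In an H-asymptotic field, `a ↦ ∂ a` preserves and reflects the order of
valuations other than `0` (`val_der_lt`), so `g w ∈ Cont(∂)`, i.e. `w ≺ h / (g ∂ h)` for all nonzero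
`h ≺ 1`, becomes a condition on `∂ w` (`exists_der_iff_forall_val_lt`), which can also be phrased in
terms of the asymptotic couple (`forall_derivImage_lt_iff`).
-/

namespace HahnLimit

section Sums

variable {C : Type w} [Field C]
variable {Γ : Type u} [AddCommGroup Γ] [LinearOrder Γ] [IsOrderedAddMonoid Γ]
variable {D : Type v} [Preorder D] [IsDirectedOrder D] [Nonempty D] {G : D →o AddSubgroup Γ}

/-! ### The valuation -/

/-- The coefficient of `f` at the exponent `γ`, as a linear form. -/
noncomputable def coeffAt (γ : Γ) : limitField C G →ₗ[C] C where
  toFun f := (f : HahnSeries Γ C).coeff γ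
  map_add' _ _ := rfl
  map_smul' _ _ := rfl

theorem coeffAt_apply (γ : Γ) (f : limitField C G) :
    coeffAt γ f = (f : HahnSeries Γ C).coeff γ := rfl

theorem ext_coeffAt {f g : limitField C G} (h : ∀ γ, coeffAt γ f = coeffAt γ g) : f = g :=
  Subtype.ext (HahnSeries.ext (funext h))

theorem val_eq_top {f : limitField C G} : val f = ⊤ ↔ f = 0 := by
  rw [val, HahnSeries.orderTop_eq_top, ZeroMemClass.coe_eq_zero]

@[simp] theorem val_zero : val (0 : limitField C G) = ⊤ := val_eq_top.2 rfl

theorem exists_val {f : limitField C G} (hf : f ≠ 0) : ∃ γ : Γ, val f = γ := by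
  have h : val f ≠ ⊤ := fun h => hf (val_eq_top.1 h)
  exact ⟨(val f).untop h, (WithTop.coe_untop _ h).symm⟩

theorem ne_zero_of_val {f : limitField C G} {γ : Γ} (h : val f = γ) : f ≠ 0 := by
  rintro rfl
  simp at h

theorem ne_zero_of_val_lt {f : limitField C G} {a : WithTop Γ} (h : val f < a) : f ≠ 0 := by
  rintro rfl
  simp at h

theorem val_mul (f g : limitField C G) : val (f * g) = val f + val g :=
  HahnSeries.orderTop_mul _ _

@[simp] theorem val_neg (f : limitField C G) : val (-f) = val f := HahnSeries.orderTop_neg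

theorem val_sub_comm (f g : limitField C G) : val (f - g) = val (g - f) := by
  rw [← val_neg, neg_sub]

@[simp] theorem val_one : val (1 : limitField C G) = 0 := HahnSeries.orderTop_one

theorem val_inv {f : limitField C G} {γ : Γ} (h : val f = γ) : val f⁻¹ = ((-γ : Γ) : WithTop Γ) := by
  have hf := ne_zero_of_val h
  obtain ⟨δ, hδ⟩ := exists_val (inv_ne_zero hf)
  have h1 := val_mul f f⁻¹
  rw [mul_inv_cancel₀ hf, val_one, h, hδ, ← WithTop.coe_add, ← WithTop.coe_zero,
    WithTop.coe_inj] at h1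
  rw [hδ, WithTop.coe_inj]
  exact eq_neg_of_add_eq_zero_right h1.symm

theorem val_div {f g : limitField C G} {γ δ : Γ} (hf : val f = γ) (hg : val g = δ) :
    val (f / g) = ((γ - δ : Γ) : WithTop Γ) := by
  rw [div_eq_mul_inv, val_mul, hf, val_inv hg, ← WithTop.coe_add, sub_eq_add_neg]

theorem le_val_iff {f : limitField C G} {a : WithTop Γ} :
    a ≤ val f ↔ ∀ γ : Γ, (γ : WithTop Γ) < a → coeffAt γ f = 0 :=
  HahnSeries.le_orderTop_iff_forall

theorem coeffAt_eq_zero_of_lt {f : limitField C G} {γ : Γ} (h : (γ : WithTop Γ) < val f) :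
    coeffAt γ f = 0 := HahnSeries.coeff_eq_zero_of_lt_orderTop h

theorem coeffAt_ne_zero_of_val {f : limitField C G} {γ : Γ} (h : val f = γ) :
    coeffAt γ f ≠ 0 := HahnSeries.coeff_orderTop_ne h

theorem val_le_of_coeffAt_ne_zero {f : limitField C G} {γ : Γ} (h : coeffAt γ f ≠ 0) :
    val f ≤ γ := HahnSeries.orderTop_le_of_coeff_ne_zero h

theorem lt_val_iff {f : limitField C G} {a : Γ} :
    (a : WithTop Γ) < val f ↔ ∀ γ ≤ a, coeffAt γ f = 0 := by
  constructor
  · intro h γ hγ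
    exact coeffAt_eq_zero_of_lt (lt_of_le_of_lt (WithTop.coe_le_coe.2 hγ) h)
  · intro h
    by_contra! h1
    have hf : f ≠ 0 := by
      rintro rfl
      simp at h1
    obtain ⟨γ, hγ⟩ := exists_val hf
    rw [hγ] at h1
    exact coeffAt_ne_zero_of_val hγ (h γ (WithTop.coe_le_coe.1 h1))

theorem le_val_add {f g : limitField C G} {a : WithTop Γ} (hf : a ≤ val f) (hg : a ≤ val g) :
    a ≤ val (f + g) :=
  (le_min hf hg).trans HahnSeries.min_orderTop_le_orderTop_add

theorem le_val_sub {f g : limitField C G} {a : WithTop Γ} (hf : a ≤ val f) (hg : a ≤ val g) :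
    a ≤ val (f - g) := by
  rw [sub_eq_add_neg]
  exact le_val_add hf (by rwa [val_neg])

theorem lt_val_add {f g : limitField C G} {a : WithTop Γ} (hf : a < val f) (hg : a < val g) :
    a < val (f + g) :=
  (lt_min hf hg).trans_le HahnSeries.min_orderTop_le_orderTop_add

theorem val_add_eq_left {f g : limitField C G} (h : val f < val g) : val (f + g) = val f :=
  HahnSeries.orderTop_add_eq_left h

theorem val_eq_of_lt_val_sub {f g : limitField C G} (h : val f < val (f - g)) :
    val g = val f := by
  rw [← val_neg, val_sub_comm] at h
  have := val_add_eq_left (f := f) (g := g - f) (by rwa [val_neg] at h)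
  rwa [add_sub_cancel] at this

theorem val_smul {c : C} (hc : c ≠ 0) (f : limitField C G) : val (c • f) = val f := by
  have h1 : ∀ (c : C) (f : limitField C G), val f ≤ val (c • f) :=
    fun c f => HahnSeries.orderTop_le_orderTop_smul c (f : HahnSeries Γ C)
  refine le_antisymm ?_ (h1 c f)
  have := h1 c⁻¹ (c • f)
  rwa [smul_smul, inv_mul_cancel₀ hc, one_smul] at this

theorem val_le_smul (c : C) (f : limitField C G) : val f ≤ val (c • f) :=
  HahnSeries.orderTop_le_orderTop_smul c (f : HahnSeries Γ C)

/-- Two series of equal valuation differ, up to a constant factor, by a series of larger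
valuation: the residue field of `val` is `C`. -/
theorem exists_lt_val_sub_smul {f g : limitField C G} (hf : f ≠ 0) (h : val f = val g) :
    ∃ c : C, c ≠ 0 ∧ val f < val (g - c • f) := by
  obtain ⟨γ, hγ⟩ := exists_val hf
  have hγ' : val g = γ := h ▸ hγ
  have h1 := coeffAt_ne_zero_of_val hγ
  have h2 := coeffAt_ne_zero_of_val hγ'
  refine ⟨coeffAt γ g / coeffAt γ f, div_ne_zero h2 h1, ?_⟩
  rw [hγ, lt_val_iff]
  intro δ hδ
  rw [map_sub, map_smul]
  rcases hδ.lt_or_eq with hδ | rfl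
  · rw [coeffAt_eq_zero_of_lt (f := f) (γ := δ) (by rw [hγ]; exact WithTop.coe_lt_coe.2 hδ),
      coeffAt_eq_zero_of_lt (f := g) (γ := δ) (by rw [hγ']; exact WithTop.coe_lt_coe.2 hδ)]
    simp
  · rw [smul_eq_mul, div_mul_cancel₀ _ h1, sub_self]

/-! ### Summable families -/

theorem mem_level_iff {d : D} {f : limitField C G} :
    f ∈ level C G d ↔ ∀ γ, coeffAt γ f ≠ 0 → γ ∈ G d := Iff.rfl

theorem level_mono {d e : D} (h : d ≤ e) : level C G d ⊆ level C G e :=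
  fun _ hf _ hγ => G.monotone h (hf hγ)

theorem exists_mem_level (f : limitField C G) : ∃ d, f ∈ level C G d := f.2

theorem smul_mem_level {d : D} (c : C) {f : limitField C G} (hf : f ∈ level C G d) :
    c • f ∈ level C G d :=
  IntermediateField.smul_mem (hahnSubfield C (G d)) hf

theorem zero_mem_level (d : D) : (0 : limitField C G) ∈ level C G d :=
  zero_mem (hahnSubfield C (G d))

theorem add_mem_level {d : D} {f g : limitField C G} (hf : f ∈ level C G d)
    (hg : g ∈ level C G d) : f + g ∈ level C G d :=
  (hahnSubfield C (G d)).add_mem hf hg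

theorem sub_mem_level {d : D} {f g : limitField C G} (hf : f ∈ level C G d)
    (hg : g ∈ level C G d) : f - g ∈ level C G d :=
  (hahnSubfield C (G d)).sub_mem hf hg

theorem mul_mem_level {d : D} {f g : limitField C G} (hf : f ∈ level C G d)
    (hg : g ∈ level C G d) : f * g ∈ level C G d :=
  (hahnSubfield C (G d)).mul_mem hf hg

theorem exists_ne_zero_of_finsum_ne_zero {ι M : Type*} [AddCommMonoid M] {f : ι → M}
    (h : ∑ᶠ i, f i ≠ 0) : ∃ i, f i ≠ 0 := by
  by_contra! h1
  exact h (finsum_eq_zero_of_forall_eq_zero h1)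

theorem exists_ne_zero_of_finsum_prop_ne_zero {M : Type*} [AddCommMonoid M] {p : Prop} {a : M}
    (h : ∑ᶠ (_ : p), a ≠ 0) : p ∧ a ≠ 0 := by
  by_cases hp : p
  · exact ⟨hp, by simpa [hp] using h⟩
  · simp [hp] at h

/-- The family `F` takes values in some `𝕊_d` and is summable there. -/
structure Summ {ι : Type*} (F : ι → limitField C G) : Prop where
  level : ∃ d, ∀ i, F i ∈ HahnLimit.level C G d
  isPWO : {γ : Γ | ∃ i, coeffAt γ (F i) ≠ 0}.IsPWO
  finite : ∀ γ, {i | coeffAt γ (F i) ≠ 0}.Finite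

section

variable {ι κ : Type*}

theorem hasStrongSum_iff {F : ι → limitField C G} {s : limitField C G} :
    HasStrongSum F s ↔ Summ F ∧ ∀ γ, coeffAt γ s = ∑ᶠ i, coeffAt γ (F i) := by
  constructor
  · rintro ⟨d, hd, T, hT, hs⟩
    refine ⟨⟨⟨d, hd⟩, ?_, ?_⟩, ?_⟩
    · refine T.isPWO_iUnion_support.mono ?_
      rintro γ ⟨i, hi⟩
      refine Set.mem_iUnion.2 ⟨i, ?_⟩
      rw [hT]
      exact hi
    · intro γ
      have := T.finite_co_support' γ
      refine this.subset fun i hi => ?_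
      change (T i).coeff γ ≠ 0
      rw [hT]
      exact hi
    · intro γ
      rw [coeffAt_apply, ← hs, HahnSeries.SummableFamily.coeff_hsum]
      exact finsum_congr fun i => by rw [hT]; rfl
  · rintro ⟨⟨⟨d, hd⟩, h1, h2⟩, h3⟩
    refine ⟨d, hd, ⟨fun i => (F i : HahnSeries Γ C), ?_, h2⟩, fun i => rfl, ?_⟩
    · refine h1.mono fun γ hγ => ?_
      obtain ⟨i, hi⟩ := Set.mem_iUnion.1 hγ
      exact ⟨i, hi⟩
    · ext γ
      rw [HahnSeries.SummableFamily.coeff_hsum]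
      exact (h3 γ).symm

theorem HasStrongSum.summ {F : ι → limitField C G} {s : limitField C G} (h : HasStrongSum F s) :
    Summ F := (hasStrongSum_iff.1 h).1

theorem HasStrongSum.coeffAt_eq {F : ι → limitField C G} {s : limitField C G}
    (h : HasStrongSum F s) (γ : Γ) : coeffAt γ s = ∑ᶠ i, coeffAt γ (F i) :=
  (hasStrongSum_iff.1 h).2 γ

theorem HasStrongSum.unique {F : ι → limitField C G} {s t : limitField C G}
    (h : HasStrongSum F s) (h' : HasStrongSum F t) : s = t :=
  ext_coeffAt fun γ => by rw [h.coeffAt_eq, h'.coeffAt_eq]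

theorem HasStrongSum.mem_level {F : ι → limitField C G} {s : limitField C G}
    (h : HasStrongSum F s) {d : D} (hd : ∀ i, F i ∈ level C G d) : s ∈ level C G d := by
  intro γ hγ
  change coeffAt γ s ≠ 0 at hγ
  rw [h.coeffAt_eq] at hγ
  obtain ⟨i, hi⟩ := exists_ne_zero_of_finsum_ne_zero hγ
  exact hd i hi

theorem Summ.exists_hasStrongSum {F : ι → limitField C G} (h : Summ F) :
    ∃ s, HasStrongSum F s := by
  obtain ⟨⟨d, hd⟩, h1, h2⟩ := h
  let T : HahnSeries.SummableFamily Γ C ι := ⟨fun i => (F i : HahnSeries Γ C),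
    h1.mono fun γ hγ => by
      obtain ⟨i, hi⟩ := Set.mem_iUnion.1 hγ
      exact ⟨i, hi⟩, h2⟩
  refine ⟨⟨T.hsum, d, ?_⟩, d, hd, T, fun i => rfl, rfl⟩
  intro γ hγ
  obtain ⟨i, hi⟩ := Set.mem_iUnion.1 (HahnSeries.SummableFamily.support_hsum_subset hγ)
  exact hd i hi

open Classical in
/-- The sum of a summable family, and `0` if the family is not summable. -/
noncomputable def ssum (F : ι → limitField C G) : limitField C G :=
  if h : Summ F then h.exists_hasStrongSum.choose else 0

theorem Summ.hasStrongSum {F : ι → limitField C G} (h : Summ F) : HasStrongSum F (ssum F) := by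
  rw [ssum, dif_pos h]
  exact h.exists_hasStrongSum.choose_spec

/-- A family is summable if the support of each member is covered by the supports of finitely many
members of a summable family, and each member of the latter is used only finitely often. -/
theorem Summ.of_cover {F : κ → limitField C G} (hF : Summ F) {P : ι → limitField C G}
    (J : ι → Set κ) (hJ : ∀ j, {i | j ∈ J i}.Finite)
    (hP : ∀ i γ, coeffAt γ (P i) ≠ 0 → ∃ j ∈ J i, coeffAt γ (F j) ≠ 0) : Summ P where
  level := by
    obtain ⟨d, hd⟩ := hF.level
    refine ⟨d, fun i => mem_level_iff.2 fun γ hγ => ?_⟩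
    obtain ⟨j, -, hj⟩ := hP i γ hγ
    exact hd j hj
  isPWO := hF.isPWO.mono fun γ ⟨i, hi⟩ => by
    obtain ⟨j, -, hj⟩ := hP i γ hi
    exact ⟨j, hj⟩
  finite γ := by
    refine ((hF.finite γ).biUnion fun j _ => hJ j).subset fun i hi => ?_
    obtain ⟨j, hji, hj⟩ := hP i γ hi
    exact Set.mem_biUnion (show j ∈ {j | coeffAt γ (F j) ≠ 0} from hj) hji

theorem Summ.comp_injective {F : κ → limitField C G} (hF : Summ F) {e : ι → κ}
    (he : Function.Injective e) : Summ fun i => F (e i) :=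
  hF.of_cover (fun i => {e i})
    (fun _ => Set.Subsingleton.finite fun _ ha _ hb => he (ha.symm.trans hb))
    fun i _ h => ⟨e i, rfl, h⟩

theorem Summ.smul {F : ι → limitField C G} (hF : Summ F) (c : ι → C) :
    Summ fun i => c i • F i :=
  hF.of_cover (fun i => {i}) (fun _ => Set.Subsingleton.finite fun _ ha _ hb => ha.symm.trans hb)
    fun i γ h => ⟨i, rfl, fun h0 => h (by rw [map_smul, h0, smul_zero])⟩

theorem Summ.of_finite [Finite ι] (F : ι → limitField C G) : Summ F where
  level := by
    choose d hd using fun i => exists_mem_level (F i)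
    obtain ⟨e, he⟩ := (Set.finite_range d).bddAbove
    exact ⟨e, fun i => level_mono (he ⟨i, rfl⟩) (hd i)⟩
  isPWO := by
    have := Fintype.ofFinite ι
    have h : ∀ U : Finset ι, {γ : Γ | ∃ i ∈ U, coeffAt γ (F i) ≠ 0}.IsPWO := by
      classical
      intro U
      induction U using Finset.induction_on with
      | empty => simp
      | insert i U _ ih =>
        refine ((F i : HahnSeries Γ C).isPWO_support.union ih).mono ?_
        rintro γ ⟨j, hj, hγ⟩
        rcases Finset.mem_insert.1 hj with rfl | hj
        · exact Or.inl hγ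
        · exact Or.inr ⟨j, hj, hγ⟩
    simpa using h Finset.univ
  finite _ := Set.toFinite _

theorem HasStrongSum.congr {F H : ι → limitField C G} {s : limitField C G} (h : HasStrongSum F s)
    (hFH : ∀ i, F i = H i) : HasStrongSum H s := by
  rwa [← funext hFH]

theorem HasStrongSum.add {F H : ι → limitField C G} {s t : limitField C G}
    (hF : HasStrongSum F s) (hH : HasStrongSum H t) :
    HasStrongSum (fun i => F i + H i) (s + t) := by
  obtain ⟨d, hd, T, hT, rfl'⟩ := hF
  obtain ⟨e, he, T', hT', rfl''⟩ := hH
  obtain ⟨c, hdc, hec⟩ := exists_ge_ge d e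
  refine ⟨c, fun i => add_mem_level (level_mono hdc (hd i)) (level_mono hec (he i)), T + T',
    fun i => ?_, ?_⟩
  · simp [hT, hT']
  · rw [HahnSeries.SummableFamily.hsum_add, rfl', rfl'']
    rfl

theorem HasStrongSum.smul {F : ι → limitField C G} {s : limitField C G}
    (hF : HasStrongSum F s) (c : C) : HasStrongSum (fun i => c • F i) (c • s) := by
  refine hasStrongSum_iff.2 ⟨hF.summ.smul _, fun γ => ?_⟩
  rw [map_smul, hF.coeffAt_eq, smul_eq_mul, mul_finsum]
  exact finsum_congr fun i => by rw [map_smul, smul_eq_mul]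

theorem HasStrongSum.sub {F H : ι → limitField C G} {s t : limitField C G}
    (hF : HasStrongSum F s) (hH : HasStrongSum H t) :
    HasStrongSum (fun i => F i - H i) (s - t) := by
  have := hF.add (hH.smul (-1))
  simp only [neg_smul, one_smul, ← sub_eq_add_neg] at this
  exact this

theorem HasStrongSum.mul {F : ι → limitField C G} {H : κ → limitField C G} {s t : limitField C G}
    (hF : HasStrongSum F s) (hH : HasStrongSum H t) :
    HasStrongSum (fun p : ι × κ => F p.1 * H p.2) (s * t) := by
  obtain ⟨d, hd, T, hT, h1⟩ := hF
  obtain ⟨e, he, T', hT', h2⟩ := hH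
  obtain ⟨c, hdc, hec⟩ := exists_ge_ge d e
  refine ⟨c, fun i => mul_mem_level (level_mono hdc (hd _)) (level_mono hec (he _)), T.mul T',
    fun i => ?_, ?_⟩
  · change T i.1 * T' i.2 = _
    rw [hT, hT']
    rfl
  · rw [HahnSeries.SummableFamily.hsum_mul, h1, h2]
    rfl

theorem hasStrongSum_pi_single [DecidableEq ι] (i : ι) (a : limitField C G) :
    HasStrongSum (Pi.single i a) a := by
  obtain ⟨d, hd⟩ := exists_mem_level a
  refine ⟨d, fun j => ?_, HahnSeries.SummableFamily.single i (a : HahnSeries Γ C), fun j => ?_, ?_⟩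
  · by_cases h : j = i
    · subst h; rwa [Pi.single_eq_same]
    · rw [Pi.single_eq_of_ne h]; exact zero_mem_level d
  · change (Pi.single i (a : HahnSeries Γ C) : ι → HahnSeries Γ C) j = _
    by_cases h : j = i
    · subst h; simp
    · simp [Pi.single_eq_of_ne h]
  · rw [HahnSeries.SummableFamily.hsum_single]

theorem HasStrongSum.mul_left {F : ι → limitField C G} {s : limitField C G}
    (hF : HasStrongSum F s) (a : limitField C G) : HasStrongSum (fun i => a * F i) (a * s) := by
  have h : Summ fun i => a * F i := by
    have h1 := ((hasStrongSum_pi_single () a).mul hF).summ.comp_injective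
      (e := fun i : ι => ((), i)) fun i j h => by simpa using h
    simpa using h1
  refine hasStrongSum_iff.2 ⟨h, fun γ => ?_⟩
  rw [((hasStrongSum_pi_single () a).mul hF).coeffAt_eq]
  rw [← finsum_comp_equiv (Equiv.punitProd ι).symm]
  exact finsum_congr fun i => by simp

/-- Fubini: partial sums over the fibres of a map `p`. -/
theorem HasStrongSum.fiberwise {F : ι → limitField C G} {s : limitField C G}
    (hF : HasStrongSum F s) (p : ι → κ) {r : κ → limitField C G}
    (hr : ∀ k γ, coeffAt γ (r k) = ∑ᶠ (i) (_ : p i = k), coeffAt γ (F i)) :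
    HasStrongSum r s := by
  classical
  refine hasStrongSum_iff.2 ⟨?_, fun γ => ?_⟩
  · refine hF.summ.of_cover (fun k => {i | p i = k})
      (fun _ => Set.Subsingleton.finite fun _ ha _ hb => ha.symm.trans hb) fun k γ hγ => ?_
    rw [hr] at hγ
    obtain ⟨i, hi⟩ := exists_ne_zero_of_finsum_ne_zero hγ
    obtain ⟨hi1, hi2⟩ := exists_ne_zero_of_finsum_prop_ne_zero hi
    exact ⟨i, hi1, hi2⟩
  · rw [hF.coeffAt_eq]
    set U : Finset ι := (hF.summ.finite γ).toFinset with hU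
    have h1 : ∀ k, coeffAt γ (r k) = ∑ i ∈ U with p i = k, coeffAt γ (F i) := by
      intro k
      rw [hr]
      refine finsum_mem_eq_sum_of_inter_support_eq (s := {i | p i = k}) _ ?_
      ext i
      simp only [hU, Set.mem_inter_iff, Set.mem_ofPred_eq, Function.mem_support, Finset.coe_filter,
        Set.Finite.mem_toFinset]
      tauto
    rw [finsum_eq_sum_of_support_subset _ (s := U) (by intro i hi; simpa [hU] using hi),
      finsum_congr h1, finsum_eq_sum_of_support_subset _ (s := U.image p) ?_]
    · exact (Finset.sum_fiberwise_of_maps_to (fun i hi => Finset.mem_image_of_mem p hi) _).symm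
    · intro k hk
      obtain ⟨i, hi, -⟩ := Finset.exists_ne_zero_of_sum_ne_zero hk
      rw [Finset.mem_filter] at hi
      simp only [Finset.coe_image, Set.mem_image, Finset.mem_coe]
      exact ⟨i, hi⟩

theorem HasStrongSum.rows {F : ι × κ → limitField C G} {s : limitField C G}
    (hF : HasStrongSum F s) {r : ι → limitField C G}
    (hr : ∀ i, HasStrongSum (fun k => F (i, k)) (r i)) : HasStrongSum r s := by
  refine hF.fiberwise Prod.fst fun i γ => ?_
  rw [(hr i).coeffAt_eq]
  have : (fun p : ι × κ => ∑ᶠ (_ : p.1 = i), coeffAt γ (F p)) =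
      fun p => ∑ᶠ (_ : p ∈ Set.range fun k : κ => (i, k)), coeffAt γ (F p) := by
    funext p
    refine finsum_congr_Prop ?_ fun _ => rfl
    rcases p with ⟨j, k⟩
    simp [eq_comm]
  rw [this, finsum_mem_range fun a b h => by simpa using h]

theorem HasStrongSum.comp_equiv {F : κ → limitField C G} {s : limitField C G}
    (hF : HasStrongSum F s) (e : ι ≃ κ) : HasStrongSum (fun i => F (e i)) s := by
  refine hasStrongSum_iff.2 ⟨hF.summ.comp_injective e.injective, fun γ => ?_⟩
  rw [hF.coeffAt_eq, ← finsum_comp_equiv e]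

theorem HasStrongSum.cols {F : ι × κ → limitField C G} {s : limitField C G}
    (hF : HasStrongSum F s) {r : κ → limitField C G}
    (hr : ∀ k, HasStrongSum (fun i => F (i, k)) (r k)) : HasStrongSum r s :=
  (hF.comp_equiv (Equiv.prodComm κ ι)).rows hr

theorem hasStrongSum_of_support_subset {F : ι → limitField C G} (U : Finset ι)
    (h : ∀ i ∉ U, F i = 0) : HasStrongSum F (∑ i ∈ U, F i) := by
  refine hasStrongSum_iff.2 ⟨?_, fun γ => ?_⟩
  · refine (Summ.of_finite fun i : U => F i).of_cover (fun i => {j | (j : ι) = i})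
      (fun _ => Set.Subsingleton.finite fun _ ha _ hb => ha.symm.trans hb) fun i γ hγ => ?_
    have : i ∈ U := by
      by_contra h1
      rw [h i h1, map_zero] at hγ
      exact hγ rfl
    exact ⟨⟨i, this⟩, rfl, hγ⟩
  · rw [map_sum, finsum_eq_sum_of_support_subset]
    intro i hi
    by_contra h1
    exact hi (by simp [h i h1])

theorem HasStrongSum.antidiagonal {F : ℕ × ℕ → limitField C G} {s : limitField C G}
    (hF : HasStrongSum F s) :
    HasStrongSum (fun n => ∑ p ∈ Finset.HasAntidiagonal.antidiagonal n, F p) s := by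
  refine hF.fiberwise (fun p => p.1 + p.2) fun n γ => ?_
  rw [map_sum, ← finsum_mem_finset_eq_sum]
  exact finsum_congr fun p => finsum_congr_Prop (by simp) fun _ => rfl

theorem HasStrongSum.le_val {F : ι → limitField C G} {s : limitField C G}
    (hF : HasStrongSum F s) {a : WithTop Γ} (h : ∀ i, a ≤ val (F i)) : a ≤ val s := by
  refine le_val_iff.2 fun γ hγ => ?_
  rw [hF.coeffAt_eq]
  exact finsum_eq_zero_of_forall_eq_zero fun i => le_val_iff.1 (h i) γ hγ

theorem HasStrongSum.lt_val {F : ι → limitField C G} {s : limitField C G}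
    (hF : HasStrongSum F s) {a : Γ} (h : ∀ i, (a : WithTop Γ) < val (F i)) :
    (a : WithTop Γ) < val s := by
  refine lt_val_iff.2 fun γ hγ => ?_
  rw [hF.coeffAt_eq]
  exact finsum_eq_zero_of_forall_eq_zero fun i => lt_val_iff.1 (h i) γ hγ

/-- If all terms but one have valuation larger than `a`, then so does the difference of the sum and
this term. -/
theorem HasStrongSum.lt_val_sub {F : ι → limitField C G} {s : limitField C G}
    (hF : HasStrongSum F s) {a : Γ} (i : ι) (h : ∀ j ≠ i, (a : WithTop Γ) < val (F j)) :
    (a : WithTop Γ) < val (s - F i) := by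
  classical
  refine (hF.sub (hasStrongSum_pi_single i (F i))).lt_val fun j => ?_
  by_cases hj : j = i
  · subst hj
    simp
  · simpa [hj] using h j hj

end

end Sums

end HahnLimit

namespace HahnLimit

/-! ### Summability of words in contracting operators -/

section Pairs

variable {Γ : Type*} [LinearOrder Γ] {ι : Type*}

/-- The relation on pairs (index, exponent) whose well-quasi-orderings are the summable families
of supports, see `pairs_wqo_iff`. -/
def PairRel (p q : ι × Γ) : Prop := p = q ∨ p.2 < q.2

/-- The supports `U i` have well-partially-ordered union and finite fibres, as required of a summable
family, if and only if there is no bad sequence of pairs `(i, γ)` with `γ ∈ U i`. This makes the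
minimal bad sequence argument available for summability. -/
theorem pairs_wqo_iff {U : ι → Set Γ} :
    {p : ι × Γ | p.2 ∈ U p.1}.PartiallyWellOrderedOn PairRel ↔
      {γ | ∃ i, γ ∈ U i}.IsPWO ∧ ∀ γ, {i | γ ∈ U i}.Finite := by
  constructor
  · intro h
    refine ⟨?_, fun γ => ?_⟩
    · rw [Set.IsPWO, Set.partiallyWellOrderedOn_iff_exists_lt]
      intro f hf
      choose i hi using hf
      obtain ⟨m, n, hmn, hr⟩ := Set.partiallyWellOrderedOn_iff_exists_lt.1 h
        (fun n => (i n, f n)) hi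
      refine ⟨m, n, hmn, ?_⟩
      rcases hr with hr | hr
      · exact (Prod.ext_iff.1 hr).2.le
      · exact hr.le
    · by_contra hinf
      obtain ⟨m, n, hmn, hr⟩ := Set.partiallyWellOrderedOn_iff_exists_lt.1 h
        (fun n => (((Set.Infinite.natEmbedding _ hinf) n : ι), γ))
        (fun n => ((Set.Infinite.natEmbedding _ hinf) n).2)
      rcases hr with hr | hr
      · have h1 := (Set.Infinite.natEmbedding _ hinf).injective
          (Subtype.ext (Prod.ext_iff.1 hr).1)
        omega
      · exact lt_irrefl _ hr
  · rintro ⟨h1, h2⟩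
    rw [Set.partiallyWellOrderedOn_iff_exists_lt]
    intro f hf
    by_contra! hbad
    have hanti : ∀ m n, m < n → (f n).2 ≤ (f m).2 := fun m n hmn =>
      not_lt.1 fun h => hbad m n hmn (Or.inr h)
    obtain ⟨g, hg⟩ := h1.exists_monotone_subseq (f := fun n => (f n).2) fun n => ⟨_, hf n⟩
    have hconst : ∀ n, (f (g n)).2 = (f (g 0)).2 := by
      intro n
      rcases Nat.eq_zero_or_pos n with rfl | hn
      · rfl
      · exact le_antisymm (hanti _ _ (g.strictMono hn)) (hg hn.le)
    have hmaps : ∀ n ∈ (Set.univ : Set ℕ), (f (g n)).1 ∈ {i | (f (g 0)).2 ∈ U i} := by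
      intro n _
      have := hf (g n)
      rw [Set.mem_ofPred_eq, hconst] at this
      exact this
    obtain ⟨m, -, n, -, hmn, he⟩ :=
      Set.infinite_univ.exists_lt_map_eq_of_mapsTo hmaps (h2 _)
    exact hbad (g m) (g n) (g.strictMono hmn)
      (Or.inl (Prod.ext he ((hconst m).trans (hconst n).symm)))

end Pairs

section Words

variable {C : Type w} [Field C]
variable {Γ : Type u} [AddCommGroup Γ] [LinearOrder Γ] [IsOrderedAddMonoid Γ]
variable {D : Type v} [Preorder D] [IsDirectedOrder D] [Nonempty D] {G : D →o AddSubgroup Γ}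

/-- The term `c t ^ γ` of `𝕊`. -/
noncomputable def term (hcover : ∀ γ : Γ, ∃ d, γ ∈ G d) (γ : Γ) (c : C) : limitField C G :=
  ⟨HahnSeries.single γ c, (hcover γ).imp fun d hd δ hδ => by
    have : δ = γ := by simpa using HahnSeries.support_single_subset hδ
    rwa [this]⟩

theorem coeffAt_term_self (hcover : ∀ γ : Γ, ∃ d, γ ∈ G d) (γ : Γ) (c : C) :
    coeffAt γ (term hcover γ c) = c := HahnSeries.coeff_single_same _ _

theorem coeffAt_term_of_ne (hcover : ∀ γ : Γ, ∃ d, γ ∈ G d) {γ δ : Γ} (h : δ ≠ γ) (c : C) :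
    coeffAt δ (term hcover γ c) = 0 := HahnSeries.coeff_single_of_ne h

theorem eq_of_coeffAt_term_ne_zero {hcover : ∀ γ : Γ, ∃ d, γ ∈ G d} {γ δ : Γ} {c : C}
    (h : coeffAt δ (term hcover γ c) ≠ 0) : δ = γ := by
  by_contra h1
  exact h (coeffAt_term_of_ne hcover h1 c)

theorem val_term (hcover : ∀ γ : Γ, ∃ d, γ ∈ G d) (γ : Γ) {c : C} (hc : c ≠ 0) :
    val (term hcover γ c) = γ := HahnSeries.orderTop_single hc

theorem term_zero (hcover : ∀ γ : Γ, ∃ d, γ ∈ G d) (γ : Γ) :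
    term hcover γ (0 : C) = 0 := Subtype.ext (HahnSeries.single_eq_zero)

theorem term_smul (hcover : ∀ γ : Γ, ∃ d, γ ∈ G d) (γ : Γ) (c e : C) :
    term hcover γ (c * e) = c • term hcover γ e := by
  refine ext_coeffAt fun δ => ?_
  rw [map_smul]
  by_cases h : δ = γ
  · rw [h, coeffAt_term_self, coeffAt_term_self, smul_eq_mul]
  · rw [coeffAt_term_of_ne hcover h, coeffAt_term_of_ne hcover h, smul_zero]

theorem term_mem_level (hcover : ∀ γ : Γ, ∃ d, γ ∈ G d) {γ : Γ} {d : D} (h : γ ∈ G d) (c : C) :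
    term hcover γ c ∈ level C G d := fun δ hδ => by
  rwa [eq_of_coeffAt_term_ne_zero (hcover := hcover) (c := c) hδ]

theorem summ_term (hcover : ∀ γ : Γ, ∃ d, γ ∈ G d) (c : Γ → C) {d : D}
    (hd : ∀ γ, c γ ≠ 0 → γ ∈ G d) (hc : {γ | c γ ≠ 0}.IsPWO) :
    Summ fun γ => term hcover γ (c γ) where
  level := by
    refine ⟨d, fun γ => ?_⟩
    by_cases h : c γ = 0
    · rw [h, term_zero]
      exact zero_mem_level d
    · exact term_mem_level hcover (hd γ h) _
  isPWO := hc.mono fun γ ⟨δ, hδ⟩ => by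
    obtain rfl := eq_of_coeffAt_term_ne_zero hδ
    rwa [coeffAt_term_self] at hδ
  finite γ := Set.Subsingleton.finite fun α hα β hβ =>
    (eq_of_coeffAt_term_ne_zero hα).symm.trans (eq_of_coeffAt_term_ne_zero hβ)

theorem isPWO_support (a : limitField C G) : {γ : Γ | coeffAt γ a ≠ 0}.IsPWO :=
  HahnSeries.isPWO_support (a : HahnSeries Γ C)

theorem hasStrongSum_term (hcover : ∀ γ : Γ, ∃ d, γ ∈ G d) (a : limitField C G) :
    HasStrongSum (fun γ => term hcover γ (coeffAt γ a)) a := by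
  obtain ⟨d, hd⟩ := exists_mem_level a
  refine hasStrongSum_iff.2 ⟨summ_term hcover _ (d := d) hd (isPWO_support a), fun γ => ?_⟩
  rw [finsum_eq_single _ γ fun δ hδ => coeffAt_term_of_ne hcover hδ.symm _, coeffAt_term_self]

/-- A `C`-linear operator on `𝕊` is strongly linear if it commutes with sums of summable
families. -/
def StronglyLinear (φ : Module.End C (limitField C G)) : Prop :=
  ∀ (ι : Type u) (F : ι → limitField C G) (s : limitField C G),
    HasStrongSum F s → HasStrongSum (fun i => φ (F i)) (φ s)

theorem StronglyLinear.map {φ : Module.End C (limitField C G)} (hφ : StronglyLinear φ)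
    {ι : Type} {F : ι → limitField C G} {s : limitField C G} (h : HasStrongSum F s) :
    HasStrongSum (fun i => φ (F i)) (φ s) :=
  (hφ _ _ _ (h.comp_equiv (Equiv.ulift.{u}))).comp_equiv (Equiv.ulift.{u}).symm

theorem StronglyLinear.pow {φ : Module.End C (limitField C G)} (hφ : StronglyLinear φ) (n : ℕ) :
    StronglyLinear (φ ^ n) := by
  induction n with
  | zero => exact fun _ _ _ h => h
  | succ n ih =>
    intro ι F s h
    simpa only [pow_succ', Module.End.mul_apply] using hφ _ _ _ (ih _ _ _ h)

/-- An operator is contracting if `φ a ≺ a` for all `a ≠ 0`. -/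
def Contracting (φ : Module.End C (limitField C G)) : Prop :=
  ∀ a : limitField C G, a ≠ 0 → val a < val (φ a)

theorem Contracting.le_val {φ : Module.End C (limitField C G)} (hφ : Contracting φ)
    (a : limitField C G) : val a ≤ val (φ a) := by
  by_cases h : a = 0
  · simp [h]
  · exact (hφ a h).le

theorem Contracting.le_val_pow {φ : Module.End C (limitField C G)} (hφ : Contracting φ) (n : ℕ)
    (a : limitField C G) : val a ≤ val ((φ ^ n) a) := by
  induction n with
  | zero => exact le_rfl
  | succ n ih =>
    rw [pow_succ']
    exact ih.trans (hφ.le_val _)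

theorem Contracting.lt_val_pow_succ {φ : Module.End C (limitField C G)} (hφ : Contracting φ)
    (n : ℕ) {a : limitField C G} (ha : a ≠ 0) : val a < val ((φ ^ (n + 1)) a) := by
  rw [pow_succ]
  exact (hφ a ha).trans_le (hφ.le_val_pow n _)

/-- Each exponent of `φ a` is an exponent of `φ (t ^ δ)` for an exponent `δ` of `a`. -/
theorem exists_exponent_of_coeffAt_ne_zero (hcover : ∀ γ : Γ, ∃ d, γ ∈ G d)
    {φ : Module.End C (limitField C G)} (hφ : StronglyLinear φ) (hφ' : Contracting φ)
    {a : limitField C G} {γ : Γ} (h : coeffAt γ (φ a) ≠ 0) :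
    ∃ δ, coeffAt δ a ≠ 0 ∧ coeffAt γ (φ (term hcover δ 1)) ≠ 0 ∧ δ < γ := by
  rw [(hφ _ _ _ (hasStrongSum_term hcover a)).coeffAt_eq] at h
  obtain ⟨δ, hδ⟩ := exists_ne_zero_of_finsum_ne_zero h
  rw [← mul_one (coeffAt δ a), term_smul, map_smul, map_smul, smul_eq_mul] at hδ
  have h1 := right_ne_zero_of_mul hδ
  refine ⟨δ, left_ne_zero_of_mul hδ, h1, ?_⟩
  have hv := val_term hcover δ (one_ne_zero (α := C))
  have h2 := (hφ' _ (ne_zero_of_val hv)).trans_le (val_le_of_coeffAt_ne_zero h1)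
  rw [hv] at h2
  exact WithTop.coe_lt_coe.1 h2

/-- For finitely many strongly linear contracting operators `φ_b`, the family of all
`φ_{b₁} ⋯ φ_{b_n} a` is summable. The proof is a minimal bad sequence argument: removing the operator
applied last strictly decreases the exponent under consideration. -/
theorem summ_words (hcover : ∀ γ : Γ, ∃ d, γ ∈ G d) {B : Type*} [Finite B]
    (φ : B → Module.End C (limitField C G)) (hφ : ∀ b, StronglyLinear (φ b))
    (hφ' : ∀ b, Contracting (φ b)) {d : D} (hd : ∀ b, ∀ a ∈ level C G d, φ b a ∈ level C G d)
    {a : limitField C G} (ha : a ∈ level C G d) :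
    Summ fun w : List B => (w.map φ).prod a := by
  have hlev : ∀ w : List B, (w.map φ).prod a ∈ level C G d := by
    intro w
    induction w with
    | nil => simpa using ha
    | cons b w ih => simpa using hd b _ ih
  set U : List B → Set Γ := fun w => {γ | coeffAt γ ((w.map φ).prod a) ≠ 0} with hU
  suffices h : {p : List B × Γ | p.2 ∈ U p.1}.PartiallyWellOrderedOn PairRel from
    ⟨⟨d, hlev⟩, (pairs_wqo_iff.1 h).1, (pairs_wqo_iff.1 h).2⟩
  rw [Set.PartiallyWellOrderedOn.iff_not_exists_isMinBadSeq fun p : List B × Γ => p.1.length]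
  rintro ⟨f, ⟨hfU, hbad⟩, hmin⟩
  have hanti : ∀ m n, m < n → (f n).2 ≤ (f m).2 := fun m n hmn =>
    not_lt.1 fun h => hbad m n hmn (Or.inr h)
  by_cases hI : {n | (f n).1 ≠ []}.Infinite
  · -- Removing the operator applied last gives shorter words `w n`, with smaller exponents `δ n`,
    -- which by minimality admit no bad sequence.
    set e : ℕ → ℕ := Nat.nth (fun n => (f n).1 ≠ []) with he
    have he_mono : StrictMono e := Nat.nth_strictMono hI
    have hstep : ∀ n, ∃ (b : B) (w : List B) (δ : Γ), (f (e n)).1 = b :: w ∧ δ ∈ U w ∧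
        coeffAt (f (e n)).2 (φ b (term hcover δ 1)) ≠ 0 ∧ δ < (f (e n)).2 := by
      intro n
      obtain ⟨b, w, hbw⟩ := List.exists_cons_of_ne_nil (Nat.nth_mem_of_infinite hI n)
      have h1 : coeffAt (f (e n)).2 (((b :: w).map φ).prod a) ≠ 0 := by
        have := hfU (e n)
        rwa [Set.mem_ofPred_eq, hbw] at this
      rw [List.map_cons, List.prod_cons, Module.End.mul_apply] at h1
      obtain ⟨δ, h2, h3, h4⟩ := exists_exponent_of_coeffAt_ne_zero hcover (hφ b) (hφ' b) h1
      exact ⟨b, w, δ, hbw, h2, h3, h4⟩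
    choose b w δ hbw hδU hδ hlt using hstep
    set V : List B → Set Γ := fun v => {γ | ∃ n, (v, γ) = (w n, δ n)} with hV
    have hVwqo : {p : List B × Γ | p.2 ∈ V p.1}.PartiallyWellOrderedOn PairRel := by
      rw [Set.partiallyWellOrderedOn_iff_exists_lt]
      intro s hs
      by_contra! hsbad
      choose k hk using hs
      have hj₀ : ∀ j, k (Function.argmin k) ≤ k j := fun j => Function.argmin_le k j
      set j₀ := Function.argmin k
      set N := e (k j₀) with hN
      refine hmin N (fun m => if m < N then f m else s (j₀ + (m - N))) ?_ ?_ ⟨?_, ?_⟩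
      · intro m hm
        simp [hm]
      · have h1 : s j₀ = (w (k j₀), δ (k j₀)) := hk j₀
        simp [h1, hN, hbw]
      · intro m
        by_cases hm : m < N
        · simpa [hm] using hfU m
        · have h1 : s (j₀ + (m - N)) = (w (k (j₀ + (m - N))), δ (k (j₀ + (m - N)))) := hk _
          simpa [hm, h1] using hδU _
      · intro m n hmn
        by_cases hn : n < N
        · simpa [hn, hmn.trans hn] using hbad m n hmn
        · by_cases hm : m < N
          · have h1 : s (j₀ + (n - N)) = (w (k (j₀ + (n - N))), δ (k (j₀ + (n - N)))) := hk _
            have h2 : m < e (k (j₀ + (n - N))) :=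
              hm.trans_le (he_mono.monotone (hj₀ _))
            have h3 : δ (k (j₀ + (n - N))) < (f m).2 := (hlt _).trans_le (hanti _ _ h2)
            simp only [hm, hn, if_true, if_false, h1]
            rintro (h4 | h4)
            · rw [h4] at h3
              exact lt_irrefl _ h3
            · exact lt_asymm h3 h4
          · simp only [hm, hn, if_false]
            exact hsbad _ _ (by omega)
    obtain ⟨hVpwo, hVfin⟩ := pairs_wqo_iff.1 hVwqo
    -- Hence the `t ^ δ n` are summable, and so are their images under each of the finitely many
    -- `φ b`, which yields a good pair in the original sequence.
    classical
    set W : Set Γ := {γ | ∃ v, γ ∈ V v} with hW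
    have hterm : Summ fun γ => term (C := C) hcover γ (if γ ∈ W then 1 else 0) := by
      refine summ_term hcover _ (d := d) ?_ (hVpwo.mono ?_)
      · intro γ hγ
        obtain ⟨v, n, hn⟩ : γ ∈ W := by
          by_contra h
          simp [h] at hγ
        obtain ⟨-, rfl⟩ := Prod.mk.inj hn
        exact hlev _ (hδU n)
      · intro γ hγ
        by_contra h
        exact hγ (if_neg h)
    have hsum : ∀ b, Summ fun γ => φ b (term hcover γ (if γ ∈ W then 1 else 0)) :=
      fun b => (hφ b _ _ _ hterm.hasStrongSum).summ
    have hp : {p : (B × List B × Γ) × Γ | p.2 ∈ {γ | p.1.2.2 ∈ V p.1.2.1 ∧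
        coeffAt γ (φ p.1.1 (term hcover p.1.2.2 1)) ≠ 0}}.PartiallyWellOrderedOn PairRel := by
      refine (pairs_wqo_iff (U := fun i : B × List B × Γ => {γ | i.2.2 ∈ V i.2.1 ∧
        coeffAt γ (φ i.1 (term hcover i.2.2 1)) ≠ 0})).2 ⟨?_, fun γ => ?_⟩
      · have : (⋃ b ∈ (Set.univ : Set B), {γ : Γ | ∃ δ, coeffAt γ (φ b (term hcover δ
            (if δ ∈ W then 1 else 0))) ≠ 0}).IsPWO := by
          have hfin := Fintype.ofFinite B
          have h : ∀ T : Finset B, (⋃ b ∈ T, {γ : Γ | ∃ δ, coeffAt γ (φ b (term hcover δ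
            (if δ ∈ W then 1 else 0))) ≠ 0}).IsPWO := by
            intro T
            induction T using Finset.induction_on with
            | empty => simp
            | insert b T _ ih =>
              rw [Finset.set_biUnion_insert]
              exact (hsum b).isPWO.union ih
          simpa using h Finset.univ
        refine this.mono ?_
        rintro γ ⟨⟨b, v, δ⟩, h1, h2⟩
        have h3 : δ ∈ W := ⟨v, h1⟩
        simp only [Set.mem_univ, Set.iUnion_true, Set.mem_iUnion, Set.mem_ofPred_eq]
        exact ⟨b, δ, by rwa [if_pos h3]⟩
      · refine (Set.finite_iUnion fun b : B => (((hsum b).finite γ).biUnion fun δ _ =>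
          ((hVfin δ).image fun v => (b, v, δ)))).subset ?_
        rintro ⟨b, v, δ⟩ ⟨h1, h2⟩
        have h3 : δ ∈ W := ⟨v, h1⟩
        refine Set.mem_iUnion.2 ⟨b, Set.mem_biUnion (x := δ) ?_ ⟨v, h1, rfl⟩⟩
        change coeffAt γ (φ b (term hcover δ (if δ ∈ W then 1 else 0))) ≠ 0
        rwa [if_pos h3]
    obtain ⟨m, n, hmn, hr⟩ := Set.partiallyWellOrderedOn_iff_exists_lt.1 hp
      (fun n => ((b n, w n, δ n), (f (e n)).2)) fun n => ⟨⟨n, rfl⟩, hδ n⟩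
    refine hbad _ _ (he_mono hmn) ?_
    rcases hr with hr | hr
    · left
      simp only [Prod.mk.injEq] at hr
      refine Prod.ext ?_ hr.2
      rw [hbw, hbw, hr.1.1, hr.1.2.1]
    · exact Or.inr hr
  · -- Almost all words in the sequence are empty, and the exponents of `a` are well-ordered.
    rw [Set.not_infinite] at hI
    obtain ⟨N, hN⟩ := hI.bddAbove
    have hnil : ∀ n, (f (n + N + 1)).1 = [] := by
      intro n
      by_contra h
      have : n + N + 1 ≤ N := hN h
      omega
    have hmem : ∀ n, (f (n + N + 1)).2 ∈ {γ : Γ | coeffAt γ a ≠ 0} := by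
      intro n
      have := hfU (n + N + 1)
      rw [Set.mem_ofPred_eq, hnil] at this
      simpa [hU] using this
    obtain ⟨m, n, hmn, hle⟩ := Set.partiallyWellOrderedOn_iff_exists_lt.1 (isPWO_support a) _ hmem
    have hmn' : m + N + 1 < n + N + 1 := by omega
    exact hbad _ _ hmn' (Or.inl (Prod.ext ((hnil m).trans (hnil n).symm)
      (le_antisymm hle (hanti _ _ hmn'))))

end Words

end HahnLimit

namespace HahnLimit

/-! ### A fixed point theorem -/

section FixedPoint

variable {C : Type w} [Field C]
variable {Γ : Type u} [AddCommGroup Γ] [LinearOrder Γ] [IsOrderedAddMonoid Γ]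
variable {D : Type v} [Preorder D] [IsDirectedOrder D] [Nonempty D] {G : D →o AddSubgroup Γ}

/-- Spherical completeness of Hahn fields in the form of a fixed point theorem: a contracting map
on the set of all series with support in a given subset of some `Γ_d` has a fixed point. -/
theorem exists_fixed_point {d : D} {S : Set Γ} (hS : ∀ γ ∈ S, γ ∈ G d)
    (Φ : limitField C G → limitField C G)
    (hmap : ∀ a, (∀ γ, coeffAt γ a ≠ 0 → γ ∈ S) → ∀ γ, coeffAt γ (Φ a) ≠ 0 → γ ∈ S)
    (hcontr : ∀ a b, (∀ γ, coeffAt γ a ≠ 0 → γ ∈ S) → (∀ γ, coeffAt γ b ≠ 0 → γ ∈ S) → a ≠ b →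
      val (a - b) < val (Φ a - Φ b)) :
    ∃ a, (∀ γ, coeffAt γ a ≠ 0 → γ ∈ S) ∧ Φ a = a := by
  classical
  have hcontr' : ∀ a b, (∀ γ, coeffAt γ a ≠ 0 → γ ∈ S) → (∀ γ, coeffAt γ b ≠ 0 → γ ∈ S) →
      val (a - b) ≤ val (Φ a - Φ b) := by
    intro a b ha hb
    by_cases h : a = b
    · simp [h]
    · exact (hcontr a b ha hb h).le
  let X := {a : limitField C G // ∀ γ, coeffAt γ a ≠ 0 → γ ∈ S}
  -- `x` is below `y` if `y` lies in the ball around `x` of radius `val (x - Φ x)`, and its own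
  -- radius is at least as large a value.
  let r : X → X → Prop := fun x y => val (x.1 - Φ x.1) ≤ val (y.1 - Φ y.1) ∧
    val (x.1 - Φ x.1) ≤ val (y.1 - x.1)
  -- The members of a chain agree below their radii, and glue to an upper bound.
  have hchain : ∀ c : Set X, IsChain r c → ∃ ub, ∀ a ∈ c, r a ub := by
    intro c hc
    have hagree : ∀ x ∈ c, ∀ y ∈ c, ∀ δ : Γ, (δ : WithTop Γ) < val (x.1 - Φ x.1) →
        (δ : WithTop Γ) < val (y.1 - Φ y.1) → coeffAt δ x.1 = coeffAt δ y.1 := by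
      intro x hx y hy δ h1 h2
      by_cases hxy : x = y
      · rw [hxy]
      rcases hc hx hy hxy with h | h
      · have := coeffAt_eq_zero_of_lt (h1.trans_le h.2)
        rw [map_sub, sub_eq_zero] at this
        exact this.symm
      · have := coeffAt_eq_zero_of_lt (h2.trans_le h.2)
        rwa [map_sub, sub_eq_zero] at this
    let y : Γ → C := fun δ =>
      if h : ∃ x ∈ c, (δ : WithTop Γ) < val (x.1 - Φ x.1) then coeffAt δ h.choose.1 else 0
    have hy : ∀ x ∈ c, ∀ δ : Γ, (δ : WithTop Γ) < val (x.1 - Φ x.1) → y δ = coeffAt δ x.1 := by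
      intro x hx δ hδ
      have h : ∃ x ∈ c, (δ : WithTop Γ) < val (x.1 - Φ x.1) := ⟨x, hx, hδ⟩
      simp only [y, dif_pos h]
      exact hagree _ h.choose_spec.1 _ hx _ h.choose_spec.2 hδ
    have hysupp : ∀ δ, y δ ≠ 0 → ∃ x ∈ c, (δ : WithTop Γ) < val (x.1 - Φ x.1) := by
      intro δ hδ
      by_contra h
      exact hδ (dif_neg h)
    have hyS : ∀ δ, y δ ≠ 0 → δ ∈ S := by
      intro δ hδ
      obtain ⟨x, hx, h⟩ := hysupp δ hδ
      rw [hy x hx δ h] at hδ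
      exact x.2 δ hδ
    have hyPWO : (Function.support y).IsPWO := by
      rw [Set.isPWO_iff_isWF, Set.isWF_iff_no_descending_seq]
      intro s hs hmem
      obtain ⟨x, hx, h⟩ := hysupp _ (hmem 0)
      have h1 := (x.1 : HahnSeries Γ C).isWF_support
      rw [Set.isWF_iff_no_descending_seq] at h1
      refine h1 s hs fun n => ?_
      have h2 : (s n : WithTop Γ) < val (x.1 - Φ x.1) :=
        lt_of_le_of_lt (WithTop.coe_le_coe.2 (hs.antitone (Nat.zero_le n))) h
      have h3 : y (s n) ≠ 0 := hmem n
      rw [hy x hx _ h2] at h3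
      exact h3
    let z : limitField C G := ⟨⟨y, hyPWO⟩, d, fun γ hγ => hS γ (hyS γ hγ)⟩
    have hz : ∀ δ, coeffAt δ z = y δ := fun _ => rfl
    have hzX : ∀ γ, coeffAt γ z ≠ 0 → γ ∈ S := fun γ hγ => hyS γ hγ
    refine ⟨⟨z, hzX⟩, fun x hx => ?_⟩
    have h1 : val (x.1 - Φ x.1) ≤ val (z - x.1) := by
      refine le_val_iff.2 fun δ hδ => ?_
      rw [map_sub, hz, hy x hx δ hδ, sub_self]
    refine ⟨?_, h1⟩
    have h2 : val (x.1 - Φ x.1) ≤ val (Φ x.1 - Φ z) :=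
      (h1.trans (val_sub_comm _ _).le).trans (hcontr' _ _ x.2 hzX)
    have h3 := le_val_add (le_val_add h1 le_rfl) h2
    have h4 : z - x.1 + (x.1 - Φ x.1) + (Φ x.1 - Φ z) = z - Φ z := by ring
    rwa [h4] at h3
  have htrans : ∀ {a b c : X}, r a b → r b c → r a c := by
    intro a b c h1 h2
    refine ⟨h1.1.trans h2.1, ?_⟩
    have := le_val_add (h1.1.trans h2.2) h1.2
    rwa [sub_add_sub_cancel] at this
  -- A maximal `m` is fixed, since otherwise `Φ m` lies strictly above it.
  obtain ⟨m, hm⟩ := exists_maximal_of_chains_bounded hchain htrans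
  refine ⟨m.1, m.2, ?_⟩
  by_contra hne
  have h1 := hcontr m.1 (Φ m.1) m.2 (hmap _ m.2) (Ne.symm hne)
  have h2 := hm ⟨Φ m.1, hmap _ m.2⟩ ⟨h1.le, (val_sub_comm _ _).le⟩
  exact absurd h2.1 (not_le.2 h1)

end FixedPoint

end HahnLimit

/-! ### The formal Baker-Campbell-Hausdorff identity -/

section FormalBCH

open PowerSeries Finset.HasAntidiagonal

variable {A : Type*} [Ring A]

/-- The Euler derivation `t d/dt` on `A[[t]]`. -/
noncomputable def eulerDeriv : PowerSeries A →+ PowerSeries A where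
  toFun f := PowerSeries.mk fun n => n • coeff n f
  map_zero' := by ext; simp
  map_add' f g := by ext; simp

theorem coeff_eulerDeriv (f : PowerSeries A) (n : ℕ) : coeff n (eulerDeriv f) = n • coeff n f :=
  by simp [eulerDeriv]

theorem eulerDeriv_mul (f g : PowerSeries A) :
    eulerDeriv (f * g) = eulerDeriv f * g + f * eulerDeriv g := by
  ext n
  rw [coeff_eulerDeriv, map_add, coeff_mul, coeff_mul, coeff_mul, Finset.smul_sum,
    ← Finset.sum_add_distrib]
  refine Finset.sum_congr rfl fun p hp => ?_
  rw [coeff_eulerDeriv, coeff_eulerDeriv, smul_mul_assoc, mul_smul_comm, ← add_smul,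
    mem_antidiagonal.1 hp]

/-- The power series in `A[[t]]` divisible by `t ^ k`. -/
def orderGE (A : Type*) [Ring A] (k : ℕ) : AddSubgroup (PowerSeries A) where
  carrier := {f | ∀ m < k, coeff m f = 0}
  zero_mem' m _ := map_zero _
  add_mem' hf hg m hm := by rw [map_add, hf m hm, hg m hm, add_zero]
  neg_mem' hf m hm := by rw [map_neg, hf m hm, neg_zero]

theorem orderGE_mono {i j : ℕ} (h : i ≤ j) : orderGE A j ≤ orderGE A i :=
  fun _ hf m hm => hf m (hm.trans_le h)

theorem mul_mem_orderGE {i j : ℕ} {f g : PowerSeries A} (hf : f ∈ orderGE A i)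
    (hg : g ∈ orderGE A j) : f * g ∈ orderGE A (i + j) := by
  intro m hm
  rw [coeff_mul]
  refine Finset.sum_eq_zero fun p hp => ?_
  have := mem_antidiagonal.1 hp
  by_cases h : p.1 < i
  · rw [hf _ h, zero_mul]
  · rw [hg _ (by omega), mul_zero]

theorem mem_orderGE_zero (f : PowerSeries A) : f ∈ orderGE A 0 := fun m hm => by omega

theorem mul_mem_orderGE_left {j : ℕ} {f : PowerSeries A} (g : PowerSeries A)
    (hf : f ∈ orderGE A j) : f * g ∈ orderGE A j := by
  simpa using mul_mem_orderGE hf (mem_orderGE_zero g)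

theorem pow_mem_orderGE {Z : PowerSeries A} (hZ : Z ∈ orderGE A 1) (n : ℕ) :
    Z ^ n ∈ orderGE A n := by
  induction n with
  | zero => exact mem_orderGE_zero _
  | succ n ih => exact mul_mem_orderGE ih hZ

theorem sum_antidiagonal_sub_sum_range_mem {N : ℕ} {F : ℕ → ℕ → PowerSeries A}
    (hF : ∀ i j, F i j ∈ orderGE A (i + j)) :
    ∑ n ∈ Finset.range (N + 1), ∑ p ∈ antidiagonal n, F p.1 p.2 -
      ∑ i ∈ Finset.range (N + 1), ∑ j ∈ Finset.range (N + 1), F i j ∈ orderGE A (N + 1) := by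
  classical
  rw [← Finset.sum_product', ← Finset.sum_filter_add_sum_filter_not
    (Finset.range (N + 1) ×ˢ Finset.range (N + 1)) (fun p => p.1 + p.2 ≤ N)]
  have h1 : ∑ n ∈ Finset.range (N + 1), ∑ p ∈ antidiagonal n, F p.1 p.2 =
      ∑ p ∈ Finset.range (N + 1) ×ˢ Finset.range (N + 1) with p.1 + p.2 ≤ N, F p.1 p.2 := by
    rw [← Finset.sum_fiberwise_of_maps_to (t := Finset.range (N + 1)) (g := fun p : ℕ × ℕ => p.1 + p.2)
      (fun (p : ℕ × ℕ) hp => by simp at hp ⊢; omega)]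
    refine Finset.sum_congr rfl fun n hn => Finset.sum_congr ?_ fun _ _ => rfl
    ext p
    simp at hn ⊢
    omega
  rw [h1, ← sub_sub, sub_self, zero_sub]
  refine neg_mem (sum_mem fun p hp => orderGE_mono ?_ (hF _ _))
  simp at hp
  omega

variable {K : Type*} [Field K] [Algebra K A]

theorem smul_mem_orderGE {k : ℕ} (c : K) {f : PowerSeries A} (hf : f ∈ orderGE A k) :
    c • f ∈ orderGE A k := fun m hm => by
  rw [coeff_smul, hf m hm, smul_zero]

theorem eulerDeriv_smul (c : K) (f : PowerSeries A) : eulerDeriv (c • f) = c • eulerDeriv f := by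
  ext n
  simp only [coeff_eulerDeriv, coeff_smul]
  rw [smul_comm]

variable (K) in
/-- The operator `ad Z` on `A[[t]]`. -/
noncomputable def adOp (Z : PowerSeries A) : Module.End K (PowerSeries A) :=
  LinearMap.mulLeft K Z - LinearMap.mulRight K Z

theorem adOp_apply (Z u : PowerSeries A) : adOp K Z u = Z * u - u * Z := rfl

theorem mul_eq_adOp_add (Z u : PowerSeries A) : Z * u = adOp K Z u + u * Z := by
  rw [adOp_apply, sub_add_cancel]

theorem adOp_pow_mem_orderGE {Z : PowerSeries A} (hZ : Z ∈ orderGE A 1) {i : ℕ} (k : ℕ)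
    {u : PowerSeries A} (hu : u ∈ orderGE A i) : (adOp K Z ^ k) u ∈ orderGE A (k + i) := by
  induction k with
  | zero => simpa using hu
  | succ k ih =>
    rw [pow_succ', Module.End.mul_apply, adOp_apply]
    refine sub_mem (orderGE_mono (by omega) (mul_mem_orderGE hZ ih))
      (orderGE_mono (by omega) (mul_mem_orderGE ih hZ))

variable (K) in
/-- The divided power `Z ^ n / n!`. -/
noncomputable def divPow (Z : PowerSeries A) (n : ℕ) : PowerSeries A :=
  (Nat.factorial n : K)⁻¹ • Z ^ n

theorem divPow_mem_orderGE {Z : PowerSeries A} (hZ : Z ∈ orderGE A 1) (n : ℕ) :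
    divPow K Z n ∈ orderGE A n := smul_mem_orderGE _ (pow_mem_orderGE hZ n)

theorem eulerDeriv_mem_orderGE {f : PowerSeries A} {k : ℕ} (hf : f ∈ orderGE A k) :
    eulerDeriv f ∈ orderGE A k := fun m hm => by
  rw [coeff_eulerDeriv, hf m hm, smul_zero]

/-- Multiplying a sum over `i + j = n + 1` by its degree, shifted by `c`, splits the degree into
`i + c` and `j`; if these factors lower the respective index, what remains is a sum over
`i + j = n`. This drives the inductions for Cauchy products of divided powers. -/
theorem smul_sum_antidiagonal_succ {M : Type*} [AddCommGroup M] [Module K M] (c : K)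
    (F F₁ F₂ : ℕ → ℕ → M)
    (h₁ : ∀ i j : ℕ, ((i : K) + 1 + c) • F (i + 1) j = F₁ i j)
    (h₂ : ∀ i j : ℕ, ((j : K) + 1) • F i (j + 1) = F₂ i j) (n : ℕ) :
    (((n : K) + 1) + c) • ∑ p ∈ antidiagonal (n + 1), F p.1 p.2 =
      c • F 0 (n + 1) + ∑ p ∈ antidiagonal n, (F₁ p.1 p.2 + F₂ p.1 p.2) := by
  have h : (((n : K) + 1) + c) • ∑ p ∈ antidiagonal (n + 1), F p.1 p.2 =
      ∑ p ∈ antidiagonal (n + 1), ((p.1 : K) + c) • F p.1 p.2 +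
        ∑ p ∈ antidiagonal (n + 1), (p.2 : K) • F p.1 p.2 := by
    rw [Finset.smul_sum, ← Finset.sum_add_distrib]
    refine Finset.sum_congr rfl fun p hp => ?_
    rw [← add_smul]
    congr 1
    have : ((p.1 + p.2 : ℕ) : K) = ((n + 1 : ℕ) : K) := by rw [mem_antidiagonal.1 hp]
    push_cast at this
    linear_combination -this
  rw [h, Finset.Nat.sum_antidiagonal_succ, Finset.Nat.sum_antidiagonal_succ',
    Finset.sum_add_distrib]
  simp only [Nat.cast_zero, zero_add, zero_smul, Nat.cast_add, Nat.cast_one, h₁, h₂]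
  abel

variable [CharZero K]

theorem succ_smul_inv_factorial {M : Type*} [AddCommGroup M] [Module K M] (n : ℕ) (m : M) :
    ((n : K) + 1) • (Nat.factorial (n + 1) : K)⁻¹ • m = (Nat.factorial n : K)⁻¹ • m := by
  have h1 : ((n : K) + 1) ≠ 0 := by exact_mod_cast Nat.succ_ne_zero n
  have h2 : (Nat.factorial n : K) ≠ 0 := by exact_mod_cast Nat.factorial_ne_zero n
  rw [smul_smul, Nat.factorial_succ]
  congr 1
  push_cast
  field_simp

theorem succ_smul_divPow_succ (Z : PowerSeries A) (n : ℕ) :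
    ((n : K) + 1) • divPow K Z (n + 1) = Z * divPow K Z n := by
  rw [divPow, succ_smul_inv_factorial, divPow, mul_smul_comm, pow_succ']

/-- `Z ^ n y / n! = ∑_{k + j = n} ((ad Z) ^ k y / k!) (Z ^ j / j!)`. -/
theorem divPow_mul_eq (Z y : PowerSeries A) (n : ℕ) :
    divPow K Z n * y = ∑ p ∈ antidiagonal n,
      ((Nat.factorial p.1 : K)⁻¹ • (adOp K Z ^ p.1) y) * divPow K Z p.2 := by
  induction n with
  | zero => simp [divPow]
  | succ n ih =>
    have hne : ((n : K) + 1) ≠ 0 := by exact_mod_cast Nat.succ_ne_zero n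
    refine smul_right_injective _ hne ?_
    have h := smul_sum_antidiagonal_succ (K := K) 0
      (fun i j => ((Nat.factorial i : K)⁻¹ • (adOp K Z ^ i) y) * divPow K Z j)
      (fun i j => (adOp K Z ((Nat.factorial i : K)⁻¹ • (adOp K Z ^ i) y)) * divPow K Z j)
      (fun i j => (((Nat.factorial i : K)⁻¹ • (adOp K Z ^ i) y)) * (Z * divPow K Z j))
      (fun i j => by
        rw [add_zero, ← smul_mul_assoc, succ_smul_inv_factorial, map_smul, pow_succ',
          Module.End.mul_apply])
      (fun i j => by rw [← mul_smul_comm, succ_smul_divPow_succ]) n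
    rw [add_zero] at h
    simp only
    rw [h, ← smul_mul_assoc, succ_smul_divPow_succ, mul_assoc, ih, Finset.mul_sum, zero_smul,
      zero_add]
    refine Finset.sum_congr rfl fun p _ => ?_
    rw [← mul_assoc, mul_eq_adOp_add (K := K) Z ((Nat.factorial p.1 : K)⁻¹ • _), add_mul,
      mul_assoc _ Z]

/-- The derivative of the exponential:
`(Z ^ (n + 1) / (n + 1)!)' = ∑_{k + j = n} ((ad Z) ^ k Z' / (k + 1)!) (Z ^ j / j!)`. -/
theorem eulerDeriv_divPow_succ (Z : PowerSeries A) (n : ℕ) :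
    eulerDeriv (divPow K Z (n + 1)) = ∑ p ∈ antidiagonal n,
      ((Nat.factorial (p.1 + 1) : K)⁻¹ • (adOp K Z ^ p.1) (eulerDeriv Z)) * divPow K Z p.2 := by
  induction n with
  | zero => simp [divPow]
  | succ n ih =>
    have hne : ((n : K) + 1 + 1) ≠ 0 := by exact_mod_cast Nat.succ_ne_zero (n + 1)
    refine smul_right_injective _ hne ?_
    have h := smul_sum_antidiagonal_succ (K := K) 1
      (fun i j => ((Nat.factorial (i + 1) : K)⁻¹ • (adOp K Z ^ i) (eulerDeriv Z)) * divPow K Z j)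
      (fun i j => (adOp K Z ((Nat.factorial (i + 1) : K)⁻¹ • (adOp K Z ^ i) (eulerDeriv Z)))
        * divPow K Z j)
      (fun i j => (((Nat.factorial (i + 1) : K)⁻¹ • (adOp K Z ^ i) (eulerDeriv Z)))
        * (Z * divPow K Z j))
      (fun i j => by
        rw [← smul_mul_assoc]
        have := succ_smul_inv_factorial (K := K) (i + 1) ((adOp K Z ^ (i + 1)) (eulerDeriv Z))
        push_cast at this
        rw [this, map_smul, pow_succ', Module.End.mul_apply])
      (fun i j => by rw [← mul_smul_comm, succ_smul_divPow_succ]) n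
    simp only
    have h2 := succ_smul_divPow_succ (K := K) Z (n + 1)
    push_cast at h2
    rw [h, ← eulerDeriv_smul, h2, eulerDeriv_mul, ih, Finset.mul_sum]
    congr 1
    · simp
    · refine Finset.sum_congr rfl fun p _ => ?_
      rw [← mul_assoc, mul_eq_adOp_add (K := K) Z ((Nat.factorial (p.1 + 1) : K)⁻¹ • _), add_mul,
        mul_assoc _ Z]

/-- The power series `∑ B_k t ^ k / k!` is inverse to `(e ^ t - 1) / t`. -/
theorem sum_antidiagonal_bernoulli (n : ℕ) :
    ∑ p ∈ antidiagonal n, (((bernoulli p.1 / Nat.factorial p.1 : ℚ) : K) *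
      (Nat.factorial (p.2 + 1) : K)⁻¹) = if n = 0 then 1 else 0 := by
  have h : ∑ p ∈ antidiagonal n, ((bernoulli p.1 / Nat.factorial p.1 : ℚ) *
      (Nat.factorial (p.2 + 1) : ℚ)⁻¹) = if n = 0 then 1 else 0 := by
    have h0 := bernoulli_spec' n
    have hn : (Nat.factorial n : ℚ) ≠ 0 := by exact_mod_cast Nat.factorial_ne_zero n
    have : ∑ p ∈ antidiagonal n, ((bernoulli p.1 / Nat.factorial p.1 : ℚ) *
      (Nat.factorial (p.2 + 1) : ℚ)⁻¹) = (if n = 0 then 1 else 0) / (Nat.factorial n : ℚ) := by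
      rw [← h0, Finset.sum_div]
      refine Finset.sum_congr rfl fun p hp => ?_
      rw [mem_antidiagonal.1 hp, ← mem_antidiagonal.1 hp, Nat.add_comm p.1,
        Nat.cast_add_choose ℚ, Nat.factorial_succ]
      have h1 : (Nat.factorial p.1 : ℚ) ≠ 0 := by exact_mod_cast Nat.factorial_ne_zero _
      have h2 : (Nat.factorial p.2 : ℚ) ≠ 0 := by exact_mod_cast Nat.factorial_ne_zero _
      have h3 : (Nat.factorial (p.2 + p.1) : ℚ) ≠ 0 := by exact_mod_cast Nat.factorial_ne_zero _
      have h4 : (p.2 : ℚ) + 1 ≠ 0 := by exact_mod_cast Nat.succ_ne_zero p.2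
      push_cast
      field_simp
    rw [this]
    split_ifs with hn0
    · simp [hn0]
    · simp
  have h' := congrArg (Rat.cast (K := K)) h
  push_cast at h' ⊢
  rw [h']
  split_ifs <;> simp

/-- The identity `∑ (-1) ^ k B_k t ^ k / k! = e ^ t · t / (e ^ t - 1)`. -/
theorem sum_antidiagonal_neg_one_pow_bernoulli (n : ℕ) :
    ∑ p ∈ antidiagonal n, (((bernoulli p.1 / Nat.factorial p.1 : ℚ) : K) *
      (Nat.factorial (p.2 + 1) : K)⁻¹ * (-1) ^ p.1) = (Nat.factorial n : K)⁻¹ := by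
  have h : ∑ p ∈ antidiagonal n, ((bernoulli p.1 / Nat.factorial p.1 : ℚ) *
      (Nat.factorial (p.2 + 1) : ℚ)⁻¹ * (-1) ^ p.1) = (Nat.factorial n : ℚ)⁻¹ := by
    have h0 := bernoulli'_spec' n
    have hn : (Nat.factorial n : ℚ) ≠ 0 := by exact_mod_cast Nat.factorial_ne_zero n
    rw [← one_div, ← congrArg (· / (Nat.factorial n : ℚ)) h0, Finset.sum_div]
    refine Finset.sum_congr rfl fun p hp => ?_
    rw [← mem_antidiagonal.1 hp, Nat.add_comm p.1,
      Nat.cast_add_choose ℚ, Nat.factorial_succ, bernoulli]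
    have h1 : (Nat.factorial p.1 : ℚ) ≠ 0 := by exact_mod_cast Nat.factorial_ne_zero _
    have h2 : (Nat.factorial p.2 : ℚ) ≠ 0 := by exact_mod_cast Nat.factorial_ne_zero _
    have h3 : (Nat.factorial (p.2 + p.1) : ℚ) ≠ 0 := by exact_mod_cast Nat.factorial_ne_zero _
    have h4 : (p.2 : ℚ) + 1 ≠ 0 := by exact_mod_cast Nat.succ_ne_zero p.2
    have h5 : ((-1 : ℚ) ^ p.1) * (-1) ^ p.1 = 1 := by
      rw [← mul_pow]; simp
    push_cast
    field_simp
    linear_combination (bernoulli' p.1) * h5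
  have h' := congrArg (Rat.cast (K := K)) h
  push_cast at h' ⊢
  rw [h']

end FormalBCH

section FormalBCH

/-! ### The exponential of the formal Baker-Campbell-Hausdorff series -/

open PowerSeries Finset.HasAntidiagonal

variable {A : Type*} [Ring A] {K : Type*} [Field K] [Algebra K A] [CharZero K]

/-- The coefficient of `t ^ n` in `exp (t x) exp (t y)`. -/
noncomputable def expMulCoeff (K : Type*) [Field K] [Algebra K A] (x y : A) (n : ℕ) : A :=
  ∑ p ∈ antidiagonal n, ((Nat.factorial p.1 : K)⁻¹ • x ^ p.1) * ((Nat.factorial p.2 : K)⁻¹ • y ^ p.2)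

theorem succ_smul_expMulCoeff (x y : A) (n : ℕ) :
    ((n : K) + 1) • expMulCoeff K x y (n + 1) =
      x * expMulCoeff K x y n + expMulCoeff K x y n * y := by
  have h := smul_sum_antidiagonal_succ (K := K) 0
    (fun i j => ((Nat.factorial i : K)⁻¹ • x ^ i) * ((Nat.factorial j : K)⁻¹ • y ^ j))
    (fun i j => x * (((Nat.factorial i : K)⁻¹ • x ^ i) * ((Nat.factorial j : K)⁻¹ • y ^ j)))
    (fun i j => (((Nat.factorial i : K)⁻¹ • x ^ i) * ((Nat.factorial j : K)⁻¹ • y ^ j)) * y)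
    (fun i j => by
      rw [add_zero, ← smul_mul_assoc, succ_smul_inv_factorial, pow_succ', ← mul_smul_comm,
        mul_assoc])
    (fun i j => by
      rw [← mul_smul_comm, succ_smul_inv_factorial, pow_succ, ← smul_mul_assoc, mul_assoc]) n
  rw [add_zero, zero_smul, zero_add, Finset.sum_add_distrib, ← Finset.mul_sum,
    ← Finset.sum_mul] at h
  exact h

theorem coeff_monomial_one_mul (x : A) (f : PowerSeries A) (n : ℕ) :
    coeff (n + 1) (monomial 1 x * f) = x * coeff n f := by
  rw [coeff_mul, Finset.Nat.sum_antidiagonal_succ, coeff_monomial, if_neg (by omega), zero_mul,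
    zero_add]
  rw [Finset.sum_eq_single (0, n)]
  · simp
  · intro p hp hne
    rw [coeff_monomial, if_neg, zero_mul]
    intro h
    have := mem_antidiagonal.1 hp
    exact hne (Prod.ext (by simpa using h) (by simp only; omega))
  · intro h
    simp at h

theorem coeff_mul_monomial_one (x : A) (f : PowerSeries A) (n : ℕ) :
    coeff (n + 1) (f * monomial 1 x) = coeff n f * x := by
  rw [coeff_mul, Finset.Nat.sum_antidiagonal_succ', coeff_monomial, if_neg (by omega), mul_zero,
    zero_add]
  rw [Finset.sum_eq_single (n, 0)]
  · simp
  · intro p hp hne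
    rw [coeff_monomial, if_neg, mul_zero]
    intro h
    have := mem_antidiagonal.1 hp
    exact hne (Prod.ext (by simp only; omega) (by simpa using h))
  · intro h
    simp at h

theorem monomial_one_mem_orderGE (x : A) : monomial 1 x ∈ orderGE A 1 := fun m hm => by
  rw [coeff_monomial, if_neg (by omega)]

/-- If `Z` solves `t Z' = ∑_k (B_k / k!) (ad Z) ^ k (t x + (-1) ^ k t y)` modulo `t ^ (N + 1)`,
then so does `E = exp Z` for the equation `t E' = t x E + E t y`. -/
theorem eulerDeriv_sum_divPow {Z : PowerSeries A} (hZ : Z ∈ orderGE A 1) (x y : A) (N : ℕ)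
    (hode : eulerDeriv Z - ∑ k ∈ Finset.range (N + 1),
      ((bernoulli k / (Nat.factorial k : ℚ) : ℚ) : K) •
        (adOp K Z ^ k) (monomial 1 (x + (-1 : K) ^ k • y)) ∈ orderGE A (N + 1)) :
    eulerDeriv (∑ n ∈ Finset.range (N + 1), divPow K Z n) -
      (monomial 1 x * (∑ n ∈ Finset.range (N + 1), divPow K Z n) +
        (∑ n ∈ Finset.range (N + 1), divPow K Z n) * monomial 1 y) ∈ orderGE A (N + 1) := by
  set E := ∑ n ∈ Finset.range (N + 1), divPow K Z n with hE
  set β : ℕ → K := fun k => ((bernoulli k / (Nat.factorial k : ℚ) : ℚ) : K) with hβ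
  set wk : ℕ → PowerSeries A := fun k => monomial 1 (x + (-1 : K) ^ k • y) with hw
  set V : ℕ → PowerSeries A := fun k =>
    (Nat.factorial (k + 1) : K)⁻¹ • (adOp K Z ^ k) (eulerDeriv Z) with hV
  have hθZ : eulerDeriv Z ∈ orderGE A 1 := eulerDeriv_mem_orderGE hZ
  have hVmem : ∀ k, V k ∈ orderGE A k := fun k =>
    orderGE_mono (Nat.le_succ k) (smul_mem_orderGE _ (adOp_pow_mem_orderGE hZ k hθZ))
  -- `θ E ≡ (∑ V_k) E`
  have h1 : eulerDeriv E - (∑ k ∈ Finset.range (N + 1), V k) * E ∈ orderGE A (N + 1) := by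
    have e1 : eulerDeriv (∑ n ∈ Finset.range (N + 1 + 1), divPow K Z n) =
        ∑ n ∈ Finset.range (N + 1), ∑ p ∈ antidiagonal n, V p.1 * divPow K Z p.2 := by
      rw [map_sum, Finset.sum_range_succ']
      simp only [eulerDeriv_divPow_succ]
      have : eulerDeriv (divPow K Z 0) = 0 := by
        ext n
        rcases n with _ | n <;> simp [coeff_eulerDeriv, divPow, coeff_one]
      rw [this, add_zero]
    have e2 := sum_antidiagonal_sub_sum_range_mem (N := N) (F := fun i j => V i * divPow K Z j)
      fun i j => mul_mem_orderGE (hVmem i) (divPow_mem_orderGE hZ j)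
    rw [← e1, Finset.sum_range_succ, map_add, ← Finset.sum_mul_sum] at e2
    have e3 := sub_mem e2 (eulerDeriv_mem_orderGE (divPow_mem_orderGE (K := K) hZ (N + 1)))
    convert e3 using 1
    abel
  -- `∑ V_k ≡ t x + ∑ (ad Z) ^ n (t y) / n!`
  have h2 : (∑ k ∈ Finset.range (N + 1), V k) - (monomial 1 x + ∑ n ∈ Finset.range (N + 1),
      (Nat.factorial n : K)⁻¹ • (adOp K Z ^ n) (monomial 1 y)) ∈ orderGE A (N + 1) := by
    have e1 : (∑ k ∈ Finset.range (N + 1), V k) - ∑ k ∈ Finset.range (N + 1),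
        ∑ m ∈ Finset.range (N + 1), ((Nat.factorial (k + 1) : K)⁻¹ * β m) •
          (adOp K Z ^ (k + m)) (wk m) ∈ orderGE A (N + 1) := by
      rw [← Finset.sum_sub_distrib]
      refine sum_mem fun k _ => ?_
      have := smul_mem_orderGE (K := K) (Nat.factorial (k + 1) : K)⁻¹ (adOp_pow_mem_orderGE (K := K) hZ k hode)
      rw [map_sub, smul_sub, map_sum, Finset.smul_sum] at this
      refine orderGE_mono (Nat.le_add_left _ k) ?_
      convert this using 3 with m
      rw [map_smul, smul_smul, pow_add, Module.End.mul_apply]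
    have e2 := sum_antidiagonal_sub_sum_range_mem (N := N)
      (F := fun m k => ((Nat.factorial (k + 1) : K)⁻¹ * β m) • (adOp K Z ^ (k + m)) (wk m))
      fun m k => orderGE_mono (by omega) (smul_mem_orderGE _
        (adOp_pow_mem_orderGE hZ (k + m) (monomial_one_mem_orderGE _)))
    rw [Finset.sum_comm (s := Finset.range (N + 1)) (t := Finset.range (N + 1))] at e2
    have e3 : ∀ n, ∑ p ∈ antidiagonal n, ((Nat.factorial (p.2 + 1) : K)⁻¹ * β p.1) •
        (adOp K Z ^ (p.2 + p.1)) (wk p.1) = (if n = 0 then monomial 1 x else 0) +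
          (Nat.factorial n : K)⁻¹ • (adOp K Z ^ n) (monomial 1 y) := by
      intro n
      have e4 : ∀ p ∈ antidiagonal n, ((Nat.factorial (p.2 + 1) : K)⁻¹ * β p.1) •
          (adOp K Z ^ (p.2 + p.1)) (wk p.1) =
          (β p.1 * (Nat.factorial (p.2 + 1) : K)⁻¹) • (adOp K Z ^ n) (monomial 1 x) +
          (β p.1 * (Nat.factorial (p.2 + 1) : K)⁻¹ * (-1) ^ p.1) •
            (adOp K Z ^ n) (monomial 1 y) := by
        intro p hp
        have e5 : wk p.1 = monomial 1 x + (-1 : K) ^ p.1 • monomial 1 y := by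
          rw [hw]
          ext m
          simp only [map_add, coeff_smul, coeff_monomial]
          split_ifs <;> simp
        rw [add_comm p.2 p.1, mem_antidiagonal.1 hp, e5, map_add, map_smul, smul_add, smul_smul,
          mul_comm (β p.1)]
      rw [Finset.sum_congr rfl e4, Finset.sum_add_distrib, ← Finset.sum_smul, ← Finset.sum_smul,
        sum_antidiagonal_bernoulli, sum_antidiagonal_neg_one_pow_bernoulli]
      congr 1
      split_ifs with hn
      · simp [hn]
      · simp
    simp only [e3] at e2
    rw [Finset.sum_add_distrib, Finset.sum_ite_eq' (Finset.range (N + 1)) 0,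
      if_pos (by simp)] at e2
    have e6 := sub_mem e1 e2
    convert e6 using 1
    abel
  -- `(∑ (ad Z) ^ n (t y) / n!) E ≡ E t y`
  have h3 : E * monomial 1 y - (∑ n ∈ Finset.range (N + 1),
      (Nat.factorial n : K)⁻¹ • (adOp K Z ^ n) (monomial 1 y)) * E ∈ orderGE A (N + 1) := by
    have := sum_antidiagonal_sub_sum_range_mem (N := N)
      (F := fun i j => ((Nat.factorial i : K)⁻¹ • (adOp K Z ^ i) (monomial 1 y)) * divPow K Z j)
      fun i j => mul_mem_orderGE (smul_mem_orderGE _ (orderGE_mono (Nat.le_add_right i 1)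
        (adOp_pow_mem_orderGE hZ i (monomial_one_mem_orderGE _)))) (divPow_mem_orderGE hZ j)
    simp only [← divPow_mul_eq] at this
    rwa [← Finset.sum_mul, ← Finset.sum_mul_sum] at this
  have h4 := sub_mem (add_mem h1 (mul_mem_orderGE_left E h2)) h3
  convert h4 using 1
  noncomm_ring

/-- The exponential of the solution of the differential equation of the
Baker-Campbell-Hausdorff series is `exp (t x) exp (t y)`. -/
theorem coeff_sum_divPow {Z : PowerSeries A} (hZ : Z ∈ orderGE A 1) (x y : A) (N : ℕ)
    (hode : eulerDeriv Z - ∑ k ∈ Finset.range (N + 1),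
      ((bernoulli k / (Nat.factorial k : ℚ) : ℚ) : K) •
        (adOp K Z ^ k) (monomial 1 (x + (-1 : K) ^ k • y)) ∈ orderGE A (N + 1)) :
    ∀ p ≤ N, coeff p (∑ n ∈ Finset.range (N + 1), divPow K Z n) = expMulCoeff K x y p := by
  intro p
  induction p with
  | zero =>
    intro _
    rw [Finset.sum_range_succ', map_add, map_sum, Finset.sum_eq_zero]
    · simp [divPow, expMulCoeff]
    · intro n _
      exact divPow_mem_orderGE hZ (n + 1) 0 (by omega)
  | succ p ih =>
    intro hp
    have h := eulerDeriv_sum_divPow hZ x y N hode (p + 1) (by omega)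
    rw [map_sub, sub_eq_zero, coeff_eulerDeriv, map_add, coeff_monomial_one_mul,
      coeff_mul_monomial_one, ih (by omega), ← succ_smul_expMulCoeff (K := K)] at h
    have hne : ((p : K) + 1) ≠ 0 := by exact_mod_cast Nat.succ_ne_zero p
    refine smul_right_injective _ hne ?_
    simp only
    rw [← h, ← Nat.cast_smul_eq_nsmul K]
    push_cast
    rfl

section Term

variable {M : Type*} [AddCommGroup M] [Module K M] (br : M → M → M)

omit [CharZero K] in
theorem bchPrefix_eq_bchTerm (x y : M) {n m : ℕ} (h : m ≤ n) :
    bchPrefix br K x y n m = bchTerm br K x y m := by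
  induction n with
  | zero =>
    obtain rfl : m = 0 := by omega
    rfl
  | succ n ih =>
    rcases h.lt_or_eq with h | rfl
    · rw [bchPrefix, Function.update_of_ne (by omega), ih (by omega)]
    · rfl

theorem adPowCoeff_congr {M : Type*} [AddCommGroup M] (br : M → M → M) {Z Z' : ℕ → M} (w : M)
    {n : ℕ} (h : ∀ m ≤ n, Z m = Z' m) (k : ℕ) :
    ∀ i ≤ n, adPowCoeff br Z w k i = adPowCoeff br Z' w k i := by
  induction k with
  | zero => exact fun i _ => rfl
  | succ k ih =>
    intro i hi
    rw [adPowCoeff, adPowCoeff]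
    refine Finset.sum_congr rfl fun m hm => ?_
    rw [Finset.mem_Icc] at hm
    rw [h m (by omega), ih _ (by omega)]

omit [CharZero K] in
theorem bchTerm_zero (x y : M) : bchTerm br K x y 0 = 0 := rfl

omit [CharZero K] in
theorem bchTerm_succ (x y : M) (n : ℕ) :
    bchTerm br K x y (n + 1) = ((n : K) + 1)⁻¹ • ∑ k ∈ Finset.range (n + 1),
      ((bernoulli k / (Nat.factorial k : ℚ) : ℚ) : K) •
        adPowCoeff br (bchTerm br K x y) (x + (-1 : K) ^ k • y) k n := by
  rw [bchTerm, bchPrefix, Function.update_self]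
  congr 1
  refine Finset.sum_congr rfl fun k _ => ?_
  rw [adPowCoeff_congr br _ (fun m hm => bchPrefix_eq_bchTerm br x y hm) k n le_rfl]

end Term

variable (K) in
/-- The Baker-Campbell-Hausdorff series of `x` and `y` in `A[[t]]`. -/
noncomputable def bchSeries (x y : A) : PowerSeries A :=
  PowerSeries.mk (bchTerm (fun a b : A => a * b - b * a) K x y)

omit [CharZero K] in
theorem bchSeries_mem_orderGE (x y : A) : bchSeries K x y ∈ orderGE A 1 := fun m hm => by
  obtain rfl : m = 0 := by omega
  rw [bchSeries, coeff_mk, bchTerm_zero]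

omit [CharZero K] in
theorem coeff_adOp_pow_monomial (x y w : A) (k n : ℕ) :
    coeff (n + 1) ((adOp K (bchSeries K x y) ^ k) (monomial 1 w)) =
      adPowCoeff (fun a b : A => a * b - b * a) (bchTerm (fun a b : A => a * b - b * a) K x y)
        w k n := by
  induction k generalizing n with
  | zero =>
    rw [pow_zero, Module.End.one_apply, coeff_monomial, adPowCoeff]
    simp
  | succ k ih =>
    rw [pow_succ', Module.End.mul_apply, adOp_apply, map_sub, adPowCoeff, Finset.sum_sub_distrib]
    set u := (adOp K (bchSeries K x y) ^ k) (monomial 1 w) with hu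
    have hu0 : coeff 0 u = 0 :=
      adOp_pow_mem_orderGE (bchSeries_mem_orderGE x y) k (monomial_one_mem_orderGE w) 0 (by omega)
    have hZ0 : coeff 0 (bchSeries K x y) = 0 := bchSeries_mem_orderGE x y 0 (by omega)
    have hreindex : ∀ F : ℕ → ℕ → A, (∀ j, F 0 j = 0) → (∀ i, F i 0 = 0) →
        ∑ p ∈ antidiagonal (n + 1), F p.1 p.2 = ∑ m ∈ Finset.Icc 1 n, F m (n - m + 1) := by
      intro F h0 h0'
      rw [Finset.Nat.sum_antidiagonal_eq_sum_range_succ_mk, Finset.sum_range_succ,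
        Finset.sum_range_succ']
      simp only [h0, tsub_self, h0', add_zero]
      have hI : Finset.Icc 1 n = Finset.Ico 1 (n + 1) := by
        ext
        simp
      rw [hI, Finset.sum_Ico_eq_sum_range]
      refine Finset.sum_congr rfl fun i hi => ?_
      have hi' := Finset.mem_range.1 hi
      congr 1 <;> omega
    have h1 : coeff (n + 1) (bchSeries K x y * u) = ∑ m ∈ Finset.Icc 1 n,
        coeff m (bchSeries K x y) * coeff (n - m + 1) u := by
      rw [coeff_mul]
      exact hreindex (fun i j => coeff i (bchSeries K x y) * coeff j u)
        (fun j => by simp only [hZ0, zero_mul]) (fun i => by simp only [hu0, mul_zero])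
    have h2 : coeff (n + 1) (u * bchSeries K x y) = ∑ m ∈ Finset.Icc 1 n,
        coeff (n - m + 1) u * coeff m (bchSeries K x y) := by
      rw [coeff_mul, ← Finset.Nat.sum_antidiagonal_swap]
      exact hreindex (fun i j => coeff j u * coeff i (bchSeries K x y))
        (fun j => by simp only [hZ0, mul_zero]) (fun i => by simp only [hu0, zero_mul])
    rw [h1, h2]
    simp only [ih, bchSeries, coeff_mk]

theorem eulerDeriv_bchSeries (x y : A) (N : ℕ) :
    eulerDeriv (bchSeries K x y) - ∑ k ∈ Finset.range (N + 1),
      ((bernoulli k / (Nat.factorial k : ℚ) : ℚ) : K) •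
        (adOp K (bchSeries K x y) ^ k) (monomial 1 (x + (-1 : K) ^ k • y)) ∈
      orderGE A (N + 1) := by
  intro p hp
  have hZ := bchSeries_mem_orderGE (K := K) x y
  rw [map_sub, map_sum, sub_eq_zero, coeff_eulerDeriv]
  rcases p with _ | n
  · rw [zero_smul, Finset.sum_eq_zero]
    intro k _
    rw [coeff_smul, adOp_pow_mem_orderGE (K := K) hZ k (monomial_one_mem_orderGE _) 0 (by omega), smul_zero]
  · rw [bchSeries, coeff_mk, bchTerm_succ, ← Nat.cast_smul_eq_nsmul K, smul_smul]
    have hne : ((n : K) + 1) ≠ 0 := by exact_mod_cast Nat.succ_ne_zero n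
    rw [Nat.cast_add, Nat.cast_one, mul_inv_cancel₀ hne, one_smul]
    rw [← Finset.sum_subset (Finset.range_mono (show n + 1 ≤ N + 1 by omega))]
    · refine Finset.sum_congr rfl fun k _ => ?_
      rw [coeff_smul, ← coeff_adOp_pow_monomial]
      rfl
    · intro k _ hk
      rw [Finset.mem_range] at hk
      rw [coeff_smul]
      have := adOp_pow_mem_orderGE (K := K) hZ k (monomial_one_mem_orderGE (x + (-1 : K) ^ k • y))
        (n + 1) (by omega)
      rw [bchSeries] at this
      rw [this, smul_zero]

/-- The Baker-Campbell-Hausdorff formula: `exp (Z(t)) = exp (t x) exp (t y)`. -/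
theorem coeff_exp_bchSeries (x y : A) (n : ℕ) :
    ∑ k ∈ Finset.range (n + 1), (Nat.factorial k : K)⁻¹ • coeff n (bchSeries K x y ^ k) =
      expMulCoeff K x y n := by
  rw [← coeff_sum_divPow (bchSeries_mem_orderGE (K := K) x y) x y n (eulerDeriv_bchSeries x y n) n
    le_rfl, map_sum]
  exact Finset.sum_congr rfl fun k _ => by rw [divPow, coeff_smul]

end FormalBCH

namespace HahnLimit

section Exponential

variable {C : Type w} [Field C]
variable {Γ : Type u} [AddCommGroup Γ] [LinearOrder Γ] [IsOrderedAddMonoid Γ]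
variable {D : Type v} [Preorder D] [IsDirectedOrder D] [Nonempty D] {G : D →o AddSubgroup Γ}

/-! ### Operators of given degree -/

theorem exists_forall_mem_level {T : Set (limitField C G)} (hT : T.Finite) :
    ∃ d, ∀ f ∈ T, f ∈ level C G d := by
  choose d hd using fun f : limitField C G => exists_mem_level f
  obtain ⟨e, he⟩ := (hT.image d).bddAbove
  exact ⟨e, fun f hf => level_mono (he ⟨f, hf, rfl⟩) (hd f)⟩

theorem val_lt_list_prod {B : Type*} {φ : B → Module.End C (limitField C G)}
    (hφ : ∀ b, Contracting (φ b)) {a : limitField C G} (ha : a ≠ 0) {l : List B} (hl : l ≠ []) :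
    val a < val ((l.map φ).prod a) := by
  have hle : ∀ l : List B, val a ≤ val ((l.map φ).prod a) := by
    intro l
    induction l with
    | nil => simp
    | cons b l ih =>
      rw [List.map_cons, List.prod_cons, Module.End.mul_apply]
      exact ih.trans ((hφ b).le_val _)
  obtain ⟨b, l, rfl⟩ := List.exists_cons_of_ne_nil hl
  rw [List.map_cons, List.prod_cons, Module.End.mul_apply]
  by_cases h : (l.map φ).prod a = 0
  · rw [h, map_zero, val_zero]
    obtain ⟨γ, hγ⟩ := exists_val ha
    rw [hγ]
    exact WithTop.coe_lt_top γ
  · exact (hle l).trans_lt (hφ b _ h)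

/-- An operator of degree `n` in the operators from `T` has its exponents covered by those of the
words of length `n`. -/
theorem exists_word_of_mem_span_pow {T : Set (Module.End C (limitField C G))} {n : ℕ}
    {P : Module.End C (limitField C G)} (hP : P ∈ Submodule.span C T ^ n) {a : limitField C G}
    {γ : Γ} (h : coeffAt γ (P a) ≠ 0) :
    ∃ l : List T, l.length = n ∧ coeffAt γ ((l.map Subtype.val).prod a) ≠ 0 := by
  rw [Submodule.span_pow] at hP
  induction hP using Submodule.span_induction with
  | mem P hP =>
    obtain ⟨f, rfl⟩ := Set.mem_pow.1 hP
    refine ⟨List.ofFn f, by simp, ?_⟩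
    rwa [List.map_ofFn]
  | zero => simp at h
  | add P Q _ _ hP hQ =>
    by_cases h1 : coeffAt γ (P a) = 0
    · refine hQ fun h2 => h ?_
      rw [LinearMap.add_apply, map_add, h1, h2, add_zero]
    · exact hP h1
  | smul c P _ hP =>
    refine hP fun h1 => h ?_
    rw [LinearMap.smul_apply, map_smul, h1, smul_zero]

/-! ### The operators `h ∂` and their exponentials -/

variable (der : Derivation C (limitField C G) (limitField C G))

/-- The operator `h ∂` on `𝕊`, depending linearly on `h`. -/
noncomputable def vf : limitField C G →ₗ[C] Module.End C (limitField C G) :=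
  LinearMap.mk₂ C (fun h a => h * der a) (fun _ _ _ => add_mul _ _ _)
    (fun _ _ _ => smul_mul_assoc _ _ _) (fun h a b => by rw [map_add, mul_add])
    (fun c h a => by rw [Derivation.map_smul, mul_smul_comm])

theorem vf_apply (h a : limitField C G) : vf der h a = h * der a := rfl

theorem vf_mul (h a b : limitField C G) :
    vf der h (a * b) = vf der h a * b + a * vf der h b := by
  simp only [vf_apply, Derivation.leibniz, smul_eq_mul]
  ring

theorem vf_bracket (f g : limitField C G) :
    vf der (bracket der f g) = vf der f * vf der g - vf der g * vf der f := by
  ext1 a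
  simp only [LinearMap.sub_apply, Module.End.mul_apply, vf_apply, bracket, Derivation.leibniz,
    smul_eq_mul]
  ring

variable {der}

theorem contracting_vf {h : limitField C G} (hh : h ∈ ContractiveHull der) :
    Contracting (vf der h) := hh

theorem stronglyLinear_vf (hreg : IsRegularMap der) (h : limitField C G) :
    StronglyLinear (vf der h) := by
  intro ι F s hs
  obtain ⟨d, hd⟩ := hs.summ.level
  exact ((hreg d).2 ι F s hd hs).mul_left h

theorem vf_mem_level (hreg : IsRegularMap der) {d : D} {h a : limitField C G}
    (hh : h ∈ level C G d) (ha : a ∈ level C G d) : vf der h a ∈ level C G d :=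
  mul_mem_level hh ((hreg d).1 a ha)

/-- A family `P_i a`, with `P_i` a polynomial of degree `ℓ i` in contracting operators `h ∂`, is
summable if only finitely many `P_i` have a given degree. -/
theorem summ_of_mem_span_pow (hcover : ∀ γ : Γ, ∃ d, γ ∈ G d) (hreg : IsRegularMap der)
    {T : Set (limitField C G)} (hT : T.Finite) (hTc : T ⊆ ContractiveHull der)
    (a : limitField C G) {ι : Type*} (ℓ : ι → ℕ) (hℓ : ∀ n, {i | ℓ i = n}.Finite)
    (P : ι → Module.End C (limitField C G))
    (hP : ∀ i, P i ∈ Submodule.span C (vf der '' T) ^ ℓ i) : Summ fun i => P i a := by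
  obtain ⟨d, hd⟩ := exists_forall_mem_level (hT.insert a)
  have : Finite (vf der '' T) := hT.image _
  have h := summ_words hcover (fun b : vf der '' T => b.1)
    (by rintro ⟨_, h, hh, rfl⟩; exact stronglyLinear_vf hreg h)
    (by rintro ⟨_, h, hh, rfl⟩; exact contracting_vf (hTc hh)) (d := d)
    (by
      rintro ⟨_, h, hh, rfl⟩ b hb
      exact vf_mem_level hreg (hd h (Or.inr hh)) hb) (hd a (Or.inl rfl))
  refine h.of_cover (fun i => {l | l.length = ℓ i}) (fun l => ?_) fun i γ hγ => ?_
  · exact (hℓ l.length).subset fun i hi => Eq.symm hi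
  · exact exists_word_of_mem_span_pow (hP i) hγ

theorem val_lt_of_mem_span_pow {T : Set (limitField C G)} (hTc : T ⊆ ContractiveHull der)
    {a : limitField C G} (ha : a ≠ 0) {n : ℕ} (hn : n ≠ 0) {P : Module.End C (limitField C G)}
    (hP : P ∈ Submodule.span C (vf der '' T) ^ n) : val a < val (P a) := by
  obtain ⟨γ, hγ⟩ := exists_val ha
  rw [hγ, lt_val_iff]
  intro δ hδ
  by_contra h
  obtain ⟨l, hl, hl'⟩ := exists_word_of_mem_span_pow hP h
  have h1 := (val_lt_list_prod (φ := fun b : vf der '' T => b.1)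
    (by rintro ⟨_, h, hh, rfl⟩; exact contracting_vf (hTc hh)) ha (l := l)
    (by rintro rfl; exact hn hl.symm)).trans_le (val_le_of_coeffAt_ne_zero hl')
  rw [hγ] at h1
  exact absurd (WithTop.coe_lt_coe.1 h1) (not_lt.2 hδ)

/-- The exponential `exp X = ∑ X ^ n / n!` of an operator. -/
noncomputable def expOp (X : Module.End C (limitField C G)) (a : limitField C G) :
    limitField C G := ssum fun n : ℕ => (Nat.factorial n : C)⁻¹ • (X ^ n) a

theorem vf_mem_span {T : Set (limitField C G)} {f : limitField C G} (hf : f ∈ T) :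
    vf der f ∈ Submodule.span C (vf der '' T) :=
  Submodule.subset_span (Set.mem_image_of_mem _ hf)

section

variable (hcover : ∀ γ : Γ, ∃ d, γ ∈ G d) (hreg : IsRegularMap der)
include hcover hreg

theorem hasStrongSum_expOp {f : limitField C G} (hf : f ∈ ContractiveHull der)
    (a : limitField C G) :
    HasStrongSum (fun n : ℕ => (Nat.factorial n : C)⁻¹ • (vf der f ^ n) a)
      (expOp (vf der f) a) := by
  refine Summ.hasStrongSum (Summ.smul ?_ _)
  exact summ_of_mem_span_pow hcover hreg (Set.finite_singleton f) (by simpa using hf) a id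
    (fun n => by simp) (fun n => vf der f ^ n) fun n => Submodule.pow_mem_pow _
      (vf_mem_span (T := {f}) (Set.mem_singleton f)) n

theorem hasStrongSum_expOp_expOp {f g : limitField C G} (hf : f ∈ ContractiveHull der)
    (hg : g ∈ ContractiveHull der) (a : limitField C G) :
    HasStrongSum (fun p : ℕ × ℕ => (Nat.factorial p.1 : C)⁻¹ • (vf der f ^ p.1)
      ((Nat.factorial p.2 : C)⁻¹ • (vf der g ^ p.2) a)) (expOp (vf der f) (expOp (vf der g) a)) := by
  have hs : Summ fun p : ℕ × ℕ => (Nat.factorial p.1 : C)⁻¹ • (vf der f ^ p.1)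
      ((Nat.factorial p.2 : C)⁻¹ • (vf der g ^ p.2) a) := by
    refine Summ.smul ?_ _
    simp only [map_smul]
    refine Summ.smul ?_ _
    refine summ_of_mem_span_pow hcover hreg (Set.toFinite {f, g})
      (by rintro h (rfl | rfl) <;> assumption) a (fun p : ℕ × ℕ => p.1 + p.2)
      (fun n => ?_) (fun p => vf der f ^ p.1 * vf der g ^ p.2) fun p => ?_
    · exact (Finset.HasAntidiagonal.antidiagonal n).finite_toSet.subset fun p hp => by simpa using hp
    · rw [pow_add]
      exact Submodule.mul_mem_mul (Submodule.pow_mem_pow _ (vf_mem_span (T := {f, g}) (Set.mem_insert f _)) _)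
        (Submodule.pow_mem_pow _
          (vf_mem_span (T := {f, g}) (Set.mem_insert_of_mem _ (Set.mem_singleton g))) _)
  have h1 := hs.hasStrongSum.rows fun i =>
    (((stronglyLinear_vf hreg f).pow i).map (hasStrongSum_expOp hcover hreg hg a)).smul
      (Nat.factorial i : C)⁻¹
  rw [(hasStrongSum_expOp hcover hreg hf _).unique h1]
  exact hs.hasStrongSum

theorem hasStrongSum_expOp_cols {f g : limitField C G} (hf : f ∈ ContractiveHull der)
    (hg : g ∈ ContractiveHull der) (a : limitField C G) :
    HasStrongSum (fun n : ℕ => (Nat.factorial n : C)⁻¹ • expOp (vf der f) ((vf der g ^ n) a))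
      (expOp (vf der f) (expOp (vf der g) a)) := by
  refine (hasStrongSum_expOp_expOp hcover hreg hf hg a).cols fun n => ?_
  refine ((hasStrongSum_expOp hcover hreg hf ((vf der g ^ n) a)).smul
    (Nat.factorial n : C)⁻¹).congr fun i => ?_
  rw [map_smul, smul_comm]

theorem hasStrongSum_expMulCoeff {f g : limitField C G} (hf : f ∈ ContractiveHull der)
    (hg : g ∈ ContractiveHull der) (a : limitField C G) :
    HasStrongSum (fun n : ℕ => expMulCoeff C (vf der f) (vf der g) n a)
      (expOp (vf der f) (expOp (vf der g) a)) := by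
  refine (hasStrongSum_expOp_expOp hcover hreg hf hg a).antidiagonal.congr fun n => ?_
  rw [expMulCoeff, LinearMap.sum_apply]
  rfl

end

end Exponential

/-! ### The Baker-Campbell-Hausdorff product -/

section BCHNaturality

variable {K : Type*} [Field K] {M M' : Type*} [AddCommGroup M] [Module K M] [AddCommGroup M']
  [Module K M'] {br : M → M → M} {br' : M' → M' → M'}

theorem map_adPowCoeff (φ : M →ₗ[K] M') (hφ : ∀ a b, φ (br a b) = br' (φ a) (φ b)) (Z : ℕ → M)
    (x : M) (k n : ℕ) :
    φ (adPowCoeff br Z x k n) = adPowCoeff br' (fun m => φ (Z m)) (φ x) k n := by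
  induction k generalizing n with
  | zero =>
    rw [adPowCoeff, adPowCoeff]
    split_ifs <;> simp
  | succ k ih =>
    rw [adPowCoeff, adPowCoeff, map_sum]
    exact Finset.sum_congr rfl fun m _ => by rw [hφ, ih]

/-- Linear maps that preserve brackets preserve the Baker-Campbell-Hausdorff series. -/
theorem map_bchTerm (φ : M →ₗ[K] M') (hφ : ∀ a b, φ (br a b) = br' (φ a) (φ b)) (x y : M)
    (n : ℕ) : φ (bchTerm br K x y n) = bchTerm br' K (φ x) (φ y) n := by
  induction n using Nat.strong_induction_on with
  | _ n ih =>
    rcases n with _ | n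
    · rw [bchTerm_zero, bchTerm_zero, map_zero]
    · rw [bchTerm_succ, bchTerm_succ, map_smul, map_sum]
      congr 1
      refine Finset.sum_congr rfl fun k _ => ?_
      rw [map_smul, map_adPowCoeff φ hφ, map_add, map_smul,
        adPowCoeff_congr br' _ (fun m hm => ih m (by omega)) k n le_rfl]

variable {A : Type*} [Ring A] [Algebra K A]

theorem bchTerm_mem_pow {M : Submodule K A} {x y : A} (hx : x ∈ M) (hy : y ∈ M) (n : ℕ) :
    bchTerm (fun a b : A => a * b - b * a) K x y n ∈ M ^ n := by
  induction n using Nat.strong_induction_on with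
  | _ n ih =>
    rcases n with _ | n
    · rw [bchTerm_zero]
      exact zero_mem _
    · rw [bchTerm_succ]
      refine Submodule.smul_mem _ _ (sum_mem fun k _ => Submodule.smul_mem _ _ ?_)
      have h : ∀ w ∈ M, ∀ k, ∀ i ≤ n, adPowCoeff (fun a b : A => a * b - b * a)
          (bchTerm (fun a b : A => a * b - b * a) K x y) w k i ∈ M ^ (i + 1) := by
        intro w hw k
        induction k with
        | zero =>
          intro i _
          rw [adPowCoeff]
          split_ifs with hi
          · subst hi
            simpa using hw
          · exact zero_mem _
        | succ k ihk =>
          intro i hi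
          rw [adPowCoeff]
          refine sum_mem fun m hm => ?_
          rw [Finset.mem_Icc] at hm
          have h1 := ih m (by omega)
          have h2 := ihk (i - m) (by omega)
          refine sub_mem ?_ ?_
          · have := Submodule.mul_mem_mul h1 h2
            rw [← pow_add] at this
            rwa [show i + 1 = m + (i - m + 1) by omega]
          · have := Submodule.mul_mem_mul h2 h1
            rw [← pow_add] at this
            rwa [show i + 1 = i - m + 1 + m by omega]
      exact h _ (add_mem hx (Submodule.smul_mem _ _ hy)) k n le_rfl

theorem coeff_pow_mem_pow {M : Submodule K A} {Z : PowerSeries A}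
    (hZ : ∀ n, PowerSeries.coeff n Z ∈ M ^ n) (k n : ℕ) :
    PowerSeries.coeff n (Z ^ k) ∈ M ^ n := by
  induction k generalizing n with
  | zero =>
    rw [pow_zero, PowerSeries.coeff_one]
    split_ifs with h
    · rw [h, pow_zero]
      exact Submodule.one_le.1 le_rfl
    · exact zero_mem _
  | succ k ih =>
    rw [pow_succ, PowerSeries.coeff_mul]
    refine sum_mem fun p hp => ?_
    rw [← Finset.HasAntidiagonal.mem_antidiagonal.1 hp, pow_add]
    exact Submodule.mul_mem_mul (ih _) (hZ _)

end BCHNaturality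

section BCHProduct

variable {C : Type w} [Field C]
variable {Γ : Type u} [AddCommGroup Γ] [LinearOrder Γ] [IsOrderedAddMonoid Γ]
variable {D : Type v} [Preorder D] [IsDirectedOrder D] [Nonempty D] {G : D →o AddSubgroup Γ}
variable {der : Derivation C (limitField C G) (limitField C G)}

/-- `h ↦ h ∂` takes the Baker-Campbell-Hausdorff series of `f` and `g` to that of `f ∂` and `g ∂` in
the associative algebra of operators. -/
theorem vf_bchTerm (f g : limitField C G) (n : ℕ) :
    vf der (bchTerm (bracket der) C f g n) =
      PowerSeries.coeff n (bchSeries C (vf der f) (vf der g)) := by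
  rw [bchSeries, PowerSeries.coeff_mk]
  exact map_bchTerm (K := C) (br := bracket der)
    (br' := fun a b : Module.End C (limitField C G) => a * b - b * a) (vf der)
    (vf_bracket der) f g n

theorem coeff_bchSeries_mem (f g : limitField C G) (n : ℕ) :
    PowerSeries.coeff n (bchSeries C (vf der f) (vf der g)) ∈
      Submodule.span C (vf der '' {f, g}) ^ n := by
  rw [bchSeries, PowerSeries.coeff_mk]
  exact bchTerm_mem_pow (vf_mem_span (T := {f, g}) (Set.mem_insert f _))
    (vf_mem_span (T := {f, g}) (Set.mem_insert_of_mem _ (Set.mem_singleton g))) n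

theorem mem_contractiveHull_of_isBCHProduct {f g k : limitField C G}
    (hf : f ∈ ContractiveHull der) (hg : g ∈ ContractiveHull der) (hk : IsBCHProduct der f g k) :
    k ∈ ContractiveHull der := by
  intro a ha
  obtain ⟨γ, hγ⟩ := exists_val ha
  have h := hk.mul_left (der a)
  rw [mul_comm] at h
  rw [hγ]
  refine h.lt_val fun n => ?_
  rw [mul_comm, ← vf_apply, vf_bchTerm, ← hγ]
  rcases n with _ | n
  · rw [bchSeries_mem_orderGE _ _ 0 (by omega), LinearMap.zero_apply, val_zero, hγ]
    exact WithTop.coe_lt_top γ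
  · exact val_lt_of_mem_span_pow (T := {f, g}) (by rintro h (rfl | rfl) <;> assumption) ha
      (Nat.succ_ne_zero n) (coeff_bchSeries_mem f g (n + 1))

/-- `(k ∂) ^ m = Z ^ m` for `Z` the Baker-Campbell-Hausdorff series in `f ∂` and `g ∂` at `t = 1`. -/
theorem hasStrongSum_vf_pow (hreg : IsRegularMap der) {f g k : limitField C G}
    (hk : IsBCHProduct der f g k) (a : limitField C G) (m : ℕ) :
    HasStrongSum (fun n => PowerSeries.coeff n (bchSeries C (vf der f) (vf der g) ^ m) a)
      ((vf der k ^ m) a) := by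
  induction m with
  | zero =>
    refine (hasStrongSum_pi_single 0 a).congr fun n => ?_
    rw [pow_zero, PowerSeries.coeff_one]
    by_cases h : n = 0
    · subst h
      simp
    · simp [h]
  | succ m ih =>
    have h := (HasStrongSum.mul hk ((stronglyLinear_vf hreg 1).map ih)).antidiagonal
    rw [pow_succ' (vf der k), Module.End.mul_apply, vf_apply]
    simp only [vf_apply, one_mul] at h
    refine h.congr fun n => ?_
    rw [pow_succ', PowerSeries.coeff_mul, LinearMap.sum_apply]
    refine Finset.sum_congr rfl fun p _ => ?_
    rw [Module.End.mul_apply, ← vf_bchTerm, vf_apply]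

variable (hcover : ∀ γ : Γ, ∃ d, γ ∈ G d) (hreg : IsRegularMap der)
include hcover hreg

/-- The Baker-Campbell-Hausdorff series is summable: if `Z_n` is its component of degree `n`, then
`Z_n a' = (Z_n ∂) a`, where `Z_n ∂` is a polynomial of degree `n` in `f ∂` and `g ∂`. -/
theorem summ_bchTerm {f g : limitField C G} (hf : f ∈ ContractiveHull der)
    (hg : g ∈ ContractiveHull der) {a : limitField C G} (ha : der a ≠ 0) :
    Summ fun n => bchTerm (bracket der) C f g n := by
  have h := summ_of_mem_span_pow hcover hreg (Set.toFinite {f, g})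
    (by rintro h (rfl | rfl) <;> assumption) a id (fun n => by simp)
    (fun n => PowerSeries.coeff n (bchSeries C (vf der f) (vf der g))) (coeff_bchSeries_mem f g)
  refine (h.hasStrongSum.mul_left (der a)⁻¹).summ.of_cover (fun n => {n})
    (fun n => by simp) fun n γ hγ => ⟨n, rfl, ?_⟩
  rwa [← vf_bchTerm, vf_apply, mul_comm _ (der a), inv_mul_cancel_left₀ ha]

/-- `exp ((f ∗ g) ∂) = exp (f ∂) exp (g ∂)`: both sides are sums of the double family of the
components of degree `n` of `Z ^ m / m!`, where `Z` is the Baker-Campbell-Hausdorff series. -/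
theorem expOp_vf_of_isBCHProduct [CharZero C] {f g k : limitField C G} (hf : f ∈ ContractiveHull der)
    (hg : g ∈ ContractiveHull der) (hk : IsBCHProduct der f g k) (a : limitField C G) :
    expOp (vf der k) a = expOp (vf der f) (expOp (vf der g) a) := by
  set ζ := bchSeries C (vf der f) (vf der g) with hζ
  have hord : ∀ m n, n < m → PowerSeries.coeff n (ζ ^ m) = 0 := fun m n h =>
    pow_mem_orderGE (bchSeries_mem_orderGE _ _) m n h
  have hs : Summ fun p : ℕ × ℕ =>
      (Nat.factorial p.1 : C)⁻¹ • PowerSeries.coeff p.2 (ζ ^ p.1) a := by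
    refine Summ.smul ?_ _
    have h1 := summ_of_mem_span_pow hcover hreg (Set.toFinite {f, g})
      (by rintro h (rfl | rfl) <;> assumption) a (fun p : {p : ℕ × ℕ // p.1 ≤ p.2} => p.1.2)
      (fun n => by
        refine Set.Finite.of_finite_image (f := Subtype.val) ?_ Subtype.val_injective.injOn
        refine (Finset.range (n + 1) ×ˢ {n}).finite_toSet.subset ?_
        rintro _ ⟨⟨p, hp⟩, rfl, rfl⟩
        exact Finset.mem_coe.2 (Finset.mem_product.2
          ⟨Finset.mem_range.2 (Nat.lt_succ_of_le hp), Finset.mem_singleton.2 rfl⟩))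
      (fun p => PowerSeries.coeff p.1.2 (ζ ^ p.1.1))
      fun p => coeff_pow_mem_pow (coeff_bchSeries_mem f g) p.1.1 p.1.2
    refine h1.of_cover (fun p => {q | q.1 = p}) (fun q => by simp) fun p γ hγ => ?_
    have hp : p.1 ≤ p.2 := by
      by_contra hlt
      rw [hord _ _ (not_le.1 hlt)] at hγ
      simp at hγ
    exact ⟨⟨p, hp⟩, rfl, hγ⟩
  -- Sum over `n` first for the left-hand side, and over `m` first for the right-hand side.
  have h1 := hs.hasStrongSum.rows fun m =>
    (hasStrongSum_vf_pow hreg hk a m).smul (Nat.factorial m : C)⁻¹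
  have h2 := hs.hasStrongSum.cols (r := fun n => expMulCoeff C (vf der f) (vf der g) n a)
    fun n => by
      have := hasStrongSum_of_support_subset (F := fun m : ℕ =>
        (Nat.factorial m : C)⁻¹ • PowerSeries.coeff n (ζ ^ m) a) (Finset.range (n + 1))
        fun m hm => by
          rw [hord m n (by simpa using hm)]
          simp
      rw [← coeff_exp_bchSeries, LinearMap.sum_apply]
      exact this
  have hkc := mem_contractiveHull_of_isBCHProduct hf hg hk
  rw [(hasStrongSum_expOp hcover hreg hkc a).unique h1]
  exact h2.unique (hasStrongSum_expMulCoeff hcover hreg hf hg a)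

end BCHProduct

end HahnLimit

namespace HahnLimit

section Asymptotic

variable {C : Type w} [Field C]
variable {Γ : Type u} [AddCommGroup Γ] [LinearOrder Γ] [IsOrderedAddMonoid Γ]
variable {D : Type v} [Preorder D] [IsDirectedOrder D] [Nonempty D] {G : D →o AddSubgroup Γ}
variable {der : Derivation C (limitField C G) (limitField C G)}

/-! ### Valuations of derivatives -/

theorem der_ne_zero (hker : KernelEqConstants der) {a : limitField C G} (ha : a ≠ 0)
    (hv : val a ≠ 0) : der a ≠ 0 := by
  intro h
  obtain ⟨c, rfl⟩ := (hker a).1 h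
  have hc : c ≠ 0 := by
    rintro rfl
    simp at ha
  rw [Algebra.algebraMap_eq_smul_one, val_smul hc, val_one] at hv
  exact hv rfl

theorem der_smul_one (c : C) : der (c • (1 : limitField C G)) = 0 := by
  rw [Derivation.map_smul, Derivation.map_one_eq_zero, smul_zero]

theorem val_der_inv {a : limitField C G} {γ γ' : Γ} (ha : val a = γ) (ha' : val (der a) = γ') :
    val (der a⁻¹) = ((γ' - γ - γ : Γ) : WithTop Γ) := by
  rw [Derivation.leibniz_inv, smul_eq_mul, neg_mul, val_neg, val_mul, pow_two, val_mul, val_inv ha,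
    ha', ← WithTop.coe_add, ← WithTop.coe_add, WithTop.coe_inj]
  abel

-- The following three facts are the inequalities between values and derivatives needed for
-- `val_der_lt_aux`, with `α'` the value of `∂ a` and `α' - α - α` that of `∂ (a⁻¹)`.

theorem lt_of_dagger_le_of_neg {α β α' β' : Γ} (hαβ : α < β)
    (h : α' - α - α - -α ≤ β' - β - β - -β) : α' < β' := by grind

theorem lt_of_inv_deriv_le {α α' β' : Γ} (hα : α < 0) (h : α' - α - α ≤ β') : α' < β' := by grind

theorem lt_of_dagger_le_of_pos {α β α' β' : Γ} (hα : α < 0) (hβ : 0 < β)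
    (h : α' - α - α - -α ≤ β' - β) : α' < β' := by grind

/-- The axioms of an H-asymptotic field concern infinitesimal elements; infinite ones are replaced by
their inverses. -/
theorem val_der_lt_aux (hker : KernelEqConstants der) (hH : IsHAsymptotic der)
    {a b : limitField C G} {α β : Γ} (hα : val a = α) (hβ : val b = β) (hα0 : α ≠ 0) (hβ0 : β ≠ 0)
    (hab : α < β) : val (der a) < val (der b) := by
  have ha := ne_zero_of_val hα
  have hb := ne_zero_of_val hβ
  have cast0 : ∀ {γ : Γ}, γ ≠ 0 → (γ : WithTop Γ) ≠ 0 := fun h => by exact_mod_cast h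
  obtain ⟨α', hα'⟩ := exists_val (der_ne_zero hker ha (hα ▸ cast0 hα0))
  obtain ⟨β', hβ'⟩ := exists_val (der_ne_zero hker hb (hβ ▸ cast0 hβ0))
  have hia := val_inv hα
  have hia' := val_der_inv hα hα'
  have hib := val_inv hβ
  have hib' := val_der_inv hβ hβ'
  have pos : ∀ {f : limitField C G} {γ : Γ}, val f = γ → 0 < γ → 0 < val f := fun h h0 => by
    rw [h]; exact_mod_cast h0
  have key : ∀ {f g : limitField C G} {φ φ' ψ ψ' : Γ}, val f = φ → val g = ψ → val (der f) = φ' →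
      val (der g) = ψ' → 0 < φ → 0 < ψ →
      (ψ < φ ↔ ψ' < φ') ∧ (ψ < φ → φ' - φ ≤ ψ' - ψ) := by
    intro f g φ φ' ψ ψ' h1 h2 h3 h4 h5 h6
    have := hH f g (ne_zero_of_val h1) (ne_zero_of_val h2) (pos h1 h5) (pos h2 h6)
    rw [val_div h3 h1, val_div h4 h2, h1, h2, h3, h4] at this
    simpa only [WithTop.coe_lt_coe, WithTop.coe_le_coe] using this
  rw [hα', hβ', WithTop.coe_lt_coe]
  rcases lt_or_gt_of_ne hα0 with hα1 | hα1
  · rcases lt_or_gt_of_ne hβ0 with hβ1 | hβ1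
    · exact lt_of_dagger_le_of_neg hab ((key hia hib hia' hib' (neg_pos.2 hα1)
        (neg_pos.2 hβ1)).2 (neg_lt_neg hab))
    · have h1 := key hia hβ hia' hβ' (neg_pos.2 hα1) hβ1
      have h2 := key hβ hia hβ' hia' hβ1 (neg_pos.2 hα1)
      rcases lt_trichotomy (-α) β with h | h | h
      · exact lt_of_inv_deriv_le hα1 (h2.1.1 h).le
      · exact lt_of_inv_deriv_le hα1 (not_lt.1 fun h' => (h1.1.2 h').ne h.symm)
      · exact lt_of_dagger_le_of_pos hα1 hβ1 (h1.2 h)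
  · exact (key hβ hα hβ' hα' (hα1.trans hab) hα1).1.1 hab

/-- In the asymptotic field `𝕊`: if `b ≺ a` and `a` is not asymptotic to a constant, then
`b' ≺ a'`. -/
theorem val_der_lt (hker : KernelEqConstants der) (hH : IsHAsymptotic der)
    {a b : limitField C G} (ha : val a ≠ 0) (hab : val a < val b) : val (der a) < val (der b) := by
  have ha0 := ne_zero_of_val_lt hab
  obtain ⟨α, hα⟩ := exists_val ha0
  have hα0 : α ≠ 0 := by
    rintro rfl
    exact ha hα
  have h0 : ∀ {b : limitField C G}, val a < val b → val b ≠ 0 → val (der a) < val (der b) := by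
    intro b hab hb
    by_cases hb0 : b = 0
    · obtain ⟨α', hα'⟩ := exists_val (der_ne_zero hker ha0 ha)
      rw [hb0, map_zero, val_zero, hα']
      exact WithTop.coe_lt_top _
    · obtain ⟨β, hβ⟩ := exists_val hb0
      refine val_der_lt_aux hker hH hα hβ hα0 ?_ ?_
      · rintro rfl
        exact hb hβ
      · rw [hα, hβ] at hab
        exact WithTop.coe_lt_coe.1 hab
  by_cases hb : val b = 0
  · obtain ⟨c, -, hc⟩ := exists_lt_val_sub_smul (f := 1) (g := b) one_ne_zero (by rw [val_one, hb])
    rw [val_one] at hc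
    have := h0 ((hb ▸ hab).trans hc) hc.ne'
    rwa [map_sub, der_smul_one, sub_zero] at this
  · exact h0 hab hb

theorem val_der_eq (hker : KernelEqConstants der) (hH : IsHAsymptotic der)
    {a b : limitField C G} (ha : val a ≠ 0) (hab : val a = val b) :
    val (der a) = val (der b) := by
  by_cases ha0 : a = 0
  · have hb0 : b = 0 := by rwa [ha0, val_zero, eq_comm, val_eq_top] at hab
    rw [ha0, hb0]
  obtain ⟨c, hc, h⟩ := exists_lt_val_sub_smul ha0 hab
  have h1 := val_der_lt hker hH ha h
  rw [map_sub, Derivation.map_smul] at h1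
  rw [← val_smul hc] at h1 ⊢
  have := val_add_eq_left h1
  rw [← this, add_sub_cancel]

theorem val_lt_of_val_der_lt (hker : KernelEqConstants der) (hH : IsHAsymptotic der)
    {a b : limitField C G} (hb : val b ≠ 0) (h : val (der a) < val (der b)) : val a < val b := by
  by_contra! h1
  rcases h1.lt_or_eq with h1 | h1
  · exact lt_asymm h (val_der_lt hker hH hb h1)
  · exact h.ne (val_der_eq hker hH hb h1).symm

theorem exists_val_ne_zero (hG : ∀ d, Nontrivial (G d)) (hcover : ∀ γ : Γ, ∃ d, γ ∈ G d) :
    ∃ a : limitField C G, a ≠ 0 ∧ val a ≠ 0 := by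
  obtain ⟨⟨γ, hγ⟩, hne⟩ := @exists_ne _ (hG (Classical.arbitrary D)) 0
  have hγ0 : γ ≠ 0 := fun h => hne (Subtype.ext h)
  have hv := val_term hcover γ (one_ne_zero (α := C))
  exact ⟨term hcover γ 1, ne_zero_of_val hv, hv ▸ by exact_mod_cast hγ0⟩

/-! ### The group of contracting elements -/

theorem zero_mem_contractiveHull : (0 : limitField C G) ∈ ContractiveHull der := by
  intro a ha
  obtain ⟨γ, hγ⟩ := exists_val ha
  rw [zero_mul, val_zero, hγ]
  exact WithTop.coe_lt_top γ

theorem neg_mem_contractiveHull {f : limitField C G} (hf : f ∈ ContractiveHull der) :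
    -f ∈ ContractiveHull der := by
  intro a ha
  rw [neg_mul, val_neg]
  exact hf a ha

theorem mem_contractiveHull_of_le {f g : limitField C G} (hf : f ∈ ContractiveHull der)
    (h : val f ≤ val g) : g ∈ ContractiveHull der := by
  intro a ha
  have := hf a ha
  rw [val_mul] at this ⊢
  exact this.trans_le (by gcongr)

section

variable (hcover : ∀ γ : Γ, ∃ d, γ ∈ G d) (hreg : IsRegularMap der)
include hcover hreg

theorem expOp_vf_zero (a : limitField C G) : expOp (vf der 0) a = a := by
  refine (hasStrongSum_expOp hcover hreg zero_mem_contractiveHull a).unique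
    ((hasStrongSum_pi_single 0 a).congr fun n => ?_)
  rcases n with _ | n
  · simp
  · simp

theorem expOp_vf_expOp_vf_neg [CharZero C] {f : limitField C G} (hf : f ∈ ContractiveHull der)
    (a : limitField C G) : expOp (vf der f) (expOp (vf der (-f)) a) = a := by
  have h : ∀ n, expMulCoeff C (vf der f) (vf der (-f)) n = if n = 0 then 1 else 0 := by
    intro n
    induction n with
    | zero => simp [expMulCoeff]
    | succ n ih =>
      have h1 := succ_smul_expMulCoeff (K := C) (vf der f) (vf der (-f)) n
      have hne : ((n : C) + 1) ≠ 0 := by exact_mod_cast Nat.succ_ne_zero n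
      rw [ih] at h1
      have h2 : vf der f * (if n = 0 then 1 else 0) + (if n = 0 then 1 else 0) * vf der (-f) = 0 := by
        rw [map_neg]
        split_ifs <;> simp
      rw [h2] at h1
      have h3 := congrArg (((n : C) + 1)⁻¹ • ·) h1
      simp only [smul_smul, inv_mul_cancel₀ hne, one_smul, smul_zero] at h3
      rw [if_neg (Nat.succ_ne_zero n), h3]
  refine (hasStrongSum_expMulCoeff hcover hreg hf (neg_mem_contractiveHull hf) a).unique
    ((hasStrongSum_pi_single 0 a).congr fun n => ?_)
  rw [h]
  rcases n with _ | n
  · simp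
  · simp

variable (hker : KernelEqConstants der) (hH : IsHAsymptotic der) (hG : ∀ d, Nontrivial (G d))
include hker hH hG

/-- `exp (f ∂)` determines `f`, because `exp (f ∂) a - exp (g ∂) a ∼ (f - g) a'` whenever `a` is not
asymptotic to a constant. -/
theorem eq_of_expOp_vf_eq {f g : limitField C G} (hf : f ∈ ContractiveHull der)
    (hg : g ∈ ContractiveHull der) (h : ∀ a, expOp (vf der f) a = expOp (vf der g) a) : f = g := by
  by_contra hne
  obtain ⟨a, ha, hva⟩ := exists_val_ne_zero (C := C) hG hcover
  have ha' := der_ne_zero hker ha hva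
  obtain ⟨γ, hγ⟩ := exists_val (mul_ne_zero (sub_ne_zero.2 hne) ha')
  have hstep : ∀ n, (vf der f ^ (n + 1)) a - (vf der g ^ (n + 1)) a =
      vf der f ((vf der f ^ n) a - (vf der g ^ n) a) + (f - g) * der ((vf der g ^ n) a) := by
    intro n
    rw [pow_succ', pow_succ', Module.End.mul_apply, Module.End.mul_apply, map_sub]
    simp only [vf_apply]
    ring
  have hle : ∀ n, (γ : WithTop Γ) ≤ val ((vf der f ^ n) a - (vf der g ^ n) a) → n ≠ 0 →
      (γ : WithTop Γ) < val ((vf der f ^ (n + 1)) a - (vf der g ^ (n + 1)) a) := by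
    intro n hn hn0
    rw [hstep]
    refine lt_val_add ?_ ?_
    · by_cases h0 : (vf der f ^ n) a - (vf der g ^ n) a = 0
      · rw [h0, map_zero, val_zero]
        exact WithTop.coe_lt_top γ
      · exact hn.trans_lt (contracting_vf hf _ h0)
    · obtain ⟨m, rfl⟩ := Nat.exists_eq_succ_of_ne_zero hn0
      have h1 := val_der_lt hker hH hva ((contracting_vf hg).lt_val_pow_succ m ha)
      obtain ⟨δ, hδ⟩ := exists_val (sub_ne_zero.2 hne)
      rw [← hγ, val_mul, val_mul, hδ]
      exact (WithTop.add_lt_add_iff_left WithTop.coe_ne_top).2 h1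
  have hone : (vf der f ^ 1) a - (vf der g ^ 1) a = (f - g) * der a := by
    rw [pow_one, pow_one, vf_apply, vf_apply, sub_mul]
  have hlt : ∀ n, (γ : WithTop Γ) < val ((vf der f ^ (n + 2)) a - (vf der g ^ (n + 2)) a) := by
    intro n
    induction n with
    | zero => exact hle 1 (by rw [hone, hγ]) one_ne_zero
    | succ n ih => exact hle (n + 2) ih.le (by omega)
  have hs := (hasStrongSum_expOp hcover hreg hf a).sub (hasStrongSum_expOp hcover hreg hg a)
  simp only [← smul_sub] at hs
  rw [h a, sub_self] at hs
  have h1 := hs.lt_val_sub (a := γ) 1 fun n hn => by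
    rcases n with _ | _ | n
    · simp
    · exact absurd rfl hn
    · exact (hlt n).trans_le (val_le_smul _ _)
  rw [hone, Nat.factorial_one, Nat.cast_one, inv_one, one_smul, zero_sub, val_neg, hγ] at h1
  exact lt_irrefl _ h1

omit hH in
theorem isBCHProduct_ssum {f g : limitField C G} (hf : f ∈ ContractiveHull der)
    (hg : g ∈ ContractiveHull der) :
    IsBCHProduct der f g (ssum fun n => bchTerm (bracket der) C f g n) := by
  obtain ⟨a, ha, hva⟩ := exists_val_ne_zero (C := C) hG hcover
  exact (summ_bchTerm hcover hreg hf hg (der_ne_zero hker ha hva)).hasStrongSum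

/-- The group structure on `Cont(∂)` given by the Baker-Campbell-Hausdorff product. Its axioms hold
because `f ↦ exp (f ∂)` is injective and turns the product into composition. -/
@[reducible] noncomputable def bchGroup [CharZero C] : Group (ContractiveHull der) :=
  have hmul := fun a b : ContractiveHull der =>
    isBCHProduct_ssum hcover hreg hker hG a.2 b.2
  letI : Mul (ContractiveHull der) :=
    ⟨fun a b => ⟨_, mem_contractiveHull_of_isBCHProduct a.2 b.2 (hmul a b)⟩⟩
  letI : One (ContractiveHull der) := ⟨⟨0, zero_mem_contractiveHull⟩⟩
  letI : Inv (ContractiveHull der) := ⟨fun a => ⟨-a, neg_mem_contractiveHull a.2⟩⟩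
  have hexp : ∀ (a b : ContractiveHull der) (x : limitField C G),
      expOp (vf der (a * b : ContractiveHull der).1) x =
        expOp (vf der a.1) (expOp (vf der b.1) x) := fun a b x =>
    expOp_vf_of_isBCHProduct hcover hreg a.2 b.2 (hmul a b) x
  have hinj : ∀ a b : ContractiveHull der,
      (∀ x, expOp (vf der a.1) x = expOp (vf der b.1) x) → a = b := fun a b h =>
    Subtype.ext (eq_of_expOp_vf_eq hcover hreg hker hH hG a.2 b.2 h)
  have hone : ∀ x, expOp (vf der (1 : ContractiveHull der).1) x = x :=
    expOp_vf_zero hcover hreg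
  Group.ofLeftAxioms
    (fun a b c => hinj _ _ fun x => by rw [hexp, hexp, hexp, hexp])
    (fun a => hinj _ _ fun x => by rw [hexp, hone])
    (fun a => hinj _ _ fun x => by
      rw [hexp, hone]
      have h := expOp_vf_expOp_vf_neg hcover hreg (neg_mem_contractiveHull a.2) x
      rwa [neg_neg] at h)

theorem isBCHProduct_bchGroup_mul [CharZero C] (a b : ContractiveHull der) :
    IsBCHProduct der a b ((bchGroup hcover hreg hker hH hG).mul a b : ContractiveHull der) :=
  isBCHProduct_ssum hcover hreg hker hG a.2 b.2

end

end Asymptotic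

end HahnLimit

namespace HahnLimit

section Conjugacy

variable {C : Type w} [Field C]
variable {Γ : Type u} [AddCommGroup Γ] [LinearOrder Γ] [IsOrderedAddMonoid Γ]
variable {D : Type v} [Preorder D] [IsDirectedOrder D] [Nonempty D] {G : D →o AddSubgroup Γ}
variable {der : Derivation C (limitField C G) (limitField C G)}

/-! ### Exponentials as automorphisms -/

theorem HasStrongSum.of_succ {F : ℕ → limitField C G} {s : limitField C G}
    (h : HasStrongSum (fun n => F (n + 1)) s) : HasStrongSum F (F 0 + s) := by
  have h1 : HasStrongSum (fun n => if n = 0 then 0 else F n) s := by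
    refine h.fiberwise Nat.succ fun k γ => ?_
    rcases k with _ | k
    · simp
    · rw [finsum_eq_single _ k fun i hi => by simp [hi]]
      simp
  refine ((hasStrongSum_pi_single 0 (F 0)).add h1).congr fun n => ?_
  rcases n with _ | n
  · simp
  · simp

/-- The Leibniz rule for the divided powers of operators with `T (u v) = T u v + u X v`. -/
theorem inv_factorial_smul_pow_mul [CharZero C] {T X : Module.End C (limitField C G)}
    (hT : ∀ a b, T (a * b) = T a * b + a * X b) (a b : limitField C G) (n : ℕ) :
    (Nat.factorial n : C)⁻¹ • (T ^ n) (a * b) =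
      ∑ p ∈ Finset.HasAntidiagonal.antidiagonal n,
        ((Nat.factorial p.1 : C)⁻¹ • (T ^ p.1) a) * ((Nat.factorial p.2 : C)⁻¹ • (X ^ p.2) b) := by
  induction n with
  | zero => simp
  | succ n ih =>
    have hne : ((n : C) + 1) ≠ 0 := by exact_mod_cast Nat.succ_ne_zero n
    have h := smul_sum_antidiagonal_succ (K := C) 0
      (fun i j => ((Nat.factorial i : C)⁻¹ • (T ^ i) a) * ((Nat.factorial j : C)⁻¹ • (X ^ j) b))
      (fun i j => T ((Nat.factorial i : C)⁻¹ • (T ^ i) a) * ((Nat.factorial j : C)⁻¹ • (X ^ j) b))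
      (fun i j => ((Nat.factorial i : C)⁻¹ • (T ^ i) a) * X ((Nat.factorial j : C)⁻¹ • (X ^ j) b))
      (fun i j => by
        rw [add_zero, ← smul_mul_assoc, succ_smul_inv_factorial, map_smul, pow_succ',
          Module.End.mul_apply])
      (fun i j => by
        rw [← mul_smul_comm, succ_smul_inv_factorial, map_smul, pow_succ',
          Module.End.mul_apply]) n
    rw [add_zero, zero_smul, zero_add] at h
    simp only [← hT] at h
    rw [← map_sum, ← ih, map_smul, ← Module.End.mul_apply, ← pow_succ',
      ← succ_smul_inv_factorial] at h
    have h' := congrArg (((n : C) + 1)⁻¹ • ·) h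
    simp only [smul_smul (((n : C) + 1)⁻¹), inv_mul_cancel₀ hne, one_smul] at h'
    exact h'.symm

section

variable (hcover : ∀ γ : Γ, ∃ d, γ ∈ G d) (hreg : IsRegularMap der)
include hcover hreg

theorem expOp_vf_mul [CharZero C] {h : limitField C G} (hh : h ∈ ContractiveHull der)
    (a b : limitField C G) :
    expOp (vf der h) (a * b) = expOp (vf der h) a * expOp (vf der h) b := by
  refine (hasStrongSum_expOp hcover hreg hh (a * b)).unique
    (((hasStrongSum_expOp hcover hreg hh a).mul
      (hasStrongSum_expOp hcover hreg hh b)).antidiagonal.congr fun n => ?_)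
  rw [inv_factorial_smul_pow_mul (vf_mul der h)]

theorem expOp_vf_one {h : limitField C G} (hh : h ∈ ContractiveHull der) :
    expOp (vf der h) 1 = 1 := by
  refine (hasStrongSum_expOp hcover hreg hh 1).unique
    ((hasStrongSum_pi_single 0 1).congr fun n => ?_)
  rcases n with _ | n
  · simp
  · rw [pow_succ, Module.End.mul_apply, vf_apply, Derivation.map_one_eq_zero, mul_zero]
    simp

theorem val_lt_expOp_vf_sub {h : limitField C G} (hh : h ∈ ContractiveHull der)
    {a : limitField C G} (ha : a ≠ 0) : val a < val (expOp (vf der h) a - a) := by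
  obtain ⟨γ, hγ⟩ := exists_val ha
  have := (hasStrongSum_expOp hcover hreg hh a).lt_val_sub (a := γ) 0 fun n hn => by
    obtain ⟨m, rfl⟩ := Nat.exists_eq_succ_of_ne_zero hn
    rw [← hγ]
    exact ((contracting_vf hh).lt_val_pow_succ m ha).trans_le (val_le_smul _ _)
  rw [hγ]
  simpa using this

theorem val_expOp_vf {h : limitField C G} (hh : h ∈ ContractiveHull der) (a : limitField C G) :
    val (expOp (vf der h) a) = val a := by
  by_cases ha : a = 0
  · rw [ha, (hasStrongSum_expOp hcover hreg hh 0).unique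
      ((hasStrongSum_pi_single 0 0).congr fun n => by simp)]
  · refine val_eq_of_lt_val_sub ?_
    rw [val_sub_comm]
    exact val_lt_expOp_vf_sub hcover hreg hh ha

/-! ### The displacement of an exponential -/

/-- The displacement `w = ∑ (h ∂) ^ n k / (n + 1)!` with `h = k g`. If `z` is a formal solution of
`g z' = 1`, then `exp (h ∂) z = z + w`. -/
noncomputable def displacement (der : Derivation C (limitField C G) (limitField C G))
    (g k : limitField C G) : limitField C G :=
  ssum fun n : ℕ => (Nat.factorial (n + 1) : C)⁻¹ • (vf der (k * g) ^ n) k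

theorem hasStrongSum_displacement {g k : limitField C G} (h : k * g ∈ ContractiveHull der) :
    HasStrongSum (fun n : ℕ => (Nat.factorial (n + 1) : C)⁻¹ • (vf der (k * g) ^ n) k)
      (displacement der g k) := by
  refine Summ.hasStrongSum (Summ.smul ?_ _)
  exact summ_of_mem_span_pow hcover hreg (Set.finite_singleton (k * g)) (by simpa using h) k id
    (fun n => by simp) (fun n => vf der (k * g) ^ n) fun n => Submodule.pow_mem_pow _
      (vf_mem_span (T := {k * g}) (Set.mem_singleton (k * g))) n

theorem val_displacement {g k : limitField C G} (h : k * g ∈ ContractiveHull der) (hk : k ≠ 0) :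
    val (displacement der g k) = val k := by
  obtain ⟨γ, hγ⟩ := exists_val hk
  have := (hasStrongSum_displacement hcover hreg h).lt_val_sub (a := γ) 0 fun n hn => by
    obtain ⟨m, rfl⟩ := Nat.exists_eq_succ_of_ne_zero hn
    rw [← hγ]
    exact ((contracting_vf h).lt_val_pow_succ m hk).trans_le (val_le_smul _ _)
  refine val_eq_of_lt_val_sub ?_
  rw [val_sub_comm, hγ]
  simpa using this

/-- The chain rule: `D (exp (h ∂) b) = (1 + D w) exp (h ∂) (D b)` for `D = g ∂` and the
displacement `w`. It holds since `D (h ∂) = T D` for `T = h ∂ + D k`, and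
`T ^ n (u v) = ∑ (n choose i) T ^ i u (h ∂) ^ (n - i) v`. -/
theorem vf_expOp_vf [CharZero C] {g k : limitField C G} (h : k * g ∈ ContractiveHull der)
    (b : limitField C G) :
    vf der g (expOp (vf der (k * g)) b) =
      (1 + vf der g (displacement der g k)) * expOp (vf der (k * g)) (vf der g b) := by
  set X := vf der (k * g) with hX
  set T : Module.End C (limitField C G) := LinearMap.mulLeft C (vf der g k) + X with hT
  have hTapply : ∀ a, T a = vf der g k * a + X a := fun a => rfl
  have hTmul : ∀ a b, T (a * b) = T a * b + a * X b := by
    intro a b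
    rw [hTapply, hTapply, hX, vf_mul]
    ring
  have hXapply : ∀ a, X a = k * vf der g a := fun a => by
    rw [hX, vf_apply, vf_apply, mul_assoc]
  have hcomm : ∀ a, vf der g (X a) = T (vf der g a) := by
    intro a
    rw [hXapply, vf_mul, hTapply, hXapply]
  have hcomm_pow : ∀ n a, vf der g ((X ^ n) a) = (T ^ n) (vf der g a) := by
    intro n a
    induction n with
    | zero => rfl
    | succ n ih =>
      rw [pow_succ', pow_succ', Module.End.mul_apply, Module.End.mul_apply, hcomm, ih]
  have hT1 : ∀ n, (T ^ (n + 1)) 1 = vf der g ((X ^ n) k) := by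
    intro n
    have h1 : T 1 = vf der g k := by
      rw [hTapply, hX, vf_apply _ _ 1, Derivation.map_one_eq_zero, mul_zero, add_zero, mul_one]
    rw [pow_succ, Module.End.mul_apply, h1, hcomm_pow]
  have hsum1 : HasStrongSum (fun n : ℕ => (Nat.factorial n : C)⁻¹ • (T ^ n) 1)
      (1 + vf der g (displacement der g k)) := by
    have h1 : HasStrongSum (fun n : ℕ => (Nat.factorial (n + 1) : C)⁻¹ • (T ^ (n + 1)) 1)
        (vf der g (displacement der g k)) := by
      refine ((stronglyLinear_vf hreg g).map (hasStrongSum_displacement hcover hreg h)).congr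
        fun n => ?_
      rw [hT1, map_smul]
    have h2 := HasStrongSum.of_succ (F := fun n : ℕ => (Nat.factorial n : C)⁻¹ • (T ^ n) 1) h1
    simpa using h2
  have hsum2 := (hsum1.mul (hasStrongSum_expOp hcover hreg h (vf der g b))).antidiagonal
  refine ((stronglyLinear_vf hreg g).map (hasStrongSum_expOp hcover hreg h b)).unique
    (hsum2.congr fun n => ?_)
  rw [map_smul, hcomm_pow, ← one_mul (vf der g b), inv_factorial_smul_pow_mul hTmul, one_mul]

/-- If `exp (h ∂)` intertwines `g ∂` with `f ∂`, then it intertwines their exponentials. -/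
theorem expOp_vf_comm_of_intertwine {f g h : limitField C G} (hf : f ∈ ContractiveHull der)
    (hg : g ∈ ContractiveHull der) (hh : h ∈ ContractiveHull der)
    (hint : ∀ b, vf der f (expOp (vf der h) b) = expOp (vf der h) (vf der g b))
    (a : limitField C G) :
    expOp (vf der f) (expOp (vf der h) a) = expOp (vf der h) (expOp (vf der g) a) := by
  have hpow : ∀ n, (vf der f ^ n) (expOp (vf der h) a) = expOp (vf der h) ((vf der g ^ n) a) := by
    intro n
    induction n with
    | zero => rfl
    | succ n ih => rw [pow_succ', pow_succ', Module.End.mul_apply, ih, hint, Module.End.mul_apply]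
  refine (hasStrongSum_expOp hcover hreg hf _).unique
    ((hasStrongSum_expOp_cols hcover hreg hh hg a).congr fun n => ?_)
  rw [hpow]

variable [CharZero C] (hker : KernelEqConstants der) (hH : IsHAsymptotic der)
  (hG : ∀ d, Nontrivial (G d))
include hker hH hG

/-- Conjugation by `exp (h ∂)` takes `exp (g ∂)` to `exp (f ∂)` if and only if
`f (1 + g w') = g`, where `w` is the displacement. -/
theorem expOp_vf_comm_iff {f g k : limitField C G} (hf : f ∈ ContractiveHull der)
    (hg : g ∈ ContractiveHull der) (hg0 : g ≠ 0) (h : k * g ∈ ContractiveHull der) :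
    (∀ a, expOp (vf der f) (expOp (vf der (k * g)) a) =
      expOp (vf der (k * g)) (expOp (vf der g) a)) ↔
      f * (1 + g * der (displacement der g k)) = g := by
  set E := expOp (vf der (k * g)) with hE
  set u := f * (1 + g * der (displacement der g k)) / g with hu
  have hconj : ∀ b, vf der f (E b) = u * E (vf der g b) := by
    intro b
    have h1 := vf_expOp_vf hcover hreg h b
    have h2 : vf der f (E b) = f / g * vf der g (E b) := by
      rw [vf_apply, vf_apply, ← mul_assoc, div_mul_cancel₀ _ hg0]
    rw [h2, hE, h1, hu, vf_apply _ _ (displacement der g k)]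
    ring
  rw [← div_eq_one_iff_eq hg0, ← hu]
  constructor
  · intro hcomm
    set E' := expOp (vf der (-(k * g))) with hE'
    have hEE' : ∀ a, E (E' a) = a := expOp_vf_expOp_vf_neg hcover hreg h
    have hE'E : ∀ a, E' (E a) = a := fun a => by
      have := expOp_vf_expOp_vf_neg hcover hreg (neg_mem_contractiveHull h) a
      rwa [neg_neg] at this
    have hint : ∀ b, vf der f (E b) = E (vf der (g * E' u) b) := by
      intro b
      have h1 : vf der (g * E' u) b = E' u * vf der g b := by
        rw [vf_apply, vf_apply]
        ring
      rw [hconj, h1, hE, expOp_vf_mul hcover hreg h, ← hE, hEE']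
    have hmem : g * E' u ∈ ContractiveHull der := by
      intro b hb
      rw [← vf_apply, ← val_expOp_vf hcover hreg h (vf der (g * E' u) b), ← hE, ← hint,
        ← val_expOp_vf hcover hreg h b, ← hE]
      refine hf _ fun h0 => hb ?_
      rw [← val_eq_top, ← val_expOp_vf hcover hreg h b, ← hE, h0, val_zero]
    -- `E` intertwines the exponentials of both `g ∂` and `g (E' u) ∂` with that of `f ∂`, so these
    -- two exponentials agree.
    have heq : g * E' u = g := by
      refine eq_of_expOp_vf_eq hcover hreg hker hH hG hmem hg fun a => ?_
      have h1 := expOp_vf_comm_of_intertwine hcover hreg hf hmem h hint a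
      rw [← hE, hcomm a] at h1
      rw [← hE'E (expOp (vf der g) a), h1, hE'E]
    have h1 : E' u = 1 := by
      rwa [mul_eq_left₀ hg0] at heq
    rw [← hEE' u, h1, hE, expOp_vf_one hcover hreg h]
  · intro hu1 a
    refine expOp_vf_comm_of_intertwine hcover hreg hf hg h (fun b => ?_) a
    rw [← hE, hconj, hu1, one_mul]

end

/-! ### Elements with a given displacement -/

/-- Apply the definition of `Cont(∂)` to `w⁻¹`. -/
theorem val_mul_der_pos {g w : limitField C G} (h : g * w ∈ ContractiveHull der) :
    0 < val (g * der w) := by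
  by_cases hw : w = 0
  · rw [hw, map_zero, mul_zero, val_zero]
    exact WithTop.coe_lt_top 0
  · have h1 := h w⁻¹ (inv_ne_zero hw)
    have h2 : g * w * der w⁻¹ = -(g * der w * w⁻¹) := by
      rw [Derivation.leibniz_inv, smul_eq_mul]
      field_simp
    obtain ⟨γ, hγ⟩ := exists_val (inv_ne_zero hw)
    rw [h2, val_neg, val_mul (g * der w), hγ] at h1
    by_contra! h3
    exact absurd h1 (not_lt.2 (by simpa using add_le_add_left h3 (γ : WithTop Γ)))

section

variable (hcover : ∀ γ : Γ, ∃ d, γ ∈ G d) (hreg : IsRegularMap der)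
include hcover hreg

/-- Every `w` with `g w ∈ Cont(∂)` is the displacement of some `exp (k g ∂)`, by the fixed point
theorem. -/
theorem exists_displacement_eq {g w : limitField C G} (h : g * w ∈ ContractiveHull der) :
    ∃ k, k * g ∈ ContractiveHull der ∧ displacement der g k = w := by
  obtain ⟨d, hd⟩ := exists_forall_mem_level (Set.toFinite {g, w})
  have hgd : g ∈ level C G d := hd g (Or.inl rfl)
  have hwd : w ∈ level C G d := hd w (Or.inr rfl)
  set S : Set Γ := {γ | γ ∈ G d ∧ val w ≤ γ} with hS
  have hSiff : ∀ a : limitField C G, (∀ γ, coeffAt γ a ≠ 0 → γ ∈ S) ↔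
      a ∈ level C G d ∧ val w ≤ val a := by
    intro a
    constructor
    · intro h
      refine ⟨mem_level_iff.2 fun γ hγ => (h γ hγ).1, le_val_iff.2 fun γ hγ => ?_⟩
      by_contra h1
      exact absurd (h γ h1).2 (not_le.2 hγ)
    · rintro ⟨h1, h2⟩ γ hγ
      exact ⟨h1 hγ, h2.trans (val_le_of_coeffAt_ne_zero hγ)⟩
  have hcont : ∀ a : limitField C G, val w ≤ val a → a * g ∈ ContractiveHull der := by
    intro a ha
    refine mem_contractiveHull_of_le h ?_
    rw [val_mul, val_mul, add_comm]
    gcongr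
  have hpow_level : ∀ (a : limitField C G), a ∈ level C G d → ∀ n : ℕ,
      (vf der (a * g) ^ n) a ∈ level C G d := by
    intro a ha n
    induction n with
    | zero => exact ha
    | succ n ih =>
      rw [pow_succ', Module.End.mul_apply]
      exact vf_mem_level hreg (mul_mem_level ha hgd) ih
  obtain ⟨k, hk, hfix⟩ := exists_fixed_point (d := d) (S := S) (fun γ hγ => hγ.1)
    (fun k => w - (displacement der g k - k)) (by
      intro a ha
      rw [hSiff] at ha ⊢
      have hs := hasStrongSum_displacement hcover hreg (hcont a ha.2)
      refine ⟨sub_mem_level hwd (sub_mem_level (hs.mem_level fun n =>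
        smul_mem_level _ (hpow_level a ha.1 n)) ha.1), le_val_sub le_rfl (le_val_sub ?_ ha.2)⟩
      exact hs.le_val fun n => (ha.2.trans ((contracting_vf (hcont a ha.2)).le_val_pow n a)).trans
        (val_le_smul _ _)) (by
      intro a b ha hb hab
      rw [hSiff] at ha hb
      obtain ⟨γ, hγ⟩ := exists_val (sub_ne_zero.2 hab)
      have hs := (hasStrongSum_displacement hcover hreg (hcont a ha.2)).sub
        (hasStrongSum_displacement hcover hreg (hcont b hb.2))
      simp only [← smul_sub] at hs
      have hstep : ∀ n : ℕ, (γ : WithTop Γ) ≤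
            val ((vf der (a * g) ^ n) a - (vf der (b * g) ^ n) b) →
          (γ : WithTop Γ) <
            val ((vf der (a * g) ^ (n + 1)) a - (vf der (b * g) ^ (n + 1)) b) := by
        intro n hn
        set c := (vf der (b * g) ^ n) b with hc
        have h1 : (vf der (a * g) ^ (n + 1)) a - (vf der (b * g) ^ (n + 1)) b =
            vf der (a * g) ((vf der (a * g) ^ n) a - c) + (a - b) * (g * der c) := by
          rw [pow_succ', pow_succ', Module.End.mul_apply, Module.End.mul_apply, map_sub, ← hc]
          simp only [vf_apply]
          ring
        rw [h1]
        refine lt_val_add ?_ ?_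
        · by_cases h0 : (vf der (a * g) ^ n) a - c = 0
          · rw [h0, map_zero, val_zero]
            exact WithTop.coe_lt_top γ
          · exact hn.trans_lt (contracting_vf (hcont a ha.2) _ h0)
        · have h2 : 0 < val (g * der c) := by
            refine val_mul_der_pos ?_
            rw [mul_comm]
            exact hcont c (hb.2.trans ((contracting_vf (hcont b hb.2)).le_val_pow n b))
          rw [val_mul, hγ]
          have h3 := (WithTop.add_lt_add_iff_left (x := (γ : WithTop Γ)) WithTop.coe_ne_top).2 h2
          rwa [add_zero] at h3
      have hle : ∀ n : ℕ, (γ : WithTop Γ) ≤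
          val ((vf der (a * g) ^ n) a - (vf der (b * g) ^ n) b) := by
        intro n
        induction n with
        | zero => exact hγ.ge
        | succ n ih => exact (hstep n ih).le
      have h4 := hs.lt_val_sub (a := γ) 0 fun n hn => by
        obtain ⟨m, rfl⟩ := Nat.exists_eq_succ_of_ne_zero hn
        exact (hstep m (hle m)).trans_le (val_le_smul _ _)
      have h5 : w - (displacement der g a - a) - (w - (displacement der g b - b)) =
          -(displacement der g a - displacement der g b - (a - b)) := by ring
      rw [h5, val_neg, hγ]
      simpa using h4)
  rw [hSiff] at hk
  refine ⟨k, hcont k hk.2, ?_⟩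
  linear_combination -hfix

end

end Conjugacy

end HahnLimit

namespace HahnLimit

section Integration

variable {C : Type w} [Field C]
variable {Γ : Type u} [AddCommGroup Γ] [LinearOrder Γ] [IsOrderedAddMonoid Γ]
variable {D : Type v} [Preorder D] [IsDirectedOrder D] [Nonempty D] {G : D →o AddSubgroup Γ}
variable {der : Derivation C (limitField C G) (limitField C G)}

/-! ### Integration -/

/-- An integral may be changed by a constant so as not to have valuation `0`. -/
theorem exists_val_ne_zero_der_eq (a : limitField C G) :
    ∃ b : limitField C G, val b ≠ 0 ∧ der b = der a := by
  by_cases ha : val a = 0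
  · obtain ⟨c, -, h⟩ := exists_lt_val_sub_smul (f := 1) (g := a) one_ne_zero (by rw [val_one, ha])
    rw [val_one] at h
    exact ⟨a - c • 1, h.ne', by rw [map_sub, der_smul_one, sub_zero]⟩
  · exact ⟨a, ha, rfl⟩

theorem not_isPseudoGap (hcover : ∀ γ : Γ, ∃ d, γ ∈ G d)
    (hint : ClosedUnderAsymptoticIntegration der) (δ : Γ) : ¬ IsPseudoGap der δ := by
  have hδ := val_term (C := C) hcover δ one_ne_zero
  obtain ⟨A, hA⟩ := hint (term hcover δ 1) (ne_zero_of_val hδ)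
  have hA' := val_eq_of_lt_val_sub hA
  rw [hδ] at hA'
  obtain ⟨B, hB, hBA⟩ := exists_val_ne_zero_der_eq (der := der) A
  rw [← hBA] at hA'
  have hB0 : B ≠ 0 := by
    rintro rfl
    simp at hA'
  obtain ⟨β, hβ⟩ := exists_val hB0
  refine not_not.2 ⟨β, Set.mem_univ _, ?_, B, hβ, hA'.symm⟩
  rintro rfl
  exact hB hβ

/-- Every series has an integral: for `q ∈ 𝕊_d`, regular asymptotic integration gives a strongly
linear approximate right inverse of `∂` on `𝕊_d`, by which the equation `∂ w = q` becomes a fixed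
point equation. -/
theorem exists_der_eq (hcover : ∀ γ : Γ, ∃ d, γ ∈ G d) (hreg : IsRegularMap der)
    (hker : KernelEqConstants der) (hH : IsHAsymptotic der)
    (hint : HasRegularAsymptoticIntegration der) (q : limitField C G) :
    ∃ w, val w ≠ 0 ∧ der w = q := by
  suffices h : ∃ w, der w = q by
    obtain ⟨w, rfl⟩ := h
    exact exists_val_ne_zero_der_eq w
  obtain ⟨d, hqd⟩ := exists_mem_level q
  obtain ⟨d₁, -, hd₁⟩ := hint.2 d
  -- The term `τ δ` with exponent `e δ` is an approximate integral of `t ^ δ`.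
  have hτ : ∀ δ : Γ, ∃ τ : limitField C G, ∃ e : Γ, ∃ c : C, δ ∈ G d → τ ∈ level C G d₁ ∧
      (τ : HahnSeries Γ C) = HahnSeries.single e c ∧ der τ ∈ level C G d ∧
      Asymp (der τ) (term hcover δ 1) := by
    intro δ
    by_cases hδ : δ ∈ G d
    · obtain ⟨τ, h1, ⟨e, c, h2⟩, h3, h4⟩ := hd₁ (term hcover δ 1) (term_mem_level hcover hδ 1)
        (ne_zero_of_val (val_term hcover δ one_ne_zero))
        (fun γ _ => not_isPseudoGap hcover hint.1 γ)
      exact ⟨τ, e, c, fun _ => ⟨h1, h2, h3, h4⟩⟩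
    · exact ⟨0, 0, 0, fun h => absurd h hδ⟩
  choose τ e c hτ using hτ
  have hderval : ∀ δ ∈ G d, val (der (τ δ)) = δ := fun δ hδ => by
    rw [← val_eq_of_lt_val_sub (hτ δ hδ).2.2.2, val_term hcover δ one_ne_zero]
  have hcoeff : ∀ δ ∈ G d, ∀ γ, coeffAt γ (τ δ) ≠ 0 → γ = e δ := by
    intro δ hδ γ hγ
    by_contra hne
    rw [coeffAt_apply, (hτ δ hδ).2.1] at hγ
    exact hγ (HahnSeries.coeff_single_of_ne hne)
  have hval : ∀ δ ∈ G d, val (τ δ) = e δ := by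
    intro δ hδ
    obtain ⟨γ, hγ⟩ := exists_val (f := τ δ) (by
      intro h
      have := hderval δ hδ
      rw [h, map_zero, val_zero] at this
      exact WithTop.coe_ne_top this.symm)
    rw [hγ, hcoeff δ hδ γ (coeffAt_ne_zero_of_val hγ)]
  have hval0 : ∀ δ ∈ G d, val (τ δ) ≠ 0 := by
    intro δ hδ h
    have he : e δ = 0 := by exact_mod_cast (hval δ hδ).symm.trans h
    have h1 : τ δ = c δ • 1 := by
      have h2 : τ δ = term hcover 0 (c δ) := Subtype.ext (by rw [(hτ δ hδ).2.1, he]; rfl)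
      have h3 : (1 : limitField C G) = term hcover 0 1 := Subtype.ext rfl
      rw [h2, h3, ← term_smul, mul_one]
    have h2 := hderval δ hδ
    rw [h1, der_smul_one, val_zero] at h2
    exact WithTop.coe_ne_top h2.symm
  -- As `e` is strictly increasing, `I : a ↦ ∑ a_δ τ δ` is defined on `𝕊_d`.
  have hmono : StrictMonoOn e (G d : Set Γ) := by
    intro δ hδ ε hε h
    have := val_lt_of_val_der_lt hker hH (a := τ δ) (b := τ ε) (hval0 ε hε) (by
      rw [hderval δ hδ, hderval ε hε]
      exact WithTop.coe_lt_coe.2 h)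
    rw [hval δ hδ, hval ε hε] at this
    exact WithTop.coe_lt_coe.1 this
  have hsupp : ∀ a ∈ level C G d, ∀ δ γ, coeffAt γ (coeffAt δ a • τ δ) ≠ 0 →
      coeffAt δ a ≠ 0 ∧ δ ∈ G d ∧ γ = e δ := by
    intro a ha δ γ h
    rw [map_smul, smul_eq_mul] at h
    have h1 := left_ne_zero_of_mul h
    exact ⟨h1, ha h1, hcoeff δ (ha h1) γ (right_ne_zero_of_mul h)⟩
  have hlev : ∀ a ∈ level C G d, ∀ δ, coeffAt δ a • τ δ ∈ level C G d₁ := by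
    intro a ha δ
    by_cases h : coeffAt δ a = 0
    · rw [h, zero_smul]
      exact zero_mem_level d₁
    · exact smul_mem_level _ (hτ δ (ha h)).1
  have hsumm : ∀ a ∈ level C G d, Summ fun δ => coeffAt δ a • τ δ := by
    refine fun a ha => ⟨⟨d₁, hlev a ha⟩, ?_, fun γ => ?_⟩
    · refine ((isPWO_support a).image_of_monotoneOn (f := e) fun δ hδ ε hε h =>
        hmono.monotoneOn (ha hδ) (ha hε) h).mono ?_
      rintro γ ⟨δ, hδ⟩
      obtain ⟨h1, -, rfl⟩ := hsupp a ha δ γ hδ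
      exact ⟨δ, h1, rfl⟩
    · refine Set.Subsingleton.finite fun δ hδ ε hε => ?_
      obtain ⟨-, h1, h2⟩ := hsupp a ha δ γ hδ
      obtain ⟨-, h3, h4⟩ := hsupp a ha ε γ hε
      exact hmono.injOn h1 h3 (h2.symm.trans h4)
  set I : limitField C G → limitField C G := fun a => ssum fun δ => coeffAt δ a • τ δ
  have hI : ∀ a ∈ level C G d, HasStrongSum (fun δ => coeffAt δ a • τ δ) (I a) :=
    fun a ha => (hsumm a ha).hasStrongSum
  have hder : ∀ a ∈ level C G d,
      HasStrongSum (fun δ => coeffAt δ a • der (τ δ)) (der (I a)) := fun a ha =>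
    ((hreg d₁).2 Γ _ _ (hlev a ha) (hI a ha)).congr fun δ => by rw [Derivation.map_smul]
  have happrox : ∀ a ∈ level C G d, a ≠ 0 → val a < val (der (I a) - a) := by
    intro a ha ha0
    obtain ⟨α, hα⟩ := exists_val ha0
    rw [hα]
    refine ((hder a ha).sub (hasStrongSum_term hcover a)).lt_val fun δ => ?_
    have h1 : term hcover δ (coeffAt δ a) = coeffAt δ a • term hcover δ 1 := by
      rw [← term_smul, mul_one]
    rw [h1, ← smul_sub]
    by_cases h : coeffAt δ a = 0
    · rw [h, zero_smul, val_zero]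
      exact WithTop.coe_lt_top α
    · have h2 : (α : WithTop Γ) ≤ δ := hα ▸ val_le_of_coeffAt_ne_zero h
      have h3 := (hτ δ (ha h)).2.2.2
      rw [Asymp, hderval δ (ha h)] at h3
      exact (h2.trans_lt h3).trans_le (val_le_smul _ _)
  have hIsub : ∀ a ∈ level C G d, ∀ b ∈ level C G d, I (a - b) = I a - I b := by
    intro a ha b hb
    refine (hI (a - b) (sub_mem_level ha hb)).unique
      (((hI a ha).sub (hI b hb)).congr fun δ => ?_)
    rw [map_sub, sub_smul]
  -- If `p` is fixed by `p ↦ q + p - ∂ (I p)`, then `∂ (I p) = q`.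
  obtain ⟨p, hp, hfix⟩ := exists_fixed_point (C := C) (d := d) (S := {γ | γ ∈ G d})
    (fun γ hγ => hγ) (fun p => q + p - der (I p))
    (fun a ha => by
      refine sub_mem_level (add_mem_level hqd ha) ((hder a ha).mem_level fun δ => ?_)
      by_cases h : coeffAt δ a = 0
      · rw [h, zero_smul]
        exact zero_mem_level d
      · exact smul_mem_level _ (hτ δ (ha δ h)).2.2.1)
    (fun a b ha hb hab => by
      have h := happrox (a - b) (sub_mem_level ha hb) (sub_ne_zero.2 hab)
      rw [hIsub a ha b hb, map_sub, ← val_neg (_ - (a - b))] at h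
      refine h.trans_eq (congrArg val ?_)
      ring)
  exact ⟨I p, by linear_combination -hfix⟩

end Integration

end HahnLimit

namespace HahnLimit

section Criteria

variable {C : Type w} [Field C]
variable {Γ : Type u} [AddCommGroup Γ] [LinearOrder Γ] [IsOrderedAddMonoid Γ]
variable {D : Type v} [Preorder D] [IsDirectedOrder D] [Nonempty D] {G : D →o AddSubgroup Γ}
variable {der : Derivation C (limitField C G) (limitField C G)}

/-! ### The criteria for conjugacy -/

theorem val_mul_lt_val_mul_iff {a b c : limitField C G} (ha : a ≠ 0) :
    val (a * b) < val (a * c) ↔ val b < val c := by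
  obtain ⟨α, hα⟩ := exists_val ha
  rw [val_mul, val_mul, hα]
  exact WithTop.add_lt_add_iff_left WithTop.coe_ne_top

theorem val_div_lt_iff {a b c : limitField C G} (hb : b ≠ 0) :
    val (a / b) < val c ↔ val a < val (b * c) := by
  rw [← val_mul_lt_val_mul_iff hb, mul_div_cancel₀ a hb]

/-- Membership in `Cont(∂)` need only be tested on infinitesimal elements: pass from `a` to `a⁻¹`, or
subtract a constant. -/
theorem mem_contractiveHull_of_pos {f : limitField C G}
    (h : ∀ a : limitField C G, a ≠ 0 → 0 < val a → val a < val (f * der a)) :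
    f ∈ ContractiveHull der := by
  intro a ha
  rcases lt_trichotomy (val a) 0 with h0 | h0 | h0
  · obtain ⟨α, hα⟩ := exists_val ha
    have h1 : (0 : WithTop Γ) < val a⁻¹ := by
      rw [hα] at h0
      rw [val_inv hα]
      exact_mod_cast neg_pos.2 (WithTop.coe_lt_coe.1 h0)
    have h2 := h a⁻¹ (inv_ne_zero ha) h1
    rw [← val_mul_lt_val_mul_iff (pow_ne_zero 2 ha), ← val_neg (a ^ 2 * (f * der a⁻¹))] at h2
    have h3 : a ^ 2 * a⁻¹ = a := by field_simp
    have h4 : -(a ^ 2 * (f * der a⁻¹)) = f * der a := by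
      rw [Derivation.leibniz_inv, smul_eq_mul]
      field_simp
    rwa [h3, h4] at h2
  · obtain ⟨c, -, hc⟩ := exists_lt_val_sub_smul (f := 1) (g := a) one_ne_zero (by rw [val_one, h0])
    have hder : der (a - c • 1) = der a := by rw [map_sub, der_smul_one, sub_zero]
    rw [h0]
    rw [val_one] at hc
    rw [← hder]
    by_cases hb : a - c • 1 = 0
    · rw [hb, map_zero, mul_zero, val_zero]
      exact WithTop.coe_lt_top 0
    · exact hc.trans (h _ hb hc)
  · exact h a ha h0

/-- The elements `k g ∈ Cont(∂)` conjugating `f` to `g` are described by their displacements `w`,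
for which conjugacy becomes the linear equation `f (1 + g ∂ w) = g`. -/
theorem isConj_iff_exists_der [CharZero C] (hcover : ∀ γ : Γ, ∃ d, γ ∈ G d)
    (hreg : IsRegularMap der) (hker : KernelEqConstants der) (hH : IsHAsymptotic der)
    (hG : ∀ d, Nontrivial (G d)) {f g : limitField C G} (hf : f ∈ ContractiveHull der)
    (hg : g ∈ ContractiveHull der) (hg0 : g ≠ 0) :
    letI := bchGroup hcover hreg hker hH hG
    IsConj (⟨f, hf⟩ : ContractiveHull der) ⟨g, hg⟩ ↔
      ∃ w, g * w ∈ ContractiveHull der ∧ f * (1 + g * der w) = g := by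
  let := bchGroup hcover hreg hker hH hG
  have hexp : ∀ (a b : ContractiveHull der) (x : limitField C G),
      expOp (vf der (a * b : ContractiveHull der).1) x =
        expOp (vf der a.1) (expOp (vf der b.1) x) := fun a b x =>
    expOp_vf_of_isBCHProduct hcover hreg a.2 b.2
      (isBCHProduct_bchGroup_mul hcover hreg hker hH hG a b) x
  have hcomm : ∀ h : ContractiveHull der,
      (⟨f, hf⟩ : ContractiveHull der) * h = h * ⟨g, hg⟩ ↔
        ∀ a, expOp (vf der f) (expOp (vf der h.1) a) =
          expOp (vf der h.1) (expOp (vf der g) a) := by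
    intro h
    constructor
    · intro heq a
      have h1 := hexp ⟨f, hf⟩ h a
      rw [heq, hexp] at h1
      exact h1.symm
    · intro heq
      refine Subtype.ext (eq_of_expOp_vf_eq hcover hreg hker hH hG (Subtype.property _)
        (Subtype.property _) fun a => ?_)
      rw [hexp, hexp, heq]
  have hconj : IsConj (⟨f, hf⟩ : ContractiveHull der) ⟨g, hg⟩ ↔
      ∃ h : ContractiveHull der, (⟨f, hf⟩ : ContractiveHull der) * h = h * ⟨g, hg⟩ := by
    rw [isConj_comm, isConj_iff]
    exact exists_congr fun h => by rw [mul_inv_eq_iff_eq_mul, eq_comm]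
  rw [hconj]
  constructor
  · rintro ⟨h, hh⟩
    have hk : h.1 / g * g = h.1 := div_mul_cancel₀ h.1 hg0
    have hkc : h.1 / g * g ∈ ContractiveHull der := hk.symm ▸ h.2
    refine ⟨displacement der g (h.1 / g), ?_, ?_⟩
    · by_cases hk0 : h.1 / g = 0
      · have h1 : displacement der g (h.1 / g) = 0 :=
          (hasStrongSum_displacement hcover hreg hkc).unique
            ((hasStrongSum_pi_single 0 0).congr fun n => by
              rw [hk0, map_zero, smul_zero]
              simp)
        rw [h1, mul_zero]
        exact zero_mem_contractiveHull
      · refine mem_contractiveHull_of_le hkc (le_of_eq ?_)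
        rw [val_mul g, val_displacement hcover hreg hkc hk0, val_mul (h.1 / g), add_comm]
    · rw [← expOp_vf_comm_iff hcover hreg hker hH hG hf hg hg0 hkc, hk]
      exact (hcomm h).1 hh
  · rintro ⟨w, hw, hfw⟩
    obtain ⟨k, hk, rfl⟩ := exists_displacement_eq hcover hreg hw
    exact ⟨⟨k * g, hk⟩, (hcomm _).2
      ((expOp_vf_comm_iff hcover hreg hker hH hG hf hg hg0 hk).2 hfw)⟩

/-- The equation `f (1 + g ∂ w) = g` can be solved for `w` by integration, and determines `w` up to a
constant. The condition `g w ∈ Cont(∂)` says that `w ≺ h / (g ∂ h)` for all nonzero `h ≺ 1`. Since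
`h / (g ∂ h)` is infinite, and `w` may be chosen not to have valuation `0`, this is equivalent to
`∂ w ≺ ∂ (h / (g ∂ h))`. -/
theorem exists_der_iff_forall_val_lt (hcover : ∀ γ : Γ, ∃ d, γ ∈ G d) (hreg : IsRegularMap der)
    (hker : KernelEqConstants der) (hH : IsHAsymptotic der)
    (hint : HasRegularAsymptoticIntegration der) {f g : limitField C G}
    (hg : g ∈ ContractiveHull der) (hf0 : f ≠ 0) (hg0 : g ≠ 0) :
    (∃ w, g * w ∈ ContractiveHull der ∧ f * (1 + g * der w) = g) ↔
      val g < val (f - g) ∧ ∀ h : limitField C G, h ≠ 0 → 0 < val h →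
        val (g ^ 2 * der (h / (g * der h))) < val (f - g) := by
  have hval : ∀ q, val f = val g → f * (1 + g * q) = g → val (f - g) = val (g ^ 2 * q) := by
    intro q hfg h
    have h1 : f - g = -(f * (g * q)) := by linear_combination h
    rw [h1, val_neg, val_mul, hfg, ← val_mul, pow_two, mul_assoc]
  have hne : ∀ h : limitField C G, h ≠ 0 → 0 < val h → g * der h ≠ 0 := fun h hh hv =>
    mul_ne_zero hg0 (der_ne_zero hker hh hv.ne')
  constructor
  · rintro ⟨w, hw, hfw⟩
    have hpos := val_mul_der_pos hw
    have hfg : val f = val g := by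
      rw [← hfw, val_mul, val_add_eq_left (by rwa [val_one]), val_one, add_zero]
    rw [hval _ hfg hfw]
    constructor
    · have h1 : g ^ 2 * der w = g * (g * der w) := by ring
      have h2 : val (g * 1) < val (g * (g * der w)) := by
        rwa [val_mul_lt_val_mul_iff hg0, val_one]
      rwa [mul_one, ← h1] at h2
    · intro h hh hv
      rw [val_mul_lt_val_mul_iff (pow_ne_zero 2 hg0)]
      refine val_der_lt hker hH (ne_of_lt ?_) ?_
      · rw [← val_one (C := C) (G := G), val_div_lt_iff (hne h hh hv), mul_one]
        exact hg h hh
      · rw [val_div_lt_iff (hne h hh hv)]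
        have h1 := hw h hh
        rwa [mul_right_comm] at h1
  · rintro ⟨h1, h2⟩
    have hfg : val f = val g := by
      rw [val_sub_comm] at h1
      exact val_eq_of_lt_val_sub h1
    obtain ⟨w, hw0, hw⟩ := exists_der_eq hcover hreg hker hH hint ((g - f) / (f * g))
    have hfw : f * (1 + g * der w) = g := by
      rw [hw]
      field_simp
      ring
    refine ⟨w, mem_contractiveHull_of_pos fun h hh hv => ?_, hfw⟩
    have h3 := h2 h hh hv
    rw [hval _ hfg hfw, val_mul_lt_val_mul_iff (pow_ne_zero 2 hg0)] at h3
    have h4 := val_lt_of_val_der_lt hker hH hw0 h3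
    rwa [val_div_lt_iff (hne h hh hv), mul_right_comm] at h4

theorem asymp_iff {f g : limitField C G} : Asymp f g ↔ val g < val (f - g) := by
  constructor
  · intro h
    rwa [val_eq_of_lt_val_sub h]
  · intro h
    have h1 := val_eq_of_lt_val_sub (f := g) (g := f) (by rwa [val_sub_comm])
    rwa [Asymp, h1]

theorem val_div_mul_der {b g : limitField C G} (hg0 : g ≠ 0) {ψ : Γ}
    (hψ : val (der b / b) = ψ) :
    val (b / (g * der b)) = ((-(g : HahnSeries Γ C).order - ψ : Γ) : WithTop Γ) := by
  have hg : val g = ((g : HahnSeries Γ C).order : Γ) :=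
    (HahnSeries.order_eq_orderTop_of_ne_zero (by simpa using hg0)).symm
  have h1 : b / (g * der b) = (g * (der b / b))⁻¹ := by rw [mul_div_assoc', inv_div]
  rw [h1, val_inv (γ := (g : HahnSeries Γ C).order + ψ) (by rw [val_mul, hg, hψ, WithTop.coe_add]),
    neg_add']

/-- The set `(- v g - Ψ)'` consists of the valuations of the `∂ (h / (g ∂ h))` with `h ≺ 1`. -/
theorem forall_derivImage_lt_iff (hker : KernelEqConstants der) (hH : IsHAsymptotic der)
    {f g : limitField C G} (hg : g ∈ ContractiveHull der) (hg0 : g ≠ 0) :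
    (∀ δ ∈ derivImage der {γ | ∃ ψ ∈ PsiSet der, γ = -(g : HahnSeries Γ C).order - ψ},
      (δ : WithTop Γ) < val ((f - g) / g ^ 2)) ↔
    ∀ h : limitField C G, h ≠ 0 → 0 < val h →
      val (g ^ 2 * der (h / (g * der h))) < val (f - g) := by
  have hdiv : ∀ q, val (g ^ 2 * q) < val (f - g) ↔ val q < val ((f - g) / g ^ 2) := by
    intro q
    rw [← val_mul_lt_val_mul_iff (b := q) (pow_ne_zero 2 hg0),
      mul_div_cancel₀ _ (pow_ne_zero 2 hg0)]
  simp only [hdiv]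
  constructor
  · intro H h hh hv
    have hh' := der_ne_zero hker hh hv.ne'
    obtain ⟨η, hη⟩ := exists_val hh
    obtain ⟨ψ, hψ⟩ := exists_val (div_ne_zero hh' hh)
    have hx := val_div_mul_der hg0 hψ
    have hx0 : val (h / (g * der h)) ≠ 0 := by
      refine ne_of_lt ?_
      rw [← val_one (C := C) (G := G), val_div_lt_iff (mul_ne_zero hg0 hh'), mul_one]
      exact hg h hh
    obtain ⟨δ, hδ⟩ := exists_val (der_ne_zero hker
      (div_ne_zero hh (mul_ne_zero hg0 hh')) hx0)
    rw [hδ]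
    refine H δ ⟨_, ⟨ψ, ⟨η, ?_, h, hη, hψ⟩, rfl⟩, ?_, _, hx, hδ⟩
    · rw [hη] at hv
      exact_mod_cast hv
    · intro h0
      rw [hx, h0] at hx0
      exact hx0 rfl
  · rintro H δ ⟨γ, ⟨ψ, ⟨η, hη0, b, hη, hψ⟩, rfl⟩, hγ0, a, ha, hδ⟩
    rw [← hδ, val_der_eq hker hH (by rw [ha]; exact_mod_cast hγ0)
      (ha.trans (val_div_mul_der hg0 hψ).symm)]
    exact H b (ne_zero_of_val hη) (by rw [hη]; exact_mod_cast hη0)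

end Criteria

end HahnLimit

theorem mainTheorem1 {C : Type w} [Field C] [CharZero C]
    {Γ : Type u} [AddCommGroup Γ] [LinearOrder Γ] [IsOrderedAddMonoid Γ]
    {D : Type v} [Preorder D] [IsDirectedOrder D] [Nonempty D]
    (G : D →o AddSubgroup Γ) (hG : ∀ d, Nontrivial (G d)) (hcover : ∀ γ : Γ, ∃ d, γ ∈ G d)
    (der : Derivation C (limitField C G) (limitField C G))
    (hreg : IsRegularMap der) (hker : KernelEqConstants der) (hH : IsHAsymptotic der)
    (hint : HasRegularAsymptoticIntegration der) :
    ∃ _ : Group (ContractiveHull der),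
      (∀ a b : ContractiveHull der, IsBCHProduct der a b (a * b : ContractiveHull der)) ∧
      ∀ (f g : limitField C G) (hf : f ∈ ContractiveHull der) (hg : g ∈ ContractiveHull der), f ≠ 0 → g ≠ 0 →
        (IsConj (⟨f, hf⟩ : ContractiveHull der) ⟨g, hg⟩ ↔
          Asymp f g ∧
            ∀ δ ∈ derivImage der {γ | ∃ ψ ∈ PsiSet der, γ = -(g : HahnSeries Γ C).order - ψ},
              (δ : WithTop Γ) < val ((f - g) / g ^ 2)) ∧
        (IsConj (⟨f, hf⟩ : ContractiveHull der) ⟨g, hg⟩ ↔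
          val g < val (f - g) ∧
            ∀ h : limitField C G, h ≠ 0 → 0 < val h →
              val (g ^ 2 * der (h / (g * der h))) < val (f - g)) := by
  refine ⟨bchGroup hcover hreg hker hH hG, isBCHProduct_bchGroup_mul hcover hreg hker hH hG,
    fun f g hf hg hf0 hg0 => ?_⟩
  have h := (isConj_iff_exists_der hcover hreg hker hH hG hf hg hg0).trans
    (exists_der_iff_forall_val_lt hcover hreg hker hH hint hg hf0 hg0)
  exact ⟨h.trans (and_congr asymp_iff.symm (forall_derivImage_lt_iff hker hH hg hg0).symm), h⟩
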